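/- **Theorem 4.2.** Let $C$ and $D$ be coalgebras over a field $k$, let $\Lambda\in{}^D\mathcal M^C$ be a $(D,C)$-bicomodule (left $D$-comodule and right $C$-comodule with commuting coactions) and let $X\in{}^C\mathcal M^D$ be a $(C,D)$-bicomodule. *Notation.* $\mathcal M^C$ and ${}^C\mathcal M$ are the categories of right and left $C$-comodules, and $M\,\square_C N=\ker(\rho_M\otimes I_N-I_M\otimes\rho_N)\subseteq M\otimes N$ is the cotensor product of a right $C$-comodule $M$ and a left $C$-comodule $N$. A right (left) comodule $P$ is *quasifinite* if the space of colinear maps $V\to P$ is finite dimensional for every finite dimensional right (left) comodule $V$. If $\Lambda$ is quasifinite as a right $C$-comodule, then $-\square_D\Lambda:\mathcal M^D\to\mathcal M^C$ has a left adjoint, the co-Hom functor $h_C(\Lambda,-):\mathcal M^C\to\mathcal M^D$. Then $h_C(\Lambda,C)$ is a $(C,D)$-bicomodule: writing $\eta_C:C\to h_C(\Lambda,C)\,\square_D\Lambda$ for the unit of the adjunction at $C$, its left $C$-coaction $\lambda$ is the unique linear map with $(\lambda\otimes I_\Lambda)\circ\eta_C=(I_C\otimes\eta_C)\circ\Delta_C$.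 Symmetrically, if $X$ is quasifinite as a left $C$-comodule, then $X\,\square_D-:{}^D\mathcal M\to{}^C\mathcal M$ has a left adjoint ${}_Ch(X,-):{}^C\mathcal M\to{}^D\mathcal M$, and ${}_Ch(X,C)$ is a $(D,C)$-bicomodule. Consider the following properties. 1. $(-\square_C X:\mathcal M^C\to\mathcal M^D,\ -\square_D\Lambda:\mathcal M^D\to\mathcal M^C)$ is an adjoint pair of functors (the first one being the left adjoint). 2. $(\Lambda\,\square_C-:{}^C\mathcal M\to{}^D\mathcal M,\ X\,\square_D-:{}^D\mathcal M\to{}^C\mathcal M)$ is an adjoint pair of functors (the first one being the left adjoint). 3. $\Lambda$ is quasifinite as a right $C$-comodule, and the functors $-\square_C X$ and $h_C(\Lambda,-)$ are naturally isomorphic. 4. $X$ is quasifinite as a left $C$-comodule, and the functors $\Lambda\,\square_C-$ and ${}_Ch(X,-)$ are naturally isomorphic. 5. There exist bicolinear maps $\psi:C\to X\,\square_D\Lambda$ in ${}^C\mathcal M^C$ and $\omega:\Lambda\,\square_C X\to D$ in ${}^D\mathcal M^D$ such that $$(\omega\,\square_D I_\Lambda)\circ(I_\Lambda\,\square_C\psi)=I_\Lambda,\qquad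 (I_X\,\square_D\,\omega)\circ(\psi\,\square_C I_X)=I_X,$$ where the canonical isomorphisms $\Lambda\cong\Lambda\,\square_C C\cong D\,\square_D\Lambda$, $X\cong C\,\square_C X\cong X\,\square_D D$ and the associativity isomorphisms of the cotensor product are understood. 6. $\Lambda$ is quasifinite and injective as a right $C$-comodule, and $X\cong h_C(\Lambda,C)$ in ${}^C\mathcal M^D$. 7. $X$ is quasifinite and injective as a left $C$-comodule, and $\Lambda\cong{}_Ch(X,C)$ in ${}^D\mathcal M^C$. Then properties 1–5 are equivalent. Property 6 implies 1–5, and property 7 implies 1–5. If $X$ is quasifinite as a right $D$-comodule, then 1–5 imply 6. If $\Lambda$ is quasifinite as a left $D$-comodule, then 1–5 imply 7. -/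

import Mathlib

open CategoryTheory TensorProduct

universe u

namespace MoritaTakeuchi

noncomputable section

set_option linter.unusedSectionVars false

variable {k : Type u} [Field k]
variable {C : Type u} [AddCommGroup C] [Module k C] [Coalgebra k C]
variable {D : Type u} [AddCommGroup D] [Module k D] [Coalgebra k D]
variable {E : Type u} [AddCommGroup E] [Module k E] [Coalgebra k E]

/-! ### Linear algebra over a field -/

section Semi

variable {P Q N S : Type u} [AddCommMonoid P] [Module k P]
  [AddCommMonoid Q] [Module k Q] [AddCommGroup N] [Module k N] [AddCommMonoid S] [Module k S]

theorem rTensor_inj {f : P →ₗ[k] Q} (hf : Function.Injective f) :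
    Function.Injective (f.rTensor N) :=
  Module.Flat.rTensor_preserves_injective_linearMap f hf

theorem lTensor_inj {f : P →ₗ[k] Q} (hf : Function.Injective f) :
    Function.Injective (f.lTensor N) :=
  Module.Flat.lTensor_preserves_injective_linearMap f hf

/-- Corestriction of a linear map along an injective linear map. -/
def lift (i : S →ₗ[k] Q) (hi : Function.Injective i) (f : P →ₗ[k] Q)
    (h : ∀ x, f x ∈ LinearMap.range i) : P →ₗ[k] S :=
  (LinearEquiv.ofInjective i hi).symm.toLinearMap ∘ₗ f.codRestrict _ h

@[simp] theorem lift_spec (i : S →ₗ[k] Q) (hi : Function.Injective i) (f : P →ₗ[k] Q)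
    (h : ∀ x, f x ∈ LinearMap.range i) (x : P) : i (lift i hi f h x) = f x := by
  have := LinearEquiv.apply_symm_apply (LinearEquiv.ofInjective i hi) (f.codRestrict _ h x)
  exact congrArg Subtype.val this

end Semi

section LinAlg

variable {P Q N S : Type u} [AddCommGroup P] [Module k P]
  [AddCommGroup Q] [Module k Q] [AddCommGroup N] [Module k N] [AddCommGroup S] [Module k S]

theorem mem_range_rTensor_ker (f : P →ₗ[k] Q) (t : P ⊗[k] N) :
    t ∈ LinearMap.range (f.ker.subtype.rTensor N) ↔ f.rTensor N t = 0 :=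
  ((Module.Flat.rTensor_exact N (LinearMap.exact_subtype_ker_map f)) t).symm

theorem mem_range_lTensor_ker (f : P →ₗ[k] Q) (t : N ⊗[k] P) :
    t ∈ LinearMap.range (f.ker.subtype.lTensor N) ↔ f.lTensor N t = 0 :=
  ((Module.Flat.lTensor_exact N (LinearMap.exact_subtype_ker_map f)) t).symm

end LinAlg

/-! ### Naturality of the associator -/

section Assoc

variable {P Q B B' N N' : Type u} [AddCommGroup P] [Module k P]
  [AddCommGroup Q] [Module k Q] [AddCommGroup B] [Module k B] [AddCommGroup B'] [Module k B']
  [AddCommGroup N] [Module k N] [AddCommGroup N'] [Module k N']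

theorem assoc_nat1 (f : P →ₗ[k] Q) (t : (P ⊗[k] B) ⊗[k] N) :
    TensorProduct.assoc k Q B N ((f.rTensor B).rTensor N t) =
      f.rTensor (B ⊗[k] N) (TensorProduct.assoc k P B N t) :=
  LinearMap.congr_fun (f := (TensorProduct.assoc k Q B N).toLinearMap ∘ₗ (f.rTensor B).rTensor N)
    (g := f.rTensor (B ⊗[k] N) ∘ₗ (TensorProduct.assoc k P B N).toLinearMap)
    (TensorProduct.ext_threefold fun a b c => by simp) t

theorem assoc_nat2 (f : B →ₗ[k] B') (t : (P ⊗[k] B) ⊗[k] N) :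
    TensorProduct.assoc k P B' N ((f.lTensor P).rTensor N t) =
      (f.rTensor N).lTensor P (TensorProduct.assoc k P B N t) :=
  LinearMap.congr_fun (f := (TensorProduct.assoc k P B' N).toLinearMap ∘ₗ (f.lTensor P).rTensor N)
    (g := (f.rTensor N).lTensor P ∘ₗ (TensorProduct.assoc k P B N).toLinearMap)
    (TensorProduct.ext_threefold fun a b c => by simp) t

theorem assoc_nat3 (f : N →ₗ[k] N') (t : (P ⊗[k] B) ⊗[k] N) :
    TensorProduct.assoc k P B N' (f.lTensor (P ⊗[k] B) t) =
      (f.lTensor B).lTensor P (TensorProduct.assoc k P B N t) :=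
  LinearMap.congr_fun (f := (TensorProduct.assoc k P B N').toLinearMap ∘ₗ f.lTensor (P ⊗[k] B))
    (g := (f.lTensor B).lTensor P ∘ₗ (TensorProduct.assoc k P B N).toLinearMap)
    (TensorProduct.ext_threefold fun a b c => by simp) t

theorem rl_comm (f : P →ₗ[k] Q) (g : N →ₗ[k] N') (t : P ⊗[k] N) :
    f.rTensor N' (g.lTensor P t) = g.lTensor Q (f.rTensor N t) := by
  rw [← LinearMap.comp_apply, ← LinearMap.comp_apply, LinearMap.rTensor_comp_lTensor,
    LinearMap.lTensor_comp_rTensor]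

end Assoc

/-! ### Coactions on vector spaces -/

section Coactions

variable {M N M' N' X Y V W : Type u} [AddCommGroup M] [Module k M] [AddCommGroup N] [Module k N]
  [AddCommGroup M'] [Module k M'] [AddCommGroup N'] [Module k N'] [AddCommGroup X] [Module k X]
  [AddCommGroup Y] [Module k Y] [AddCommGroup V] [Module k V] [AddCommGroup W] [Module k W]

/-- `ρ : M → M ⊗ C` is a right coaction: it is coassociative and counital. -/
structure IsRightCoaction (ρ : M →ₗ[k] M ⊗[k] C) : Prop where
  coassoc : ∀ m, TensorProduct.assoc k M C C (ρ.rTensor C (ρ m)) =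
    (Coalgebra.comul (R := k) (A := C)).lTensor M (ρ m)
  counit : ∀ m, (Coalgebra.counit (R := k) (A := C)).lTensor M (ρ m) = m ⊗ₜ[k] (1 : k)

/-- `l : M → C ⊗ M` is a left coaction: it is coassociative and counital. -/
structure IsLeftCoaction (l : M →ₗ[k] C ⊗[k] M) : Prop where
  coassoc : ∀ m, TensorProduct.assoc k C C M
      ((Coalgebra.comul (R := k) (A := C)).rTensor M (l m)) = l.lTensor C (l m)
  counit : ∀ m, (Coalgebra.counit (R := k) (A := C)).rTensor M (l m) = (1 : k) ⊗ₜ[k] m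

/-- A left `C`-coaction and a right `D`-coaction commute:
`(l ⊗ D) ∘ r = (C ⊗ r) ∘ l` as maps `X → C ⊗ X ⊗ D`. -/
def Bicoassoc (l : X →ₗ[k] C ⊗[k] X) (r : X →ₗ[k] X ⊗[k] D) : Prop :=
  ∀ x, TensorProduct.assoc k C X D (l.rTensor D (r x)) = r.lTensor C (l x)

/-- The space of right colinear maps. -/
def rightHoms (ρ : M →ₗ[k] M ⊗[k] C) (ρ' : N →ₗ[k] N ⊗[k] C) : Submodule k (M →ₗ[k] N) where
  carrier := {f | ∀ m, ρ' (f m) = f.rTensor C (ρ m)}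
  add_mem' := fun hf hg m => by
    simp_all [LinearMap.rTensor_add]
  zero_mem' := fun m => by simp
  smul_mem' := fun c f hf m => by
    simp_all [LinearMap.rTensor_smul]

/-- The space of left colinear maps. -/
def leftHoms (l : M →ₗ[k] C ⊗[k] M) (l' : N →ₗ[k] C ⊗[k] N) : Submodule k (M →ₗ[k] N) where
  carrier := {f | ∀ m, l' (f m) = f.lTensor C (l m)}
  add_mem' := fun hf hg m => by
    simp_all [LinearMap.lTensor_add]
  zero_mem' := fun m => by simp
  smul_mem' := fun c f hf m => by
    simp_all [LinearMap.lTensor_smul]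

theorem rightHoms_comp {ρM : M →ₗ[k] M ⊗[k] C} {ρN : N →ₗ[k] N ⊗[k] C} {ρX : X →ₗ[k] X ⊗[k] C}
    {g : N →ₗ[k] X} {f : M →ₗ[k] N} (hg : g ∈ rightHoms ρN ρX) (hf : f ∈ rightHoms ρM ρN) :
    g ∘ₗ f ∈ rightHoms ρM ρX := fun m => by
  rw [LinearMap.comp_apply, hg, hf, LinearMap.rTensor_comp_apply]

theorem leftHoms_comp {ρM : M →ₗ[k] C ⊗[k] M} {ρN : N →ₗ[k] C ⊗[k] N} {ρX : X →ₗ[k] C ⊗[k] X}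
    {g : N →ₗ[k] X} {f : M →ₗ[k] N} (hg : g ∈ leftHoms ρN ρX) (hf : f ∈ leftHoms ρM ρN) :
    g ∘ₗ f ∈ leftHoms ρM ρX := fun m => by
  rw [LinearMap.comp_apply, hg, hf, LinearMap.lTensor_comp_apply]

theorem rightHoms_eq {ρM : M →ₗ[k] M ⊗[k] C} {ρN : N →ₗ[k] N ⊗[k] C} {f : M →ₗ[k] N}
    (hf : f ∈ rightHoms ρM ρN) : ρN ∘ₗ f = f.rTensor C ∘ₗ ρM := LinearMap.ext fun m => hf m

theorem leftHoms_eq {ρM : M →ₗ[k] C ⊗[k] M} {ρN : N →ₗ[k] C ⊗[k] N} {f : M →ₗ[k] N}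
    (hf : f ∈ leftHoms ρM ρN) : ρN ∘ₗ f = f.lTensor C ∘ₗ ρM := LinearMap.ext fun m => hf m

theorem rightHoms_id (ρ : M →ₗ[k] M ⊗[k] C) : LinearMap.id ∈ rightHoms ρ ρ := fun m => by simp

theorem leftHoms_id (l : M →ₗ[k] C ⊗[k] M) : LinearMap.id ∈ leftHoms l l := fun m => by simp

theorem IsRightCoaction.of_inj {ρ : M →ₗ[k] M ⊗[k] C} (hρ : IsRightCoaction ρ)
    {ρ' : N →ₗ[k] N ⊗[k] C} {i : N →ₗ[k] M} (hi : Function.Injective i)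
    (h : i ∈ rightHoms ρ' ρ) : IsRightCoaction ρ' where
  coassoc := fun s => by
    have h1 := (rightHoms_eq h).symm
    apply rTensor_inj (N := C ⊗[k] C) hi
    rw [← assoc_nat1, ← LinearMap.rTensor_comp_apply, h1, LinearMap.rTensor_comp_apply, rl_comm,
      ← h, hρ.coassoc]
  counit := fun s => by
    apply rTensor_inj (N := k) hi
    rw [rl_comm, ← h, hρ.counit, LinearMap.rTensor_tmul]

theorem IsLeftCoaction.of_inj {ρ : M →ₗ[k] C ⊗[k] M} (hρ : IsLeftCoaction ρ)
    {ρ' : N →ₗ[k] C ⊗[k] N} {i : N →ₗ[k] M} (hi : Function.Injective i)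
    (h : i ∈ leftHoms ρ' ρ) : IsLeftCoaction ρ' where
  coassoc := fun s => by
    have h1 := (leftHoms_eq h).symm
    apply lTensor_inj (N := C) (lTensor_inj (N := C) hi)
    rw [← assoc_nat3, ← LinearMap.lTensor_comp_apply, h1, LinearMap.lTensor_comp_apply, ← rl_comm,
      ← h, hρ.coassoc]
  counit := fun s => by
    apply lTensor_inj (N := k) hi
    rw [← rl_comm, ← h, hρ.counit, LinearMap.lTensor_tmul]

variable (V) in
/-- The right coaction `V ⊗ ρ` on `V ⊗ N`. -/
def rightTensor (ρ : N →ₗ[k] N ⊗[k] C) : V ⊗[k] N →ₗ[k] (V ⊗[k] N) ⊗[k] C :=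
  (TensorProduct.assoc k V N C).symm.toLinearMap ∘ₗ ρ.lTensor V

variable (V) in
/-- The left coaction `l ⊗ V` on `N ⊗ V`. -/
def leftTensor (l : N →ₗ[k] C ⊗[k] N) : N ⊗[k] V →ₗ[k] C ⊗[k] (N ⊗[k] V) :=
  (TensorProduct.assoc k C N V).toLinearMap ∘ₗ l.rTensor V

theorem mk_mem_rightHoms (ρ : N →ₗ[k] N ⊗[k] C) (v : V) :
    TensorProduct.mk k V N v ∈ rightHoms ρ (rightTensor V ρ) := fun n => by
  simp only [rightTensor, LinearMap.comp_apply, TensorProduct.mk_apply, LinearMap.lTensor_tmul,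
    LinearEquiv.coe_coe]
  induction ρ n with
  | zero => simp
  | tmul x y => simp
  | add x y hx hy => simp only [TensorProduct.tmul_add, map_add, hx, hy]

theorem mk_mem_leftHoms (l : N →ₗ[k] C ⊗[k] N) (v : V) :
    (TensorProduct.mk k N V).flip v ∈ leftHoms l (leftTensor V l) := fun n => by
  simp only [leftTensor, LinearMap.comp_apply, TensorProduct.mk_apply, LinearMap.rTensor_tmul,
    LinearEquiv.coe_coe, LinearMap.flip_apply]
  induction l n with
  | zero => simp
  | tmul x y => simp
  | add x y hx hy => simp only [TensorProduct.add_tmul, map_add, hx, hy]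

theorem IsRightCoaction.tensor {ρ : N →ₗ[k] N ⊗[k] C} (hρ : IsRightCoaction ρ) :
    IsRightCoaction (rightTensor V ρ) where
  coassoc := fun x => by
    induction x with
    | zero => simp
    | add x y hx hy => simp only [map_add, hx, hy]
    | tmul v n =>
      have h := mk_mem_rightHoms ρ v
      have h1 := rightHoms_eq h
      have h' := h n
      rw [TensorProduct.mk_apply] at h'
      rw [h', ← rl_comm, ← hρ.coassoc, ← LinearMap.rTensor_comp_apply, h1,
        LinearMap.rTensor_comp_apply, assoc_nat1]
  counit := fun x => by
    induction x with
    | zero => simp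
    | add x y hx hy => simp only [map_add, hx, hy, TensorProduct.add_tmul]
    | tmul v n =>
      have h' := mk_mem_rightHoms ρ v n
      rw [TensorProduct.mk_apply] at h'
      rw [h', ← rl_comm, hρ.counit]
      simp

theorem IsLeftCoaction.tensor {l : N →ₗ[k] C ⊗[k] N} (hl : IsLeftCoaction l) :
    IsLeftCoaction (leftTensor V l) where
  coassoc := fun x => by
    induction x with
    | zero => simp
    | add x y hx hy => simp only [map_add, hx, hy]
    | tmul n v =>
      have h := mk_mem_leftHoms l v
      have h1 := leftHoms_eq h
      have h' := h n
      rw [LinearMap.flip_apply, TensorProduct.mk_apply] at h'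
      rw [h', rl_comm, ← LinearMap.lTensor_comp_apply, h1,
        LinearMap.lTensor_comp_apply, ← hl.coassoc, assoc_nat3]
  counit := fun x => by
    induction x with
    | zero => simp
    | add x y hx hy => simp only [map_add, hx, hy, TensorProduct.tmul_add]
    | tmul n v =>
      have h' := mk_mem_leftHoms l v n
      rw [LinearMap.flip_apply, TensorProduct.mk_apply] at h'
      rw [h', rl_comm, hl.counit]
      simp

theorem map_mem_rightHoms {ρ : M →ₗ[k] M ⊗[k] C} {ρ' : N →ₗ[k] N ⊗[k] C} (f : V →ₗ[k] W)
    {g : M →ₗ[k] N} (hg : g ∈ rightHoms ρ ρ') :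
    TensorProduct.map f g ∈ rightHoms (rightTensor V ρ) (rightTensor W ρ') := fun t => by
  induction t with
  | zero => simp
  | add x y hx hy => simp only [map_add, hx, hy]
  | tmul v m =>
    simp only [rightTensor, TensorProduct.map_tmul, LinearMap.comp_apply, LinearMap.lTensor_tmul,
      hg m, LinearEquiv.coe_coe]
    induction ρ m with
    | zero => simp
    | add x y hx hy => simp only [map_add, TensorProduct.tmul_add, hx, hy]
    | tmul a c => simp

theorem map_mem_leftHoms {l : M →ₗ[k] C ⊗[k] M} {l' : N →ₗ[k] C ⊗[k] N} (f : V →ₗ[k] W)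
    {g : M →ₗ[k] N} (hg : g ∈ leftHoms l l') :
    TensorProduct.map g f ∈ leftHoms (leftTensor V l) (leftTensor W l') := fun t => by
  induction t with
  | zero => simp
  | add x y hx hy => simp only [map_add, hx, hy]
  | tmul m v =>
    simp only [leftTensor, TensorProduct.map_tmul, LinearMap.comp_apply, LinearMap.rTensor_tmul,
      hg m, LinearEquiv.coe_coe]
    induction l m with
    | zero => simp
    | add x y hx hy => simp only [map_add, TensorProduct.add_tmul, hx, hy]
    | tmul a c => simp

theorem Bicoassoc.tensor (lX : X →ₗ[k] C ⊗[k] X) (rY : Y →ₗ[k] Y ⊗[k] E) :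
    Bicoassoc (leftTensor Y lX) (rightTensor X rY) := fun t => by
  induction t with
  | zero => simp
  | add x y hx hy => simp only [map_add, hx, hy]
  | tmul x y =>
    simp only [rightTensor, leftTensor, LinearMap.comp_apply, LinearMap.lTensor_tmul,
      LinearEquiv.coe_coe, LinearMap.rTensor_tmul]
    have h : ∀ (z : C ⊗[k] X) (w : Y ⊗[k] E),
        TensorProduct.assoc k C (X ⊗[k] Y) E
          ((TensorProduct.assoc k C X Y).toLinearMap.rTensor E
            ((TensorProduct.assoc k (C ⊗[k] X) Y E).symm (z ⊗ₜ w))) =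
        (TensorProduct.assoc k X Y E).symm.toLinearMap.lTensor C
          (TensorProduct.assoc k C X (Y ⊗[k] E) (z ⊗ₜ w)) := by
      intro z w
      induction z with
      | zero => simp
      | add x y hx hy => simp only [map_add, TensorProduct.add_tmul, hx, hy]
      | tmul c x =>
        induction w with
        | zero => simp
        | add x y hx hy => simp only [map_add, TensorProduct.tmul_add, hx, hy]
        | tmul y e => simp
    have h1 : ∀ w : Y ⊗[k] E, (TensorProduct.assoc k (C ⊗[k] X) Y E).symm (lX x ⊗ₜ w) =
        (lX.rTensor Y).rTensor E ((TensorProduct.assoc k X Y E).symm (x ⊗ₜ w)) := by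
      intro w
      induction w with
      | zero => simp
      | add x y hx hy => simp only [map_add, TensorProduct.tmul_add, hx, hy]
      | tmul y e => simp
    have h2 : ∀ z : C ⊗[k] X, TensorProduct.assoc k C X (Y ⊗[k] E) (z ⊗ₜ rY y) =
        (rY.lTensor X).lTensor C (TensorProduct.assoc k C X Y (z ⊗ₜ y)) := by
      intro z
      induction z with
      | zero => simp
      | add x y hx hy => simp only [map_add, TensorProduct.add_tmul, hx, hy]
      | tmul c x => simp
    rw [LinearMap.rTensor_comp_apply, LinearMap.lTensor_comp_apply, ← h1, ← h2, h]

theorem Bicoassoc.of_inj {lM : M →ₗ[k] C ⊗[k] M} {rM : M →ₗ[k] M ⊗[k] D} (h : Bicoassoc lM rM)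
    {lN : N →ₗ[k] C ⊗[k] N} {rN : N →ₗ[k] N ⊗[k] D} {i : N →ₗ[k] M} (hi : Function.Injective i)
    (hl : i ∈ leftHoms lN lM) (hr : i ∈ rightHoms rN rM) : Bicoassoc lN rN := fun s => by
  have h1 := (rightHoms_eq hr).symm
  have h2 := (leftHoms_eq hl).symm
  apply lTensor_inj (N := C) (rTensor_inj (N := D) hi)
  rw [← assoc_nat2, ← LinearMap.rTensor_comp_apply, h2, LinearMap.rTensor_comp_apply,
    ← LinearMap.lTensor_comp_apply, h1, LinearMap.lTensor_comp_apply, ← hr, ← hl, h]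

/-! ### The cotensor product -/

/-- The map `ρ ⊗ N - M ⊗ l : M ⊗ N → M ⊗ C ⊗ N`. -/
def cotDiff (ρ : M →ₗ[k] M ⊗[k] C) (l : N →ₗ[k] C ⊗[k] N) :
    M ⊗[k] N →ₗ[k] M ⊗[k] (C ⊗[k] N) :=
  (TensorProduct.assoc k M C N).toLinearMap ∘ₗ ρ.rTensor N - l.lTensor M

/-- The cotensor product `M □_C N`, as the kernel of `ρ ⊗ N - M ⊗ l` on `M ⊗ N`. -/
def cot (ρ : M →ₗ[k] M ⊗[k] C) (l : N →ₗ[k] C ⊗[k] N) : Submodule k (M ⊗[k] N) :=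
  LinearMap.ker (cotDiff ρ l)

theorem cotDiff_apply (ρ : M →ₗ[k] M ⊗[k] C) (l : N →ₗ[k] C ⊗[k] N) (t : M ⊗[k] N) :
    cotDiff ρ l t = TensorProduct.assoc k M C N (ρ.rTensor N t) - l.lTensor M t := rfl

theorem mem_cot {ρ : M →ₗ[k] M ⊗[k] C} {l : N →ₗ[k] C ⊗[k] N} {t : M ⊗[k] N} :
    t ∈ cot ρ l ↔ TensorProduct.assoc k M C N (ρ.rTensor N t) = l.lTensor M t := by
  simp [cot, cotDiff, sub_eq_zero]

theorem map_mem_cot {ρ : M →ₗ[k] M ⊗[k] C} {ρ' : M' →ₗ[k] M' ⊗[k] C} {l : N →ₗ[k] C ⊗[k] N}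
    {l' : N' →ₗ[k] C ⊗[k] N'} {f : M →ₗ[k] M'} {g : N →ₗ[k] N'} (hf : f ∈ rightHoms ρ ρ')
    (hg : g ∈ leftHoms l l') (t : M ⊗[k] N) (ht : t ∈ cot ρ l) :
    TensorProduct.map f g t ∈ cot ρ' l' := by
  rw [mem_cot] at ht ⊢
  have e1 : ρ' ∘ₗ f = f.rTensor C ∘ₗ ρ := LinearMap.ext hf
  have e2 : l' ∘ₗ g = g.lTensor C ∘ₗ l := LinearMap.ext hg
  have h1 : TensorProduct.map f g t = f.rTensor _ (g.lTensor _ t) := by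
    rw [← LinearMap.comp_apply, LinearMap.rTensor_comp_lTensor]
  have h2 : TensorProduct.map f g t = g.lTensor _ (f.rTensor _ t) := by
    rw [← LinearMap.comp_apply, LinearMap.lTensor_comp_rTensor]
  conv_lhs => rw [h1]
  conv_rhs => rw [h2]
  rw [← LinearMap.rTensor_comp_apply, ← LinearMap.lTensor_comp_apply, e1, e2,
    LinearMap.rTensor_comp_apply, LinearMap.lTensor_comp_apply, rl_comm, assoc_nat1,
    assoc_nat3, ht, ← rl_comm, rl_comm]

theorem rightTensor_mem (ρ : M →ₗ[k] M ⊗[k] C) {l : X →ₗ[k] C ⊗[k] X} {r : X →ₗ[k] X ⊗[k] D}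
    (hX : Bicoassoc l r) (s : cot ρ l) :
    (rightTensor M r ∘ₗ (cot ρ l).subtype) s ∈ LinearMap.range ((cot ρ l).subtype.rTensor D) := by
  obtain ⟨s', hs'⟩ := s
  have hs := mem_cot.1 hs'
  refine (mem_range_rTensor_ker (cotDiff ρ l) _).2 ?_
  change (cotDiff ρ l).rTensor D (rightTensor M r s') = 0
  have h1 : l.rTensor D ∘ₗ r =
      (TensorProduct.assoc k C X D).symm.toLinearMap ∘ₗ r.lTensor C ∘ₗ l :=
    LinearMap.ext fun x => by simp [← hX x]
  apply (TensorProduct.assoc k M (C ⊗[k] X) D).injective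
  rw [map_zero, cotDiff, LinearMap.rTensor_sub, LinearMap.sub_apply, map_sub, assoc_nat2,
    LinearMap.rTensor_comp_apply]
  simp only [rightTensor, LinearMap.comp_apply, LinearEquiv.coe_coe,
    LinearEquiv.apply_symm_apply]
  rw [← LinearMap.lTensor_comp_apply, h1, LinearMap.lTensor_comp_apply,
    LinearMap.lTensor_comp_apply, ← hs, sub_eq_zero, ← assoc_nat3, ← rl_comm]
  generalize r.lTensor M s' = z
  obtain ⟨w, rfl⟩ := (TensorProduct.assoc k M X D).surjective z
  rw [← assoc_nat1, LinearEquiv.symm_apply_apply]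
  generalize (ρ.rTensor X).rTensor D w = w'
  exact LinearMap.congr_fun (f := (TensorProduct.assoc k M (C ⊗[k] X) D).toLinearMap ∘ₗ
      (TensorProduct.assoc k M C X).toLinearMap.rTensor D)
    (g := (TensorProduct.assoc k C X D).symm.toLinearMap.lTensor M ∘ₗ
      (TensorProduct.assoc k M C (X ⊗[k] D)).toLinearMap ∘ₗ
      (TensorProduct.assoc k (M ⊗[k] C) X D).toLinearMap)
    (TensorProduct.ext_fourfold fun a b c d => by simp) w'

theorem leftTensor_mem {l : X →ₗ[k] C ⊗[k] X} {r : X →ₗ[k] X ⊗[k] D} (hX : Bicoassoc l r)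
    (lN : N →ₗ[k] D ⊗[k] N) (s : cot r lN) :
    (leftTensor N l ∘ₗ (cot r lN).subtype) s ∈ LinearMap.range ((cot r lN).subtype.lTensor C) := by
  obtain ⟨s', hs'⟩ := s
  have hs := mem_cot.1 hs'
  refine (mem_range_lTensor_ker (cotDiff r lN) _).2 ?_
  change (cotDiff r lN).lTensor C (leftTensor N l s') = 0
  have h1 : r.lTensor C ∘ₗ l =
      (TensorProduct.assoc k C X D).toLinearMap ∘ₗ l.rTensor D ∘ₗ r :=
    LinearMap.ext fun x => by simp [← hX x]
  rw [cotDiff, LinearMap.lTensor_sub, LinearMap.sub_apply, LinearMap.lTensor_comp_apply]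
  simp only [leftTensor, LinearMap.comp_apply, LinearEquiv.coe_coe]
  rw [← assoc_nat2, ← LinearMap.rTensor_comp_apply, h1, LinearMap.rTensor_comp_apply,
    LinearMap.rTensor_comp_apply, ← assoc_nat3, ← rl_comm, sub_eq_zero, ← hs, ← assoc_nat1]
  generalize (l.rTensor D).rTensor N (r.rTensor N s') = w'
  exact LinearMap.congr_fun (f := (TensorProduct.assoc k X D N).toLinearMap.lTensor C ∘ₗ
      (TensorProduct.assoc k C (X ⊗[k] D) N).toLinearMap ∘ₗ
      (TensorProduct.assoc k C X D).toLinearMap.rTensor N)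
    (g := (TensorProduct.assoc k C X (D ⊗[k] N)).toLinearMap ∘ₗ
      (TensorProduct.assoc k (C ⊗[k] X) D N).toLinearMap)
    (TensorProduct.ext_fourfold fun a b c d => by simp) w'

/-- The right `D`-coaction on `M □_C X`: the restriction of `M ⊗ r`. -/
def rightCot (ρ : M →ₗ[k] M ⊗[k] C) {l : X →ₗ[k] C ⊗[k] X} {r : X →ₗ[k] X ⊗[k] D}
    (hX : Bicoassoc l r) : cot ρ l →ₗ[k] cot ρ l ⊗[k] D :=
  lift ((cot ρ l).subtype.rTensor D) (rTensor_inj (cot ρ l).injective_subtype)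
    (rightTensor M r ∘ₗ (cot ρ l).subtype) (rightTensor_mem ρ hX)

/-- The left `C`-coaction on `X □_D N`: the restriction of `l ⊗ N`. -/
def leftCot {l : X →ₗ[k] C ⊗[k] X} {r : X →ₗ[k] X ⊗[k] D} (hX : Bicoassoc l r)
    (lN : N →ₗ[k] D ⊗[k] N) : cot r lN →ₗ[k] C ⊗[k] cot r lN :=
  lift ((cot r lN).subtype.lTensor C) (lTensor_inj (cot r lN).injective_subtype)
    (leftTensor N l ∘ₗ (cot r lN).subtype) (leftTensor_mem hX lN)

theorem subtype_mem_rightHoms (ρ : M →ₗ[k] M ⊗[k] C) {l : X →ₗ[k] C ⊗[k] X}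
    {r : X →ₗ[k] X ⊗[k] D} (hX : Bicoassoc l r) :
    (cot ρ l).subtype ∈ rightHoms (rightCot ρ hX) (rightTensor M r) := fun s =>
  (lift_spec _ _ _ (rightTensor_mem ρ hX) s).symm

theorem subtype_mem_leftHoms {l : X →ₗ[k] C ⊗[k] X} {r : X →ₗ[k] X ⊗[k] D} (hX : Bicoassoc l r)
    (lN : N →ₗ[k] D ⊗[k] N) :
    (cot r lN).subtype ∈ leftHoms (leftCot hX lN) (leftTensor N l) := fun s =>
  (lift_spec _ _ _ (leftTensor_mem hX lN) s).symm

theorem mem_rightHoms_rightCot {ρ : M →ₗ[k] M ⊗[k] C} {l : X →ₗ[k] C ⊗[k] X}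
    {r : X →ₗ[k] X ⊗[k] D} (hX : Bicoassoc l r) {ρN : N →ₗ[k] N ⊗[k] D} {f : N →ₗ[k] cot ρ l}
    (hf : (cot ρ l).subtype ∘ₗ f ∈ rightHoms ρN (rightTensor M r)) :
    f ∈ rightHoms ρN (rightCot ρ hX) := fun n => by
  apply rTensor_inj (N := D) (cot ρ l).injective_subtype
  rw [← subtype_mem_rightHoms, ← LinearMap.rTensor_comp_apply, ← hf n]
  rfl

theorem mem_leftHoms_leftCot {l : X →ₗ[k] C ⊗[k] X} {r : X →ₗ[k] X ⊗[k] D} (hX : Bicoassoc l r)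
    {lN : N →ₗ[k] D ⊗[k] N} {lM : M →ₗ[k] C ⊗[k] M} {f : M →ₗ[k] cot r lN}
    (hf : (cot r lN).subtype ∘ₗ f ∈ leftHoms lM (leftTensor N l)) :
    f ∈ leftHoms lM (leftCot hX lN) := fun n => by
  apply lTensor_inj (N := C) (cot r lN).injective_subtype
  rw [← subtype_mem_leftHoms, ← LinearMap.lTensor_comp_apply, ← hf n]
  rfl

/-- The map `f □_C g` induced by colinear maps `f` and `g`. -/
def cotMap {ρ : M →ₗ[k] M ⊗[k] C} {ρ' : M' →ₗ[k] M' ⊗[k] C} {l : N →ₗ[k] C ⊗[k] N}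
    {l' : N' →ₗ[k] C ⊗[k] N'} {f : M →ₗ[k] M'} {g : N →ₗ[k] N'} (hf : f ∈ rightHoms ρ ρ')
    (hg : g ∈ leftHoms l l') : cot ρ l →ₗ[k] cot ρ' l' :=
  (TensorProduct.map f g).restrict (map_mem_cot hf hg)

theorem cotMap_mem_rightHoms {ρ : M →ₗ[k] M ⊗[k] C} {ρ' : M' →ₗ[k] M' ⊗[k] C}
    {l : N →ₗ[k] C ⊗[k] N} {l' : N' →ₗ[k] C ⊗[k] N'} {r : N →ₗ[k] N ⊗[k] D}
    {r' : N' →ₗ[k] N' ⊗[k] D} (h : Bicoassoc l r) (h' : Bicoassoc l' r') {f : M →ₗ[k] M'}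
    {g : N →ₗ[k] N'} (hf : f ∈ rightHoms ρ ρ') (hg : g ∈ leftHoms l l') (hg' : g ∈ rightHoms r r') :
    cotMap hf hg ∈ rightHoms (rightCot ρ h) (rightCot ρ' h') :=
  mem_rightHoms_rightCot h' (show TensorProduct.map f g ∘ₗ (cot ρ l).subtype ∈ _ from
    rightHoms_comp (map_mem_rightHoms f hg') (subtype_mem_rightHoms ρ h))

theorem cotMap_mem_leftHoms {r : M →ₗ[k] M ⊗[k] C} {r' : M' →ₗ[k] M' ⊗[k] C}
    {lN : N →ₗ[k] C ⊗[k] N} {lN' : N' →ₗ[k] C ⊗[k] N'} {l : M →ₗ[k] D ⊗[k] M}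
    {l' : M' →ₗ[k] D ⊗[k] M'} (h : Bicoassoc l r) (h' : Bicoassoc l' r') {f : M →ₗ[k] M'}
    {g : N →ₗ[k] N'} (hf : f ∈ rightHoms r r') (hf' : f ∈ leftHoms l l')
    (hg : g ∈ leftHoms lN lN') :
    cotMap hf hg ∈ leftHoms (leftCot h lN) (leftCot h' lN') :=
  mem_leftHoms_leftCot h' (show TensorProduct.map f g ∘ₗ (cot r lN).subtype ∈ _ from
    leftHoms_comp (map_mem_leftHoms g hf') (subtype_mem_leftHoms h lN))

/-! ### Associativity of the cotensor product -/

/-- The inclusion `(M □_C X) □_D N → M ⊗ (X ⊗ N)`. -/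
def inclLeft (ρ : M →ₗ[k] M ⊗[k] C) {l : X →ₗ[k] C ⊗[k] X} {r : X →ₗ[k] X ⊗[k] D}
    (hX : Bicoassoc l r) (lN : N →ₗ[k] D ⊗[k] N) :
    cot (rightCot ρ hX) lN →ₗ[k] M ⊗[k] (X ⊗[k] N) :=
  (TensorProduct.assoc k M X N).toLinearMap ∘ₗ
    (cot ρ l).subtype.rTensor N ∘ₗ (cot (rightCot ρ hX) lN).subtype

/-- The inclusion `M □_C (X □_D N) → M ⊗ (X ⊗ N)`. -/
def inclRight (ρ : M →ₗ[k] M ⊗[k] C) {l : X →ₗ[k] C ⊗[k] X} {r : X →ₗ[k] X ⊗[k] D}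
    (hX : Bicoassoc l r) (lN : N →ₗ[k] D ⊗[k] N) :
    cot ρ (leftCot hX lN) →ₗ[k] M ⊗[k] (X ⊗[k] N) :=
  (cot r lN).subtype.lTensor M ∘ₗ (cot ρ (leftCot hX lN)).subtype

theorem inclLeft_inj (ρ : M →ₗ[k] M ⊗[k] C) {l : X →ₗ[k] C ⊗[k] X} {r : X →ₗ[k] X ⊗[k] D}
    (hX : Bicoassoc l r) (lN : N →ₗ[k] D ⊗[k] N) : Function.Injective (inclLeft ρ hX lN) :=
  (TensorProduct.assoc k M X N).injective.comp
    ((rTensor_inj (Submodule.injective_subtype _)).comp (Submodule.injective_subtype _))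

theorem inclRight_inj (ρ : M →ₗ[k] M ⊗[k] C) {l : X →ₗ[k] C ⊗[k] X} {r : X →ₗ[k] X ⊗[k] D}
    (hX : Bicoassoc l r) (lN : N →ₗ[k] D ⊗[k] N) : Function.Injective (inclRight ρ hX lN) :=
  (lTensor_inj (Submodule.injective_subtype _)).comp (Submodule.injective_subtype _)

theorem mem_range_inclLeft (ρ : M →ₗ[k] M ⊗[k] C) {l : X →ₗ[k] C ⊗[k] X} {r : X →ₗ[k] X ⊗[k] D}
    (hX : Bicoassoc l r) (lN : N →ₗ[k] D ⊗[k] N) (t : (M ⊗[k] X) ⊗[k] N) :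
    TensorProduct.assoc k M X N t ∈ LinearMap.range (inclLeft ρ hX lN) ↔
      (cotDiff ρ l).rTensor N t = 0 ∧
      (cotDiff r lN).lTensor M (TensorProduct.assoc k M X N t) = 0 := by
  have hr : (cot ρ l).subtype.rTensor D ∘ₗ rightCot ρ hX =
      rightTensor M r ∘ₗ (cot ρ l).subtype := (rightHoms_eq (subtype_mem_rightHoms ρ hX)).symm
  have key : ∀ z : cot ρ l ⊗[k] N, (cotDiff r lN).lTensor M
        (TensorProduct.assoc k M X N ((cot ρ l).subtype.rTensor N z)) =
      TensorProduct.assoc k M X (D ⊗[k] N)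
        ((cot ρ l).subtype.rTensor (D ⊗[k] N) (cotDiff (rightCot ρ hX) lN z)) := by
    intro z
    rw [cotDiff_apply, cotDiff, LinearMap.lTensor_sub, LinearMap.sub_apply, map_sub, map_sub, ← assoc_nat1,
      ← LinearMap.rTensor_comp_apply, hr, rl_comm, assoc_nat3,
      LinearMap.lTensor_comp_apply, ← assoc_nat2, LinearMap.rTensor_comp_apply, rightTensor,
      LinearMap.rTensor_comp_apply]
    congr 1
    generalize (r.lTensor M).rTensor N ((cot ρ l).subtype.rTensor N z) = y
    obtain ⟨y', rfl⟩ := (TensorProduct.congr (TensorProduct.assoc k M X D)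
      (LinearEquiv.refl k N)).surjective y
    exact LinearMap.congr_fun (f := (TensorProduct.assoc k X D N).toLinearMap.lTensor M ∘ₗ
        (TensorProduct.assoc k M (X ⊗[k] D) N).toLinearMap ∘ₗ
        (TensorProduct.congr (TensorProduct.assoc k M X D) (LinearEquiv.refl k N)).toLinearMap)
      (g := (TensorProduct.assoc k M X (D ⊗[k] N)).toLinearMap ∘ₗ
        (TensorProduct.assoc k (M ⊗[k] X) D N).toLinearMap ∘ₗ
        (TensorProduct.assoc k M X D).symm.toLinearMap.rTensor N ∘ₗ
        (TensorProduct.congr (TensorProduct.assoc k M X D) (LinearEquiv.refl k N)).toLinearMap)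
      (TensorProduct.ext_fourfold fun a b c d => by simp) y'
  constructor
  · rintro ⟨z, hz⟩
    obtain rfl : (cot ρ l).subtype.rTensor N z.1 = t := (TensorProduct.assoc k M X N).injective hz
    refine ⟨(mem_range_rTensor_ker (cotDiff ρ l) _).1 ⟨z.1, rfl⟩, ?_⟩
    rw [key, show cotDiff (rightCot ρ hX) lN z.1 = 0 from z.2, map_zero, map_zero]
  · rintro ⟨h1, h2⟩
    obtain ⟨z, hz⟩ : ∃ z, (cot ρ l).subtype.rTensor N z = t :=
      (mem_range_rTensor_ker (cotDiff ρ l) t).2 h1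
    subst hz
    rw [key] at h2
    refine ⟨⟨z, ?_⟩, rfl⟩
    apply rTensor_inj (N := D ⊗[k] N) (cot ρ l).injective_subtype
    apply (TensorProduct.assoc k M X (D ⊗[k] N)).injective
    rw [map_zero, map_zero]
    exact h2

theorem mem_range_inclRight (ρ : M →ₗ[k] M ⊗[k] C) {l : X →ₗ[k] C ⊗[k] X} {r : X →ₗ[k] X ⊗[k] D}
    (hX : Bicoassoc l r) (lN : N →ₗ[k] D ⊗[k] N) (t : (M ⊗[k] X) ⊗[k] N) :
    TensorProduct.assoc k M X N t ∈ LinearMap.range (inclRight ρ hX lN) ↔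
      (cotDiff ρ l).rTensor N t = 0 ∧
      (cotDiff r lN).lTensor M (TensorProduct.assoc k M X N t) = 0 := by
  have hl : (cot r lN).subtype.lTensor C ∘ₗ leftCot hX lN =
      leftTensor N l ∘ₗ (cot r lN).subtype := (leftHoms_eq (subtype_mem_leftHoms hX lN)).symm
  have key : ∀ z : M ⊗[k] cot r lN,
      (cot r lN).subtype.lTensor M z = TensorProduct.assoc k M X N t →
      (TensorProduct.assoc k C X N).toLinearMap.lTensor M (TensorProduct.assoc k M (C ⊗[k] X) N
        ((cotDiff ρ l).rTensor N t)) =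
      ((cot r lN).subtype.lTensor C).lTensor M (cotDiff ρ (leftCot hX lN) z) := by
    intro z hz
    rw [cotDiff, cotDiff, LinearMap.sub_apply, map_sub, LinearMap.rTensor_sub,
      LinearMap.sub_apply, map_sub, map_sub, LinearMap.comp_apply, LinearEquiv.coe_coe,
      ← assoc_nat3, ← rl_comm, hz, assoc_nat2, ← LinearMap.lTensor_comp_apply,
      ← LinearMap.lTensor_comp_apply, hl, LinearMap.lTensor_comp_apply _ _ (cot r lN).subtype, hz, leftTensor,
      ← assoc_nat1, LinearMap.rTensor_comp_apply]
    congr 1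
    generalize (ρ.rTensor X).rTensor N t = y
    exact LinearMap.congr_fun (f := (TensorProduct.assoc k C X N).toLinearMap.lTensor M ∘ₗ
        (TensorProduct.assoc k M (C ⊗[k] X) N).toLinearMap ∘ₗ
        (TensorProduct.assoc k M C X).toLinearMap.rTensor N)
      (g := (TensorProduct.assoc k M C (X ⊗[k] N)).toLinearMap ∘ₗ
        (TensorProduct.assoc k (M ⊗[k] C) X N).toLinearMap)
      (TensorProduct.ext_fourfold fun a b c d => by simp) y
  constructor
  · rintro ⟨z, hz⟩
    refine ⟨?_, ?_⟩
    · apply (TensorProduct.assoc k M (C ⊗[k] X) N).injective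
      apply lTensor_inj (N := M) (TensorProduct.assoc k C X N).injective
      refine (key z.1 hz).trans ?_
      rw [show cotDiff ρ (leftCot hX lN) z.1 = 0 from z.2, map_zero, map_zero, map_zero]
    · rw [← hz]
      exact (mem_range_lTensor_ker (cotDiff r lN) _).1 ⟨z.1, rfl⟩
  · rintro ⟨h1, h2⟩
    obtain ⟨z, hz⟩ : ∃ z, (cot r lN).subtype.lTensor M z = _ :=
      (mem_range_lTensor_ker (cotDiff r lN) _).2 h2
    have h3 := key z hz
    rw [h1, map_zero, map_zero] at h3
    refine ⟨⟨z, ?_⟩, hz⟩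
    apply lTensor_inj (N := M) (lTensor_inj (N := C) (cot r lN).injective_subtype)
    rw [map_zero]
    exact h3.symm

theorem range_incl_eq (ρ : M →ₗ[k] M ⊗[k] C) {l : X →ₗ[k] C ⊗[k] X} {r : X →ₗ[k] X ⊗[k] D}
    (hX : Bicoassoc l r) (lN : N →ₗ[k] D ⊗[k] N) :
    LinearMap.range (inclLeft ρ hX lN) = LinearMap.range (inclRight ρ hX lN) := by
  ext w
  obtain ⟨t, rfl⟩ := (TensorProduct.assoc k M X N).surjective w
  rw [mem_range_inclLeft, mem_range_inclRight]

/-- The canonical isomorphism `(M □_C X) □_D N ≅ M □_C (X □_D N)`, both sides being the same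
subspace of `M ⊗ X ⊗ N`. -/
def cotAssoc (ρ : M →ₗ[k] M ⊗[k] C) {l : X →ₗ[k] C ⊗[k] X} {r : X →ₗ[k] X ⊗[k] D}
    (hX : Bicoassoc l r) (lN : N →ₗ[k] D ⊗[k] N) :
    cot (rightCot ρ hX) lN ≃ₗ[k] cot ρ (leftCot hX lN) :=
  LinearEquiv.ofInjective (inclLeft ρ hX lN) (inclLeft_inj ρ hX lN) ≪≫ₗ
    LinearEquiv.ofEq _ _ (range_incl_eq ρ hX lN) ≪≫ₗ
    (LinearEquiv.ofInjective (inclRight ρ hX lN) (inclRight_inj ρ hX lN)).symm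

end Coactions

/-! ### The categories of comodules and bicomodules -/

variable (k C) in
/-- A right `C`-comodule. -/
structure RightComod where
  carrier : Type u
  [grp : AddCommGroup carrier]
  [mod : Module k carrier]
  coact : carrier →ₗ[k] carrier ⊗[k] C
  isCoaction : IsRightCoaction coact

variable (k C) in
/-- A left `C`-comodule. -/
structure LeftComod where
  carrier : Type u
  [grp : AddCommGroup carrier]
  [mod : Module k carrier]
  coact : carrier →ₗ[k] C ⊗[k] carrier
  isCoaction : IsLeftCoaction coact

variable (k C D) in
/-- A `(C, D)`-bicomodule (an object of `ᶜMᴰ`): a left `C`-comodule and right `D`-comodule whose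
two coactions commute. -/
structure Bicomod where
  carrier : Type u
  [grp : AddCommGroup carrier]
  [mod : Module k carrier]
  lcoact : carrier →ₗ[k] C ⊗[k] carrier
  rcoact : carrier →ₗ[k] carrier ⊗[k] D
  isLeft : IsLeftCoaction lcoact
  isRight : IsRightCoaction rcoact
  bicoassoc : Bicoassoc lcoact rcoact

attribute [instance] RightComod.grp RightComod.mod LeftComod.grp LeftComod.mod
  Bicomod.grp Bicomod.mod

instance : CoeSort (RightComod k C) (Type u) := ⟨RightComod.carrier⟩
instance : CoeSort (LeftComod k C) (Type u) := ⟨LeftComod.carrier⟩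
instance : CoeSort (Bicomod k C D) (Type u) := ⟨Bicomod.carrier⟩

/-- The right comodule underlying a bicomodule. -/
@[reducible] def Bicomod.toRight (X : Bicomod k C D) : RightComod k D where
  carrier := X
  coact := X.rcoact
  isCoaction := X.isRight

/-- The left comodule underlying a bicomodule. -/
@[reducible] def Bicomod.toLeft (X : Bicomod k C D) : LeftComod k C where
  carrier := X
  coact := X.lcoact
  isCoaction := X.isLeft

variable (k C) in
/-- The coalgebra `C` as a right comodule over itself. -/
@[reducible] def RightComod.regular : RightComod k C where
  carrier := C
  coact := Coalgebra.comul
  isCoaction := ⟨Coalgebra.coassoc_apply, Coalgebra.lTensor_counit_comul⟩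

variable (k C) in
/-- The coalgebra `C` as a left comodule over itself. -/
@[reducible] def LeftComod.regular : LeftComod k C where
  carrier := C
  coact := Coalgebra.comul
  isCoaction := ⟨Coalgebra.coassoc_apply, Coalgebra.rTensor_counit_comul⟩

variable (k C) in
/-- The coalgebra `C` as a `(C, C)`-bicomodule, both coactions being the comultiplication. -/
@[reducible] def Bicomod.regular : Bicomod k C C where
  carrier := C
  lcoact := Coalgebra.comul
  rcoact := Coalgebra.comul
  isLeft := (LeftComod.regular k C).isCoaction
  isRight := (RightComod.regular k C).isCoaction
  bicoassoc := Coalgebra.coassoc_apply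

/-- Morphisms of right comodules: the right colinear maps. -/
@[ext] structure RightComod.Hom (M N : RightComod k C) where
  lin : M →ₗ[k] N
  colin : lin ∈ rightHoms M.coact N.coact

/-- Morphisms of left comodules: the left colinear maps. -/
@[ext] structure LeftComod.Hom (M N : LeftComod k C) where
  lin : M →ₗ[k] N
  colin : lin ∈ leftHoms M.coact N.coact

/-- Morphisms of bicomodules: the bicolinear maps. -/
@[ext] structure Bicomod.Hom (X Y : Bicomod k C D) where
  lin : X →ₗ[k] Y
  lcolin : lin ∈ leftHoms X.lcoact Y.lcoact
  rcolin : lin ∈ rightHoms X.rcoact Y.rcoact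

/-- The category `Mᶜ` of right `C`-comodules. -/
instance : Category (RightComod k C) where
  Hom := RightComod.Hom
  id M := ⟨LinearMap.id, rightHoms_id M.coact⟩
  comp f g := ⟨g.lin ∘ₗ f.lin, rightHoms_comp g.colin f.colin⟩

/-- The category `ᶜM` of left `C`-comodules. -/
instance : Category (LeftComod k C) where
  Hom := LeftComod.Hom
  id M := ⟨LinearMap.id, leftHoms_id M.coact⟩
  comp f g := ⟨g.lin ∘ₗ f.lin, leftHoms_comp g.colin f.colin⟩

/-- The category `ᶜMᴰ` of `(C, D)`-bicomodules. -/
instance : Category (Bicomod k C D) where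
  Hom := Bicomod.Hom
  id X := ⟨LinearMap.id, leftHoms_id X.lcoact, rightHoms_id X.rcoact⟩
  comp f g := ⟨g.lin ∘ₗ f.lin, leftHoms_comp g.lcolin f.lcolin, rightHoms_comp g.rcolin f.rcolin⟩

/-- A right comodule `M` is quasifinite if `Homᶜ(V, M)` is finite dimensional for every finite
dimensional right comodule `V`. -/
def RightComod.Quasifinite (M : RightComod k C) : Prop :=
  ∀ V : RightComod k C, Module.Finite k V → Module.Finite k (rightHoms V.coact M.coact)

/-- A left comodule `M` is quasifinite if `ᶜHom(V, M)` is finite dimensional for every finite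
dimensional left comodule `V`. -/
def LeftComod.Quasifinite (M : LeftComod k C) : Prop :=
  ∀ V : LeftComod k C, Module.Finite k V → Module.Finite k (leftHoms V.coact M.coact)

/-! ### The cotensor product functors -/

/-- The right `D`-comodule `M □_C X`, for `M` a right `C`-comodule and `X` a `(C, D)`-bicomodule. -/
@[reducible] def RightComod.cotensor (M : RightComod k C) (X : Bicomod k C D) :
    RightComod k D where
  carrier := cot M.coact X.lcoact
  coact := rightCot M.coact X.bicoassoc
  isCoaction := X.isRight.tensor.of_inj (Submodule.injective_subtype _)
    (subtype_mem_rightHoms M.coact X.bicoassoc)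

/-- The left `C`-comodule `X □_D N`, for `X` a `(C, D)`-bicomodule and `N` a left `D`-comodule. -/
@[reducible] def LeftComod.cotensor (X : Bicomod k C D) (N : LeftComod k D) :
    LeftComod k C where
  carrier := cot X.rcoact N.coact
  coact := leftCot X.bicoassoc N.coact
  isCoaction := X.isLeft.tensor.of_inj (Submodule.injective_subtype _)
    (subtype_mem_leftHoms X.bicoassoc N.coact)

/-- The `(C, E)`-bicomodule `X □_D Y`. -/
@[reducible] def Bicomod.cotensor (X : Bicomod k C D) (Y : Bicomod k D E) : Bicomod k C E where
  carrier := cot X.rcoact Y.lcoact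
  lcoact := leftCot X.bicoassoc Y.lcoact
  rcoact := rightCot X.rcoact Y.bicoassoc
  isLeft := (LeftComod.cotensor X Y.toLeft).isCoaction
  isRight := (RightComod.cotensor X.toRight Y).isCoaction
  bicoassoc := (Bicoassoc.tensor X.lcoact Y.rcoact).of_inj (Submodule.injective_subtype _)
    (subtype_mem_leftHoms X.bicoassoc Y.lcoact) (subtype_mem_rightHoms X.rcoact Y.bicoassoc)

/-- The functor `- □_C X : Mᶜ ⥤ Mᴰ`, for a `(C, D)`-bicomodule `X`. -/
@[simps] def cotensorRight (X : Bicomod k C D) : RightComod k C ⥤ RightComod k D where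
  obj M := M.cotensor X
  map f := ⟨cotMap f.colin (leftHoms_id X.lcoact), cotMap_mem_rightHoms X.bicoassoc X.bicoassoc
    f.colin (leftHoms_id X.lcoact) (rightHoms_id X.rcoact)⟩
  map_id M := RightComod.Hom.ext (LinearMap.ext fun s => Subtype.ext
    (LinearMap.congr_fun (TensorProduct.map_id (R := k) (M := M) (N := X)) s.1))
  map_comp f g := RightComod.Hom.ext (LinearMap.ext fun s => Subtype.ext
    (LinearMap.congr_fun (TensorProduct.map_comp g.lin LinearMap.id f.lin LinearMap.id) s.1))

/-- The functor `X □_D - : ᴰM ⥤ ᶜM`, for a `(C, D)`-bicomodule `X`. -/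
@[simps] def cotensorLeft (X : Bicomod k C D) : LeftComod k D ⥤ LeftComod k C where
  obj N := LeftComod.cotensor X N
  map g := ⟨cotMap (rightHoms_id X.rcoact) g.colin, cotMap_mem_leftHoms X.bicoassoc X.bicoassoc
    (rightHoms_id X.rcoact) (leftHoms_id X.lcoact) g.colin⟩
  map_id M := LeftComod.Hom.ext (LinearMap.ext fun s => Subtype.ext
    (LinearMap.congr_fun (TensorProduct.map_id (R := k) (M := X) (N := M)) s.1))
  map_comp f g := LeftComod.Hom.ext (LinearMap.ext fun s => Subtype.ext
    (LinearMap.congr_fun (TensorProduct.map_comp LinearMap.id g.lin LinearMap.id f.lin) s.1))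

/-- The canonical map `M → M □_C C` given by the coaction (an isomorphism). -/
def rightUnit (M : RightComod k C) : M →ₗ[k] cot M.coact (Bicomod.regular k C).lcoact :=
  M.coact.codRestrict _ fun m => mem_cot.2 (M.isCoaction.coassoc m)

/-- The canonical map `N → C □_C N` given by the coaction (an isomorphism). -/
def leftUnit (N : LeftComod k C) : N →ₗ[k] cot (Bicomod.regular k C).rcoact N.coact :=
  N.coact.codRestrict _ fun n => mem_cot.2 (N.isCoaction.coassoc n)

/-- The first triangle identity: the composite
`Λ ≅ Λ □_C C → Λ □_C (X □_D Λ) ≅ (Λ □_C X) □_D Λ → D □_D Λ` of `Λ □_C ψ` and `ω □_D Λ` is the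
canonical isomorphism `Λ ≅ D □_D Λ`. -/
def TriangleLeft (L : Bicomod k D C) (X : Bicomod k C D)
    (ψ : Bicomod.regular k C ⟶ X.cotensor L) (ω : L.cotensor X ⟶ Bicomod.regular k D) : Prop :=
  cotMap ω.rcolin (leftHoms_id L.lcoact) ∘ₗ
    (cotAssoc L.rcoact X.bicoassoc L.lcoact).symm.toLinearMap ∘ₗ
    cotMap (rightHoms_id L.rcoact) ψ.lcolin ∘ₗ rightUnit L.toRight = leftUnit L.toLeft

/-- The second triangle identity: the composite
`X ≅ C □_C X → (X □_D Λ) □_C X ≅ X □_D (Λ □_C X) → X □_D D` of `ψ □_C X` and `X □_D ω` is the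
canonical isomorphism `X ≅ X □_D D`. -/
def TriangleRight (L : Bicomod k D C) (X : Bicomod k C D)
    (ψ : Bicomod.regular k C ⟶ X.cotensor L) (ω : L.cotensor X ⟶ Bicomod.regular k D) : Prop :=
  cotMap (rightHoms_id X.rcoact) ω.lcolin ∘ₗ
    (cotAssoc X.rcoact L.bicoassoc X.lcoact).toLinearMap ∘ₗ
    cotMap ψ.rcolin (leftHoms_id X.lcoact) ∘ₗ leftUnit X.toLeft = rightUnit X.toRight

/-! ### Slices of tensors, and the finiteness theorem for comodules -/

section Slices

open Module (Dual)

variable {M N P W Z : Type u} [AddCommGroup M] [Module k M] [AddCommGroup N] [Module k N]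
  [AddCommGroup P] [Module k P] [AddCommGroup W] [Module k W] [AddCommGroup Z] [Module k Z]

variable (W) in
/-- The map `W ⊗ ξ : W ⊗ N → W` for a functional `ξ` on `N`. -/
def sliceR (ξ : Dual k N) : W ⊗[k] N →ₗ[k] W :=
  (TensorProduct.rid k W).toLinearMap ∘ₗ ξ.lTensor W

variable (W) in
/-- The map `ξ ⊗ W : N ⊗ W → W` for a functional `ξ` on `N`. -/
def sliceL (ξ : Dual k N) : N ⊗[k] W →ₗ[k] W :=
  (TensorProduct.lid k W).toLinearMap ∘ₗ ξ.rTensor W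

@[simp] theorem sliceR_tmul (ξ : Dual k N) (w : W) (n : N) : sliceR W ξ (w ⊗ₜ n) = ξ n • w := by
  simp [sliceR]

@[simp] theorem sliceL_tmul (ξ : Dual k N) (w : W) (n : N) : sliceL W ξ (n ⊗ₜ w) = ξ n • w := by
  simp [sliceL]

theorem sliceR_rTensor (ξ : Dual k N) (f : W →ₗ[k] Z) (t : W ⊗[k] N) :
    sliceR Z ξ (f.rTensor N t) = f (sliceR W ξ t) := by
  induction t with
  | zero => simp
  | add x y hx hy => simp only [map_add, hx, hy]
  | tmul w n => simp

theorem sliceL_lTensor (ξ : Dual k N) (f : W →ₗ[k] Z) (t : N ⊗[k] W) :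
    sliceL Z ξ (f.lTensor N t) = f (sliceL W ξ t) := by
  induction t with
  | zero => simp
  | add x y hx hy => simp only [map_add, hx, hy]
  | tmul w n => simp

theorem sliceR_lTensor (ξ : Dual k P) (f : N →ₗ[k] P) (t : W ⊗[k] N) :
    sliceR W ξ (f.lTensor W t) = sliceR W (ξ ∘ₗ f) t := by
  induction t with
  | zero => simp
  | add x y hx hy => simp only [map_add, hx, hy]
  | tmul w n => simp

theorem sliceL_rTensor (ξ : Dual k P) (f : N →ₗ[k] P) (t : N ⊗[k] W) :
    sliceL W ξ (f.rTensor W t) = sliceL W (ξ ∘ₗ f) t := by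
  induction t with
  | zero => simp
  | add x y hx hy => simp only [map_add, hx, hy]
  | tmul w n => simp

theorem sliceR_sep {t : W ⊗[k] N} (h : ∀ ξ : Dual k N, sliceR W ξ t = 0) : t = 0 := by
  classical
  let b := Module.Basis.ofVectorSpace k N
  apply (TensorProduct.equivFinsuppOfBasisRight (M := W) b).injective
  rw [map_zero]
  ext i
  have key : ∀ t : W ⊗[k] N,
      TensorProduct.equivFinsuppOfBasisRight (M := W) b t i = sliceR W (b.coord i) t := by
    intro t
    induction t with
    | zero => simp
    | add x y hx hy => simp only [map_add, Finsupp.add_apply, hx, hy]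
    | tmul w n => simp
  rw [key, h, Finsupp.zero_apply]

theorem sliceL_sep {t : N ⊗[k] W} (h : ∀ ξ : Dual k N, sliceL W ξ t = 0) : t = 0 := by
  classical
  let b := Module.Basis.ofVectorSpace k N
  apply (TensorProduct.equivFinsuppOfBasisLeft (N := W) b).injective
  rw [map_zero]
  ext i
  have key : ∀ t : N ⊗[k] W,
      TensorProduct.equivFinsuppOfBasisLeft (N := W) b t i = sliceL W (b.coord i) t := by
    intro t
    induction t with
    | zero => simp
    | add x y hx hy => simp only [map_add, Finsupp.add_apply, hx, hy]
    | tmul w n => simp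
  rw [key, h, Finsupp.zero_apply]

theorem sliceR_ext {s t : W ⊗[k] N} (h : ∀ ξ : Dual k N, sliceR W ξ s = sliceR W ξ t) : s = t :=
  sub_eq_zero.1 (sliceR_sep fun ξ => by rw [map_sub, h, sub_self])

theorem sliceL_ext {s t : N ⊗[k] W} (h : ∀ ξ : Dual k N, sliceL W ξ s = sliceL W ξ t) : s = t :=
  sub_eq_zero.1 (sliceL_sep fun ξ => by rw [map_sub, h, sub_self])

theorem mem_range_of_sliceR (S : Submodule k W) (t : W ⊗[k] N)
    (h : ∀ ξ : Dual k N, sliceR W ξ t ∈ S) : t ∈ LinearMap.range (S.subtype.rTensor N) := by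
  refine ((Module.Flat.rTensor_exact N (LinearMap.exact_subtype_mkQ S)) t).1 ?_
  refine sliceR_sep fun ξ => ?_
  rw [sliceR_rTensor]
  simpa using h ξ

theorem mem_range_of_sliceL (S : Submodule k W) (t : N ⊗[k] W)
    (h : ∀ ξ : Dual k N, sliceL W ξ t ∈ S) : t ∈ LinearMap.range (S.subtype.lTensor N) := by
  refine ((Module.Flat.lTensor_exact N (LinearMap.exact_subtype_mkQ S)) t).1 ?_
  refine sliceL_sep fun ξ => ?_
  rw [sliceL_lTensor]
  simpa using h ξ

theorem exists_finite_sliceR (t : W ⊗[k] N) :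
    ∃ S : Submodule k W, Module.Finite k S ∧ ∀ ξ : Dual k N, sliceR W ξ t ∈ S := by
  induction t with
  | zero => exact ⟨⊥, inferInstance, fun ξ => by simp⟩
  | tmul w n =>
    refine ⟨Submodule.span k {w}, inferInstance, fun ξ => ?_⟩
    rw [sliceR_tmul]
    exact Submodule.smul_mem _ _ (Submodule.mem_span_singleton_self w)
  | add x y hx hy =>
    obtain ⟨S, h1, h2⟩ := hx
    obtain ⟨T, h3, h4⟩ := hy
    refine ⟨S ⊔ T, inferInstance, fun ξ => ?_⟩
    rw [map_add]
    exact Submodule.add_mem_sup (h2 ξ) (h4 ξ)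

theorem exists_finite_sliceL (t : N ⊗[k] W) :
    ∃ S : Submodule k W, Module.Finite k S ∧ ∀ ξ : Dual k N, sliceL W ξ t ∈ S := by
  induction t with
  | zero => exact ⟨⊥, inferInstance, fun ξ => by simp⟩
  | tmul n w =>
    refine ⟨Submodule.span k {w}, inferInstance, fun ξ => ?_⟩
    rw [sliceL_tmul]
    exact Submodule.smul_mem _ _ (Submodule.mem_span_singleton_self w)
  | add x y hx hy =>
    obtain ⟨S, h1, h2⟩ := hx
    obtain ⟨T, h3, h4⟩ := hy
    refine ⟨S ⊔ T, inferInstance, fun ξ => ?_⟩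
    rw [map_add]
    exact Submodule.add_mem_sup (h2 ξ) (h4 ξ)

/-- Every element of a right comodule lies in a finite dimensional subcomodule. -/
theorem exists_finite_right {ρ : M →ₗ[k] M ⊗[k] C} (hρ : IsRightCoaction ρ) (m : M) :
    ∃ (S : Submodule k M) (ρS : S →ₗ[k] S ⊗[k] C), m ∈ S ∧ Module.Finite k S ∧
      IsRightCoaction ρS ∧ S.subtype ∈ rightHoms ρS ρ := by
  let F : Dual k C →ₗ[k] M :=
    { toFun := fun φ => sliceR M φ (ρ m)
      map_add' := fun φ ψ => by simp [sliceR, LinearMap.lTensor_add]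
      map_smul' := fun c φ => by simp [sliceR, LinearMap.lTensor_smul] }
  have hF : ∀ φ, F φ = sliceR M φ (ρ m) := fun φ => rfl
  have hfin : Module.Finite k (LinearMap.range F) := by
    obtain ⟨S, h1, h2⟩ := exists_finite_sliceR (ρ m)
    have : LinearMap.range F ≤ S := by
      rintro _ ⟨φ, rfl⟩
      exact h2 φ
    exact Submodule.finiteDimensional_of_le this
  have hm : m ∈ LinearMap.range F := ⟨Coalgebra.counit, by
    rw [hF, sliceR, LinearMap.comp_apply, hρ.counit]; simp⟩
  have hst : ∀ s : LinearMap.range F, (ρ ∘ₗ (LinearMap.range F).subtype) s ∈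
      LinearMap.range ((LinearMap.range F).subtype.rTensor C) := by
    rintro ⟨_, φ, rfl⟩
    refine mem_range_of_sliceR _ _ fun ψ => ?_
    refine ⟨ψ ∘ₗ sliceR C φ ∘ₗ Coalgebra.comul, ?_⟩
    change F _ = sliceR M ψ (ρ (F φ))
    rw [hF, hF, ← sliceR_lTensor, LinearMap.lTensor_comp_apply, ← hρ.coassoc, ← sliceR_rTensor]
    congr 1
    generalize ρ.rTensor C (ρ m) = t
    exact LinearMap.congr_fun (f := (sliceR C φ).lTensor M ∘ₗ
      (TensorProduct.assoc k M C C).toLinearMap) (g := sliceR (M ⊗[k] C) φ)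
      (TensorProduct.ext_threefold fun a b c => by simp) t
  let ρS := lift ((LinearMap.range F).subtype.rTensor C)
    (rTensor_inj (LinearMap.range F).injective_subtype) (ρ ∘ₗ (LinearMap.range F).subtype) hst
  have hS : (LinearMap.range F).subtype ∈ rightHoms ρS ρ := fun s => (lift_spec _ _ _ hst s).symm
  exact ⟨LinearMap.range F, ρS, hm, hfin, hρ.of_inj (Submodule.injective_subtype _) hS, hS⟩

/-- Every element of a left comodule lies in a finite dimensional subcomodule. -/
theorem exists_finite_left {l : M →ₗ[k] C ⊗[k] M} (hl : IsLeftCoaction l) (m : M) :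
    ∃ (S : Submodule k M) (lS : S →ₗ[k] C ⊗[k] S), m ∈ S ∧ Module.Finite k S ∧
      IsLeftCoaction lS ∧ S.subtype ∈ leftHoms lS l := by
  let F : Dual k C →ₗ[k] M :=
    { toFun := fun φ => sliceL M φ (l m)
      map_add' := fun φ ψ => by simp [sliceL, LinearMap.rTensor_add]
      map_smul' := fun c φ => by simp [sliceL, LinearMap.rTensor_smul] }
  have hF : ∀ φ, F φ = sliceL M φ (l m) := fun φ => rfl
  have hfin : Module.Finite k (LinearMap.range F) := by
    obtain ⟨S, h1, h2⟩ := exists_finite_sliceL (l m)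
    have : LinearMap.range F ≤ S := by
      rintro _ ⟨φ, rfl⟩
      exact h2 φ
    exact Submodule.finiteDimensional_of_le this
  have hm : m ∈ LinearMap.range F := ⟨Coalgebra.counit, by
    rw [hF, sliceL, LinearMap.comp_apply, hl.counit]; simp⟩
  have hst : ∀ s : LinearMap.range F, (l ∘ₗ (LinearMap.range F).subtype) s ∈
      LinearMap.range ((LinearMap.range F).subtype.lTensor C) := by
    rintro ⟨_, φ, rfl⟩
    refine mem_range_of_sliceL _ _ fun ψ => ?_
    refine ⟨ψ ∘ₗ sliceL C φ ∘ₗ Coalgebra.comul, ?_⟩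
    change F _ = sliceL M ψ (l (F φ))
    rw [hF, hF, ← sliceL_rTensor, LinearMap.rTensor_comp_apply, ← sliceL_lTensor, ← hl.coassoc]
    congr 1
    generalize Coalgebra.comul.rTensor M (l m) = t
    exact LinearMap.congr_fun (f := (sliceL C φ).rTensor M)
      (g := sliceL (C ⊗[k] M) φ ∘ₗ (TensorProduct.assoc k C C M).toLinearMap)
      (TensorProduct.ext_threefold fun a b c => by simp [TensorProduct.smul_tmul']) t
  let lS := lift ((LinearMap.range F).subtype.lTensor C)
    (lTensor_inj (LinearMap.range F).injective_subtype) (l ∘ₗ (LinearMap.range F).subtype) hst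
  have hS : (LinearMap.range F).subtype ∈ leftHoms lS l := fun s => (lift_spec _ _ _ hst s).symm
  exact ⟨LinearMap.range F, lS, hm, hfin, hl.of_inj (Submodule.injective_subtype _) hS, hS⟩

end Slices

/-! ### The underlying space of the co-Hom functor -/

section CoHomSpace

open Module (Dual)

variable {M L W : Type u} [AddCommGroup M] [Module k M] [AddCommGroup L] [Module k L]
  [AddCommGroup W] [Module k W]

/-- The map `M ⊗ L* → Homᶜ(M, L)*` sending `m ⊗ ξ` to the functional `f ↦ ξ (f m)`. -/
def evR (ρ : M →ₗ[k] M ⊗[k] C) (ρL : L →ₗ[k] L ⊗[k] C) :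
    M ⊗[k] Dual k L →ₗ[k] Dual k (rightHoms ρ ρL) :=
  TensorProduct.lift (LinearMap.mk₂ k
    (fun m ξ => ξ ∘ₗ LinearMap.applyₗ m ∘ₗ (rightHoms ρ ρL).subtype)
    (fun _ _ _ => by ext; simp) (fun _ _ _ => by ext; simp)
    (fun _ _ _ => by ext; simp) (fun _ _ _ => by ext; simp))

@[simp] theorem evR_tmul (ρ : M →ₗ[k] M ⊗[k] C) (ρL : L →ₗ[k] L ⊗[k] C) (m : M) (ξ : Dual k L)
    (f : rightHoms ρ ρL) : evR ρ ρL (m ⊗ₜ ξ) f = ξ (f.1 m) := by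
  simp [evR]

/-- The space `h_C(L, M)`: the subspace of the dual of `Homᶜ(M, L)` spanned by the functionals
`f ↦ ξ (f m)` with `m ∈ M` and `ξ ∈ L*`. -/
def CoHomR (ρ : M →ₗ[k] M ⊗[k] C) (ρL : L →ₗ[k] L ⊗[k] C) : Type u :=
  LinearMap.range (evR ρ ρL)

instance (ρ : M →ₗ[k] M ⊗[k] C) (ρL : L →ₗ[k] L ⊗[k] C) : AddCommGroup (CoHomR ρ ρL) :=
  inferInstanceAs (AddCommGroup (LinearMap.range (evR ρ ρL)))

instance (ρ : M →ₗ[k] M ⊗[k] C) (ρL : L →ₗ[k] L ⊗[k] C) : Module k (CoHomR ρ ρL) :=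
  inferInstanceAs (Module k (LinearMap.range (evR ρ ρL)))

/-- The inclusion of `h_C(L, M)` in the dual of `Homᶜ(M, L)`. -/
def inclR (ρ : M →ₗ[k] M ⊗[k] C) (ρL : L →ₗ[k] L ⊗[k] C) :
    CoHomR ρ ρL →ₗ[k] Dual k (rightHoms ρ ρL) :=
  (LinearMap.range (evR ρ ρL)).subtype

/-- The projection `M ⊗ L* → h_C(L, M)`. -/
def projR (ρ : M →ₗ[k] M ⊗[k] C) (ρL : L →ₗ[k] L ⊗[k] C) : M ⊗[k] Dual k L →ₗ[k] CoHomR ρ ρL :=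
  (evR ρ ρL).rangeRestrict

theorem projR_surj (ρ : M →ₗ[k] M ⊗[k] C) (ρL : L →ₗ[k] L ⊗[k] C) :
    Function.Surjective (projR ρ ρL) := by
  rintro ⟨_, t, rfl⟩
  exact ⟨t, rfl⟩

theorem inclR_projR (ρ : M →ₗ[k] M ⊗[k] C) (ρL : L →ₗ[k] L ⊗[k] C) (t : M ⊗[k] Dual k L) :
    inclR ρ ρL (projR ρ ρL t) = evR ρ ρL t := rfl

/-- The pairing of `h_C(L, M)` with a colinear map `M → L`. -/
def pairR {ρ : M →ₗ[k] M ⊗[k] C} {ρL : L →ₗ[k] L ⊗[k] C} (f : rightHoms ρ ρL) :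
    Dual k (CoHomR ρ ρL) :=
  LinearMap.applyₗ f ∘ₗ inclR ρ ρL

theorem pairR_projR {ρ : M →ₗ[k] M ⊗[k] C} {ρL : L →ₗ[k] L ⊗[k] C} (f : rightHoms ρ ρL) (m : M)
    (ξ : Dual k L) : pairR f (projR ρ ρL (m ⊗ₜ ξ)) = ξ (f.1 m) :=
  evR_tmul ρ ρL m ξ f

theorem pairR_sep {ρ : M →ₗ[k] M ⊗[k] C} {ρL : L →ₗ[k] L ⊗[k] C} {a b : CoHomR ρ ρL}
    (h : ∀ f : rightHoms ρ ρL, pairR f a = pairR f b) : a = b :=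
  Subtype.ext (LinearMap.ext h)

theorem pairR_tensor_sep {ρ : M →ₗ[k] M ⊗[k] C} {ρL : L →ₗ[k] L ⊗[k] C} {s t : CoHomR ρ ρL ⊗[k] W}
    (h : ∀ f : rightHoms ρ ρL, sliceL W (pairR f) s = sliceL W (pairR f) t) : s = t := by
  refine sliceR_ext fun ξ => pairR_sep fun f => ?_
  have key : ∀ t : CoHomR ρ ρL ⊗[k] W, pairR f (sliceR _ ξ t) = ξ (sliceL W (pairR f) t) := by
    intro t
    induction t with
    | zero => simp
    | add x y hx hy => simp only [map_add, hx, hy]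
    | tmul a w => simp [mul_comm]
  rw [key, key, h]

theorem evR_surj (ρ : M →ₗ[k] M ⊗[k] C) (ρL : L →ₗ[k] L ⊗[k] C)
    (h : Module.Finite k (rightHoms ρ ρL)) : Function.Surjective (evR ρ ρL) := by
  rw [← LinearMap.range_eq_top,
    ← Subspace.dualCoannihilator_dualAnnihilator_eq (W := LinearMap.range (evR ρ ρL)),
    Submodule.dualAnnihilator_eq_top_iff, eq_bot_iff]
  intro f hf
  rw [Submodule.mem_dualCoannihilator] at hf
  refine Subtype.ext (LinearMap.ext fun v => ?_)
  refine (Module.forall_dual_apply_eq_zero_iff k _).1 fun ξ => ?_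
  rw [← evR_tmul]
  exact hf _ ⟨_, rfl⟩

theorem exists_pairR {N : Type u} [AddCommGroup N] [Module k N] {ρ : M →ₗ[k] M ⊗[k] C}
    {ρL : L →ₗ[k] L ⊗[k] C} {ρN : N →ₗ[k] N ⊗[k] C} {i : N →ₗ[k] M} (hi : i ∈ rightHoms ρN ρ)
    (h : Module.Finite k (rightHoms ρN ρL)) (θ : Dual k (rightHoms ρN ρL)) :
    ∃ x : CoHomR ρ ρL, ∀ f, pairR f x = θ ⟨f.1 ∘ₗ i, rightHoms_comp f.2 hi⟩ := by
  obtain ⟨t, rfl⟩ := evR_surj ρN ρL h θ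
  refine ⟨projR ρ ρL (i.rTensor _ t), fun f => ?_⟩
  induction t with
  | zero => simp
  | add x y hx hy => simp only [map_add, hx, hy, LinearMap.add_apply]
  | tmul v ξ => rw [LinearMap.rTensor_tmul, pairR_projR, evR_tmul]; rfl

theorem exists_etaR_of {N : Type u} [AddCommGroup N] [Module k N] {ρ : M →ₗ[k] M ⊗[k] C}
    {ρL : L →ₗ[k] L ⊗[k] C} {ρN : N →ₗ[k] N ⊗[k] C} {i : N →ₗ[k] M} (hi : i ∈ rightHoms ρN ρ)
    (h : Module.Finite k (rightHoms ρN ρL)) (n : N) :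
    ∃ t : CoHomR ρ ρL ⊗[k] L, ∀ ξ, sliceR _ ξ t = projR ρ ρL (i n ⊗ₜ ξ) := by
  choose x hx using exists_pairR (ρL := ρL) hi h
  let b := Module.finBasis k (rightHoms ρN ρL)
  refine ⟨∑ j, x (b.coord j) ⊗ₜ[k] (b j).1 n, fun ξ => ?_⟩
  refine pairR_sep fun f => ?_
  let f' : rightHoms ρN ρL := ⟨f.1 ∘ₗ i, rightHoms_comp f.2 hi⟩
  have h2 : f'.1 = ∑ j, b.repr f' j • (b j).1 := by
    have := congrArg Subtype.val (b.sum_repr f')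
    rw [← this]
    simp only [Submodule.coe_sum, Submodule.coe_smul]
  have h3 : f.1 (i n) = ∑ j, b.repr f' j • (b j).1 n := by
    have := LinearMap.congr_fun h2 n
    rw [LinearMap.sum_apply] at this
    exact this
  rw [pairR_projR, h3, map_sum, map_sum, map_sum]
  refine Finset.sum_congr rfl fun j _ => ?_
  rw [sliceR_tmul, map_smul, hx, map_smul, smul_eq_mul, smul_eq_mul, mul_comm]
  rfl

theorem exists_etaR {ρ : M →ₗ[k] M ⊗[k] C} (hρ : IsRightCoaction ρ) {ρL : L →ₗ[k] L ⊗[k] C}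
    (hq : ∀ V : RightComod k C, Module.Finite k V → Module.Finite k (rightHoms V.coact ρL))
    (m : M) : ∃ t : CoHomR ρ ρL ⊗[k] L, ∀ ξ, sliceR _ ξ t = projR ρ ρL (m ⊗ₜ ξ) := by
  obtain ⟨S, ρS, hm, hfin, hρS, hS⟩ := exists_finite_right hρ m
  exact exists_etaR_of hS (hq ⟨S, ρS, hρS⟩ hfin) ⟨m, hm⟩

/-- The unit `M → h_C(L, M) ⊗ L`, for `L` quasifinite. -/
def etaR {ρ : M →ₗ[k] M ⊗[k] C} (hρ : IsRightCoaction ρ) {ρL : L →ₗ[k] L ⊗[k] C}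
    (hq : ∀ V : RightComod k C, Module.Finite k V → Module.Finite k (rightHoms V.coact ρL)) :
    M →ₗ[k] CoHomR ρ ρL ⊗[k] L where
  toFun m := (exists_etaR hρ hq m).choose
  map_add' m n := sliceR_ext fun ξ => by
    rw [map_add, (exists_etaR hρ hq m).choose_spec, (exists_etaR hρ hq n).choose_spec,
      (exists_etaR hρ hq (m + n)).choose_spec, TensorProduct.add_tmul, map_add]
  map_smul' c m := sliceR_ext fun ξ => by
    rw [map_smul, (exists_etaR hρ hq m).choose_spec,
      (exists_etaR hρ hq (c • m)).choose_spec, ← TensorProduct.smul_tmul', map_smul,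
      RingHom.id_apply]

variable {ρ : M →ₗ[k] M ⊗[k] C} (hρ : IsRightCoaction ρ) {ρL : L →ₗ[k] L ⊗[k] C}
  (hq : ∀ V : RightComod k C, Module.Finite k V → Module.Finite k (rightHoms V.coact ρL))

theorem etaR_slice (m : M) (ξ : Dual k L) :
    sliceR _ ξ (etaR hρ hq m) = projR ρ ρL (m ⊗ₜ ξ) :=
  (exists_etaR hρ hq m).choose_spec ξ

theorem etaR_pair (f : rightHoms ρ ρL) (m : M) : sliceL L (pairR f) (etaR hρ hq m) = f.1 m := by
  refine sub_eq_zero.1 ((Module.forall_dual_apply_eq_zero_iff k _).1 fun ξ => ?_)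
  rw [map_sub, sub_eq_zero, ← pairR_projR, ← etaR_slice hρ hq]
  generalize etaR hρ hq m = t
  induction t with
  | zero => simp
  | add x y hx hy => simp only [map_add, hx, hy]
  | tmul a w => simp [mul_comm]

theorem etaR_colin : etaR hρ hq ∈ rightHoms ρ (rightTensor (CoHomR ρ ρL) ρL) := fun m => by
  apply (TensorProduct.assoc k (CoHomR ρ ρL) L C).injective
  refine pairR_tensor_sep fun f => ?_
  rw [rightTensor, LinearMap.comp_apply, LinearEquiv.coe_coe, LinearEquiv.apply_symm_apply,
    sliceL_lTensor, etaR_pair, f.2 m]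
  have key : ∀ t : (CoHomR ρ ρL ⊗[k] L) ⊗[k] C,
      sliceL (L ⊗[k] C) (pairR f) (TensorProduct.assoc k (CoHomR ρ ρL) L C t) =
        (sliceL L (pairR f)).rTensor C t := fun t =>
    LinearMap.congr_fun (f := sliceL (L ⊗[k] C) (pairR f) ∘ₗ
      (TensorProduct.assoc k (CoHomR ρ ρL) L C).toLinearMap) (g := (sliceL L (pairR f)).rTensor C)
      (TensorProduct.ext_threefold fun a b c => by simp [TensorProduct.smul_tmul']) t
  rw [key, ← LinearMap.rTensor_comp_apply,
    show sliceL L (pairR f) ∘ₗ etaR hρ hq = f.1 from LinearMap.ext (etaR_pair hρ hq f)]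

theorem etaR_ext {h h' : CoHomR ρ ρL →ₗ[k] W}
    (H : ∀ m, h.rTensor L (etaR hρ hq m) = h'.rTensor L (etaR hρ hq m)) : h = h' := by
  have : h ∘ₗ projR ρ ρL = h' ∘ₗ projR ρ ρL := TensorProduct.ext' fun m ξ => by
    rw [LinearMap.comp_apply, LinearMap.comp_apply, ← etaR_slice hρ hq, ← sliceR_rTensor, H,
      sliceR_rTensor]
  ext x
  obtain ⟨t, rfl⟩ := projR_surj ρ ρL x
  exact LinearMap.congr_fun this t

theorem exists_descR {g : M →ₗ[k] W ⊗[k] L} (hg : g ∈ rightHoms ρ (rightTensor W ρL)) :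
    ∃ h : CoHomR ρ ρL →ₗ[k] W, ∀ m, h.rTensor L (etaR hρ hq m) = g m := by
  let G : M ⊗[k] Dual k L →ₗ[k] W := TensorProduct.lift (LinearMap.mk₂ k
    (fun m ξ => sliceR W ξ (g m))
    (fun _ _ _ => by simp) (fun _ _ _ => by simp)
    (fun _ _ _ => by simp [sliceR, LinearMap.lTensor_add])
    (fun _ _ _ => by simp [sliceR, LinearMap.lTensor_smul]))
  have hG : ∀ m ξ, G (m ⊗ₜ ξ) = sliceR W ξ (g m) := fun m ξ => rfl
  have hw : ∀ w : Dual k W, sliceL L w ∘ₗ g ∈ rightHoms ρ ρL := by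
    intro w
    refine rightHoms_comp (fun t => ?_) hg
    induction t with
    | zero => simp
    | add x y hx hy => simp only [map_add, hx, hy]
    | tmul a x =>
      simp only [rightTensor, sliceL_tmul, map_smul, LinearMap.comp_apply, LinearMap.lTensor_tmul,
        LinearEquiv.coe_coe]
      induction ρL x with
      | zero => simp
      | add x y hx hy => simp only [map_add, TensorProduct.tmul_add, smul_add, hx, hy]
      | tmul a x => simp [TensorProduct.smul_tmul']
  have hker : LinearMap.ker (evR ρ ρL) ≤ LinearMap.ker G := by
    intro t ht
    refine (Module.forall_dual_apply_eq_zero_iff k _).1 fun w => ?_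
    have : ∀ t, w (G t) = evR ρ ρL t ⟨_, hw w⟩ := by
      intro t
      induction t with
      | zero => simp
      | add x y hx hy => simp only [map_add, hx, hy, LinearMap.add_apply]
      | tmul m ξ =>
        rw [hG, evR_tmul, LinearMap.comp_apply]
        generalize g m = t
        induction t with
        | zero => simp
        | add x y hx hy => simp only [map_add, hx, hy]
        | tmul a x => simp [mul_comm]
    rw [this, LinearMap.mem_ker.1 ht, LinearMap.zero_apply]
  have hproj : LinearMap.ker (projR ρ ρL) ≤ LinearMap.ker G := fun t ht => hker (by
    rw [LinearMap.mem_ker, ← inclR_projR, LinearMap.mem_ker.1 ht, map_zero])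
  refine ⟨(LinearMap.ker (projR ρ ρL)).liftQ G hproj ∘ₗ
    ((projR ρ ρL).quotKerEquivOfSurjective (projR_surj ρ ρL)).symm.toLinearMap,
    fun m => sliceR_ext fun ξ => ?_⟩
  rw [sliceR_rTensor, etaR_slice, ← hG]
  have : ((projR ρ ρL).quotKerEquivOfSurjective (projR_surj ρ ρL)).symm (projR ρ ρL (m ⊗ₜ ξ)) =
      Submodule.Quotient.mk (m ⊗ₜ ξ) := by
    rw [LinearEquiv.symm_apply_eq]
    rfl
  rw [LinearMap.comp_apply, LinearEquiv.coe_coe, this]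
  rfl

/-- The linear map `h_C(L, M) → W` corresponding to a colinear map `M → W ⊗ L`. -/
def descR {g : M →ₗ[k] W ⊗[k] L} (hg : g ∈ rightHoms ρ (rightTensor W ρL)) :
    CoHomR ρ ρL →ₗ[k] W :=
  (exists_descR hρ hq hg).choose

theorem descR_spec {g : M →ₗ[k] W ⊗[k] L} (hg : g ∈ rightHoms ρ (rightTensor W ρL)) (m : M) :
    (descR hρ hq hg).rTensor L (etaR hρ hq m) = g m :=
  (exists_descR hρ hq hg).choose_spec m

end CoHomSpace

section CoHomCoaction

variable {M L N V W : Type u} [AddCommGroup M] [Module k M] [AddCommGroup L] [Module k L]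
  [AddCommGroup N] [Module k N] [AddCommGroup V] [Module k V] [AddCommGroup W] [Module k W]

theorem assoc_pent {P A B Z : Type u} [AddCommGroup P] [Module k P] [AddCommGroup A] [Module k A]
    [AddCommGroup B] [Module k B] [AddCommGroup Z] [Module k Z] (t : ((P ⊗[k] A) ⊗[k] B) ⊗[k] Z) :
    (TensorProduct.assoc k A B Z).toLinearMap.lTensor P (TensorProduct.assoc k P (A ⊗[k] B) Z
      ((TensorProduct.assoc k P A B).toLinearMap.rTensor Z t)) =
    TensorProduct.assoc k P A (B ⊗[k] Z) (TensorProduct.assoc k (P ⊗[k] A) B Z t) :=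
  LinearMap.congr_fun (f := (TensorProduct.assoc k A B Z).toLinearMap.lTensor P ∘ₗ
      (TensorProduct.assoc k P (A ⊗[k] B) Z).toLinearMap ∘ₗ
      (TensorProduct.assoc k P A B).toLinearMap.rTensor Z)
    (g := (TensorProduct.assoc k P A (B ⊗[k] Z)).toLinearMap ∘ₗ
      (TensorProduct.assoc k (P ⊗[k] A) B Z).toLinearMap)
    (TensorProduct.ext_fourfold fun a b c d => by simp) t

theorem assoc_symm_mem_rightHoms (ρ : N →ₗ[k] N ⊗[k] C) :
    (TensorProduct.assoc k V W N).symm.toLinearMap ∈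
      rightHoms (rightTensor V (rightTensor W ρ)) (rightTensor (V ⊗[k] W) ρ) := by
  intro t
  rw [LinearEquiv.coe_coe]
  obtain ⟨t, rfl⟩ := (TensorProduct.assoc k V W N).surjective t
  rw [LinearEquiv.symm_apply_apply]
  simp only [rightTensor, LinearMap.comp_apply, LinearEquiv.coe_coe, LinearMap.lTensor_comp,
    ← assoc_nat3]
  generalize ρ.lTensor (V ⊗[k] W) t = s
  obtain ⟨s, rfl⟩ := (TensorProduct.assoc k (V ⊗[k] W) N C).surjective s
  exact LinearMap.congr_fun (f := (TensorProduct.assoc k (V ⊗[k] W) N C).symm.toLinearMap ∘ₗ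
      (TensorProduct.assoc k (V ⊗[k] W) N C).toLinearMap)
    (g := (TensorProduct.assoc k V W N).symm.toLinearMap.rTensor C ∘ₗ
      (TensorProduct.assoc k V (W ⊗[k] N) C).symm.toLinearMap ∘ₗ
      (TensorProduct.assoc k W N C).symm.toLinearMap.lTensor V ∘ₗ
      (TensorProduct.assoc k V W (N ⊗[k] C)).toLinearMap ∘ₗ
      (TensorProduct.assoc k (V ⊗[k] W) N C).toLinearMap)
    (TensorProduct.ext_fourfold fun a b c d => by simp) s

theorem Bicoassoc.mem_rightHoms {l : L →ₗ[k] D ⊗[k] L} {ρ : L →ₗ[k] L ⊗[k] C}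
    (h : Bicoassoc l ρ) : l ∈ rightHoms ρ (rightTensor D ρ) := fun x => by
  rw [rightTensor, LinearMap.comp_apply, ← h x, LinearEquiv.coe_coe, LinearEquiv.symm_apply_apply]

theorem lTensor_mem_rightHoms {ρ : M →ₗ[k] M ⊗[k] C} {ρ' : N →ₗ[k] N ⊗[k] C}
    {g : M →ₗ[k] N} (hg : g ∈ rightHoms ρ ρ') :
    g.lTensor V ∈ rightHoms (rightTensor V ρ) (rightTensor V ρ') :=
  map_mem_rightHoms LinearMap.id hg

variable {ρ : M →ₗ[k] M ⊗[k] C} (hρ : IsRightCoaction ρ) {ρL : L →ₗ[k] L ⊗[k] C}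
  (hq : ∀ V : RightComod k C, Module.Finite k V → Module.Finite k (rightHoms V.coact ρL))
  {lL : L →ₗ[k] D ⊗[k] L} {lM : M →ₗ[k] E ⊗[k] M}

theorem deltaR_aux (hb : Bicoassoc lL ρL) : (TensorProduct.assoc k (CoHomR ρ ρL) D L).symm.toLinearMap ∘ₗ
    lL.lTensor (CoHomR ρ ρL) ∘ₗ etaR hρ hq ∈ rightHoms ρ (rightTensor (CoHomR ρ ρL ⊗[k] D) ρL) :=
  rightHoms_comp (assoc_symm_mem_rightHoms ρL)
    (rightHoms_comp (lTensor_mem_rightHoms hb.mem_rightHoms) (etaR_colin hρ hq))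

/-- The right `D`-coaction of `h_C(L, M)`, for a `(D, C)`-bicomodule `L`: it is determined by
`(δ ⊗ L) ∘ η = (h_C(L, M) ⊗ l) ∘ η`, where `l : L → D ⊗ L` is the left coaction. -/
def deltaR (hb : Bicoassoc lL ρL) : CoHomR ρ ρL →ₗ[k] CoHomR ρ ρL ⊗[k] D := descR hρ hq (deltaR_aux hρ hq hb)

theorem deltaR_spec (hb : Bicoassoc lL ρL) (m : M) : TensorProduct.assoc k (CoHomR ρ ρL) D L
    ((deltaR hρ hq hb).rTensor L (etaR hρ hq m)) = lL.lTensor (CoHomR ρ ρL) (etaR hρ hq m) := by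
  rw [deltaR, descR_spec]
  simp

theorem deltaR_isCoaction (hb : Bicoassoc lL ρL) (hl : IsLeftCoaction lL) : IsRightCoaction (deltaR hρ hq hb) where
  coassoc := by
    refine LinearMap.congr_fun (f := (TensorProduct.assoc k (CoHomR ρ ρL) D D).toLinearMap ∘ₗ
      (deltaR hρ hq hb).rTensor D ∘ₗ deltaR hρ hq hb)
      (g := Coalgebra.comul.lTensor (CoHomR ρ ρL) ∘ₗ deltaR hρ hq hb)
      (etaR_ext hρ hq fun m => ?_)
    apply (TensorProduct.assoc k (CoHomR ρ ρL) (D ⊗[k] D) L).injective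
    apply lTensor_inj (N := CoHomR ρ ρL) (TensorProduct.assoc k D D L).injective
    rw [LinearMap.rTensor_comp_apply, LinearMap.rTensor_comp_apply, assoc_pent, assoc_nat1,
      deltaR_spec, rl_comm, assoc_nat3, deltaR_spec, LinearMap.rTensor_comp_apply, assoc_nat2,
      deltaR_spec, ← LinearMap.lTensor_comp_apply, ← LinearMap.lTensor_comp_apply,
      ← LinearMap.lTensor_comp_apply]
    congr 2
    exact LinearMap.ext fun x => (hl.coassoc x).symm
  counit := by
    refine LinearMap.congr_fun (f := Coalgebra.counit.lTensor (CoHomR ρ ρL) ∘ₗ deltaR hρ hq hb)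
      (g := (TensorProduct.mk k (CoHomR ρ ρL) k).flip 1) (etaR_ext hρ hq fun m => ?_)
    apply (TensorProduct.assoc k (CoHomR ρ ρL) k L).injective
    rw [LinearMap.rTensor_comp_apply, assoc_nat2, deltaR_spec, ← LinearMap.lTensor_comp_apply,
      show Coalgebra.counit.rTensor L ∘ₗ lL = TensorProduct.mk k k L 1 from
        LinearMap.ext hl.counit]
    generalize etaR hρ hq m = t
    induction t with
    | zero => simp
    | add x y hx hy => simp only [map_add, hx, hy]
    | tmul a x => simp

theorem etaR_mem_cot (hb : Bicoassoc lL ρL) (m : M) : etaR hρ hq m ∈ cot (deltaR hρ hq hb) lL :=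
  mem_cot.2 (deltaR_spec hρ hq hb m)

theorem descR_colin (hb : Bicoassoc lL ρL) {ρN : N →ₗ[k] N ⊗[k] D} {g : M →ₗ[k] N ⊗[k] L}
    (hg : g ∈ rightHoms ρ (rightTensor N ρL)) (hg' : ∀ m, g m ∈ cot ρN lL) :
    descR hρ hq hg ∈ rightHoms (deltaR hρ hq hb) ρN := by
  refine LinearMap.congr_fun (f := ρN ∘ₗ descR hρ hq hg)
    (g := (descR hρ hq hg).rTensor D ∘ₗ deltaR hρ hq hb) (etaR_ext hρ hq fun m => ?_)
  apply (TensorProduct.assoc k N D L).injective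
  rw [LinearMap.rTensor_comp_apply, LinearMap.rTensor_comp_apply, descR_spec, assoc_nat1,
    deltaR_spec, rl_comm, descR_spec]
  exact mem_cot.1 (hg' m)

theorem lambdaR_aux (hM : Bicoassoc lM ρ) : (TensorProduct.assoc k E (CoHomR ρ ρL) L).symm.toLinearMap ∘ₗ
    (etaR hρ hq).lTensor E ∘ₗ lM ∈ rightHoms ρ (rightTensor (E ⊗[k] CoHomR ρ ρL) ρL) :=
  rightHoms_comp (assoc_symm_mem_rightHoms ρL)
    (rightHoms_comp (lTensor_mem_rightHoms (etaR_colin hρ hq)) hM.mem_rightHoms)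

/-- The left `E`-coaction of `h_C(L, M)`, for an `(E, C)`-bicomodule `M`: it is determined by
`(λ ⊗ L) ∘ η = (E ⊗ η) ∘ l`, where `l : M → E ⊗ M` is the left coaction. -/
def lambdaR (hM : Bicoassoc lM ρ) : CoHomR ρ ρL →ₗ[k] E ⊗[k] CoHomR ρ ρL := descR hρ hq (lambdaR_aux hρ hq hM)

theorem lambdaR_spec (hM : Bicoassoc lM ρ) (m : M) : TensorProduct.assoc k E (CoHomR ρ ρL) L
    ((lambdaR hρ hq hM).rTensor L (etaR hρ hq m)) = (etaR hρ hq).lTensor E (lM m) := by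
  rw [lambdaR, descR_spec]
  simp

theorem lambdaR_spec' (hM : Bicoassoc lM ρ) : (TensorProduct.assoc k E (CoHomR ρ ρL) L).toLinearMap ∘ₗ
    (lambdaR hρ hq hM).rTensor L ∘ₗ etaR hρ hq = (etaR hρ hq).lTensor E ∘ₗ lM :=
  LinearMap.ext (lambdaR_spec hρ hq hM)

theorem deltaR_spec' (hb : Bicoassoc lL ρL) : (TensorProduct.assoc k (CoHomR ρ ρL) D L).toLinearMap ∘ₗ
    (deltaR hρ hq hb).rTensor L ∘ₗ etaR hρ hq = lL.lTensor (CoHomR ρ ρL) ∘ₗ etaR hρ hq :=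
  LinearMap.ext (deltaR_spec hρ hq hb)

theorem lambdaR_isCoaction (hM : Bicoassoc lM ρ) (hl : IsLeftCoaction lM) : IsLeftCoaction (lambdaR hρ hq hM) where
  coassoc := by
    refine LinearMap.congr_fun (f := (TensorProduct.assoc k E E (CoHomR ρ ρL)).toLinearMap ∘ₗ
      Coalgebra.comul.rTensor (CoHomR ρ ρL) ∘ₗ lambdaR hρ hq hM)
      (g := (lambdaR hρ hq hM).lTensor E ∘ₗ lambdaR hρ hq hM)
      (etaR_ext hρ hq fun m => ?_)
    apply (TensorProduct.assoc k E (E ⊗[k] CoHomR ρ ρL) L).injective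
    apply lTensor_inj (N := E) (TensorProduct.assoc k E (CoHomR ρ ρL) L).injective
    rw [LinearMap.rTensor_comp_apply, LinearMap.rTensor_comp_apply, assoc_pent, assoc_nat1,
      lambdaR_spec, rl_comm, assoc_nat3, hl.coassoc, LinearMap.rTensor_comp_apply, assoc_nat2,
      lambdaR_spec, ← LinearMap.lTensor_comp_apply, ← LinearMap.lTensor_comp_apply,
      ← LinearMap.lTensor_comp_apply, LinearMap.comp_assoc, lambdaR_spec']
  counit := by
    refine LinearMap.congr_fun (f := Coalgebra.counit.rTensor (CoHomR ρ ρL) ∘ₗ lambdaR hρ hq hM)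
      (g := TensorProduct.mk k k (CoHomR ρ ρL) 1) (etaR_ext hρ hq fun m => ?_)
    apply (TensorProduct.assoc k k (CoHomR ρ ρL) L).injective
    rw [LinearMap.rTensor_comp_apply, assoc_nat1, lambdaR_spec, rl_comm, hl.counit,
      LinearMap.lTensor_tmul]
    generalize etaR hρ hq m = t
    induction t with
    | zero => simp
    | add x y hx hy => simp only [map_add, TensorProduct.tmul_add, hx, hy]
    | tmul a x => simp

theorem coHomR_bicoassoc (hb : Bicoassoc lL ρL) (hM : Bicoassoc lM ρ) : Bicoassoc (lambdaR hρ hq hM) (deltaR hρ hq hb) := by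
  refine LinearMap.congr_fun (f := (TensorProduct.assoc k E (CoHomR ρ ρL) D).toLinearMap ∘ₗ
    (lambdaR hρ hq hM).rTensor D ∘ₗ deltaR hρ hq hb)
    (g := (deltaR hρ hq hb).lTensor E ∘ₗ lambdaR hρ hq hM) (etaR_ext hρ hq fun m => ?_)
  apply (TensorProduct.assoc k E (CoHomR ρ ρL ⊗[k] D) L).injective
  apply lTensor_inj (N := E) (TensorProduct.assoc k (CoHomR ρ ρL) D L).injective
  rw [LinearMap.rTensor_comp_apply, LinearMap.rTensor_comp_apply, assoc_pent, assoc_nat1,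
    deltaR_spec, rl_comm, assoc_nat3, lambdaR_spec, LinearMap.rTensor_comp_apply, assoc_nat2,
    lambdaR_spec, ← LinearMap.lTensor_comp_apply, ← LinearMap.lTensor_comp_apply,
    ← LinearMap.lTensor_comp_apply, LinearMap.comp_assoc, deltaR_spec']

end CoHomCoaction

/-! ### The co-Hom functor -/

/-- The right `D`-comodule `h_C(Λ, M)`, for `Λ` a `(D, C)`-bicomodule that is quasifinite as a
right `C`-comodule. -/
@[reducible] def RightComod.coHom (L : Bicomod k D C) (hL : L.toRight.Quasifinite)
    (M : RightComod k C) : RightComod k D where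
  carrier := CoHomR M.coact L.rcoact
  coact := deltaR M.isCoaction hL L.bicoassoc
  isCoaction := deltaR_isCoaction M.isCoaction hL L.bicoassoc L.isLeft

theorem coHomRight_aux (L : Bicomod k D C) (hL : L.toRight.Quasifinite) (M : RightComod k C)
    (N : RightComod k D) (h : RightComod.coHom L hL M ⟶ N) :
    h.lin.rTensor L ∘ₗ etaR M.isCoaction hL ∈ rightHoms M.coact (rightTensor N L.rcoact) :=
  rightHoms_comp (map_mem_rightHoms h.lin (rightHoms_id L.rcoact)) (etaR_colin M.isCoaction hL)

theorem coHomRight_aux' (L : Bicomod k D C) (M : RightComod k C) (N : RightComod k D)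
    (f : M ⟶ (cotensorRight L).obj N) :
    (cot N.coact L.lcoact).subtype ∘ₗ f.lin ∈ rightHoms M.coact (rightTensor N L.rcoact) :=
  rightHoms_comp (subtype_mem_rightHoms N.coact L.bicoassoc) f.colin

/-- The universal property of `h_C(Λ, M)`: colinear maps `h_C(Λ, M) → N` correspond to colinear
maps `M → N □_D Λ`. -/
def coHomRightEquiv (L : Bicomod k D C) (hL : L.toRight.Quasifinite) (M : RightComod k C)
    (N : RightComod k D) :
    (RightComod.coHom L hL M ⟶ N) ≃ (M ⟶ (cotensorRight L).obj N) where
  toFun h := ⟨(h.lin.rTensor L ∘ₗ etaR M.isCoaction hL).codRestrict _ fun m =>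
      map_mem_cot h.colin (leftHoms_id L.lcoact) _ (etaR_mem_cot M.isCoaction hL L.bicoassoc m),
    mem_rightHoms_rightCot L.bicoassoc (coHomRight_aux L hL M N h)⟩
  invFun f := ⟨descR M.isCoaction hL (coHomRight_aux' L M N f),
    descR_colin M.isCoaction hL L.bicoassoc _ fun m => (f.lin m).2⟩
  left_inv h := RightComod.Hom.ext (etaR_ext M.isCoaction hL fun m =>
    descR_spec M.isCoaction hL (coHomRight_aux L hL M N h) m)
  right_inv f := RightComod.Hom.ext (LinearMap.ext fun m => Subtype.ext
    (descR_spec M.isCoaction hL (coHomRight_aux' L M N f) m))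

theorem coHomRightEquiv_naturality (L : Bicomod k D C) (hL : L.toRight.Quasifinite)
    (M : RightComod k C) (N N' : RightComod k D) (g : N ⟶ N') (h : RightComod.coHom L hL M ⟶ N) :
    coHomRightEquiv L hL M N' (h ≫ g) = coHomRightEquiv L hL M N h ≫ (cotensorRight L).map g :=
  RightComod.Hom.ext (LinearMap.ext fun m => Subtype.ext
    (LinearMap.rTensor_comp_apply L g.lin h.lin (etaR M.isCoaction hL m)))

/-- The co-Hom functor `h_C(Λ, -) : Mᶜ ⥤ Mᴰ`, for `Λ` a `(D, C)`-bicomodule that is quasifinite as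
a right `C`-comodule. -/
def coHomRight (L : Bicomod k D C) (hL : L.toRight.Quasifinite) :
    RightComod k C ⥤ RightComod k D :=
  Adjunction.leftAdjointOfEquiv (G := cotensorRight L) (F_obj := RightComod.coHom L hL)
    (coHomRightEquiv L hL) fun M N N' g h => coHomRightEquiv_naturality L hL M N N' g h

/-- The co-Hom functor `h_C(Λ, -)` is left adjoint to `- □_D Λ`. -/
def coHomRightAdjunction (L : Bicomod k D C) (hL : L.toRight.Quasifinite) :
    coHomRight L hL ⊣ cotensorRight L :=
  Adjunction.adjunctionOfEquivLeft _ _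

/-- The `(C, D)`-bicomodule `h_C(Λ, C)`, for `Λ` a `(D, C)`-bicomodule that is quasifinite as a
right `C`-comodule. -/
@[reducible] def Bicomod.coHomRight (L : Bicomod k D C) (hL : L.toRight.Quasifinite) :
    Bicomod k C D where
  carrier := CoHomR (Bicomod.regular k C).rcoact L.rcoact
  lcoact := lambdaR (Bicomod.regular k C).isRight hL (Bicomod.regular k C).bicoassoc
  rcoact := deltaR (Bicomod.regular k C).isRight hL L.bicoassoc
  isLeft := lambdaR_isCoaction _ _ _ (Bicomod.regular k C).isLeft
  isRight := deltaR_isCoaction _ _ _ L.isLeft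
  bicoassoc := coHomR_bicoassoc _ _ _ _

theorem Bicomod.coHomRight_toRight (L : Bicomod k D C) (hL : L.toRight.Quasifinite) :
    (Bicomod.coHomRight L hL).toRight =
      (MoritaTakeuchi.coHomRight L hL).obj (RightComod.regular k C) := rfl

/-! ### The left-handed version of the co-Hom space -/

section CoHomSpace

open Module (Dual)

variable {M L W : Type u} [AddCommGroup M] [Module k M] [AddCommGroup L] [Module k L]
  [AddCommGroup W] [Module k W]

/-- The map `M ⊗ L* → ᶜHom(M, L)*` sending `m ⊗ ξ` to the functional `f ↦ ξ (f m)`. -/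
def evL (ρ : M →ₗ[k] C ⊗[k] M) (ρL : L →ₗ[k] C ⊗[k] L) :
    M ⊗[k] Dual k L →ₗ[k] Dual k (leftHoms ρ ρL) :=
  TensorProduct.lift (LinearMap.mk₂ k
    (fun m ξ => ξ ∘ₗ LinearMap.applyₗ m ∘ₗ (leftHoms ρ ρL).subtype)
    (fun _ _ _ => by ext; simp) (fun _ _ _ => by ext; simp)
    (fun _ _ _ => by ext; simp) (fun _ _ _ => by ext; simp))

@[simp] theorem evL_tmul (ρ : M →ₗ[k] C ⊗[k] M) (ρL : L →ₗ[k] C ⊗[k] L) (m : M) (ξ : Dual k L)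
    (f : leftHoms ρ ρL) : evL ρ ρL (m ⊗ₜ ξ) f = ξ (f.1 m) := by
  simp [evL]

/-- The space `_Ch(L, M)`: the subspace of the dual of `ᶜHom(M, L)` spanned by the functionals
`f ↦ ξ (f m)` with `m ∈ M` and `ξ ∈ L*`. -/
def CoHomL (ρ : M →ₗ[k] C ⊗[k] M) (ρL : L →ₗ[k] C ⊗[k] L) : Type u :=
  LinearMap.range (evL ρ ρL)

instance (ρ : M →ₗ[k] C ⊗[k] M) (ρL : L →ₗ[k] C ⊗[k] L) : AddCommGroup (CoHomL ρ ρL) :=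
  inferInstanceAs (AddCommGroup (LinearMap.range (evL ρ ρL)))

instance (ρ : M →ₗ[k] C ⊗[k] M) (ρL : L →ₗ[k] C ⊗[k] L) : Module k (CoHomL ρ ρL) :=
  inferInstanceAs (Module k (LinearMap.range (evL ρ ρL)))

/-- The inclusion of `_Ch(L, M)` in the dual of `ᶜHom(M, L)`. -/
def inclL (ρ : M →ₗ[k] C ⊗[k] M) (ρL : L →ₗ[k] C ⊗[k] L) :
    CoHomL ρ ρL →ₗ[k] Dual k (leftHoms ρ ρL) :=
  (LinearMap.range (evL ρ ρL)).subtype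

/-- The projection `M ⊗ L* → _Ch(L, M)`. -/
def projL (ρ : M →ₗ[k] C ⊗[k] M) (ρL : L →ₗ[k] C ⊗[k] L) : M ⊗[k] Dual k L →ₗ[k] CoHomL ρ ρL :=
  (evL ρ ρL).rangeRestrict

theorem projL_surj (ρ : M →ₗ[k] C ⊗[k] M) (ρL : L →ₗ[k] C ⊗[k] L) :
    Function.Surjective (projL ρ ρL) := by
  rintro ⟨_, t, rfl⟩
  exact ⟨t, rfl⟩

theorem inclL_projR (ρ : M →ₗ[k] C ⊗[k] M) (ρL : L →ₗ[k] C ⊗[k] L) (t : M ⊗[k] Dual k L) :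
    inclL ρ ρL (projL ρ ρL t) = evL ρ ρL t := rfl

/-- The pairing of `_Ch(L, M)` with a colinear map `M → L`. -/
def pairL {ρ : M →ₗ[k] C ⊗[k] M} {ρL : L →ₗ[k] C ⊗[k] L} (f : leftHoms ρ ρL) :
    Dual k (CoHomL ρ ρL) :=
  LinearMap.applyₗ f ∘ₗ inclL ρ ρL

theorem pairL_projR {ρ : M →ₗ[k] C ⊗[k] M} {ρL : L →ₗ[k] C ⊗[k] L} (f : leftHoms ρ ρL) (m : M)
    (ξ : Dual k L) : pairL f (projL ρ ρL (m ⊗ₜ ξ)) = ξ (f.1 m) :=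
  evL_tmul ρ ρL m ξ f

theorem pairL_sep {ρ : M →ₗ[k] C ⊗[k] M} {ρL : L →ₗ[k] C ⊗[k] L} {a b : CoHomL ρ ρL}
    (h : ∀ f : leftHoms ρ ρL, pairL f a = pairL f b) : a = b :=
  Subtype.ext (LinearMap.ext h)

theorem pairL_tensor_sep {ρ : M →ₗ[k] C ⊗[k] M} {ρL : L →ₗ[k] C ⊗[k] L} {s t : W ⊗[k] CoHomL ρ ρL}
    (h : ∀ f : leftHoms ρ ρL, sliceR W (pairL f) s = sliceR W (pairL f) t) : s = t := by
  refine sliceL_ext fun ξ => pairL_sep fun f => ?_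
  have key : ∀ t : W ⊗[k] CoHomL ρ ρL, pairL f (sliceL _ ξ t) = ξ (sliceR W (pairL f) t) := by
    intro t
    induction t with
    | zero => simp
    | add x y hx hy => simp only [map_add, hx, hy]
    | tmul a w => simp [mul_comm]
  rw [key, key, h]

theorem evL_surj (ρ : M →ₗ[k] C ⊗[k] M) (ρL : L →ₗ[k] C ⊗[k] L)
    (h : Module.Finite k (leftHoms ρ ρL)) : Function.Surjective (evL ρ ρL) := by
  rw [← LinearMap.range_eq_top,
    ← Subspace.dualCoannihilator_dualAnnihilator_eq (W := LinearMap.range (evL ρ ρL)),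
    Submodule.dualAnnihilator_eq_top_iff, eq_bot_iff]
  intro f hf
  rw [Submodule.mem_dualCoannihilator] at hf
  refine Subtype.ext (LinearMap.ext fun v => ?_)
  refine (Module.forall_dual_apply_eq_zero_iff k _).1 fun ξ => ?_
  rw [← evL_tmul]
  exact hf _ ⟨_, rfl⟩

theorem exists_pairL {N : Type u} [AddCommGroup N] [Module k N] {ρ : M →ₗ[k] C ⊗[k] M}
    {ρL : L →ₗ[k] C ⊗[k] L} {ρN : N →ₗ[k] C ⊗[k] N} {i : N →ₗ[k] M} (hi : i ∈ leftHoms ρN ρ)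
    (h : Module.Finite k (leftHoms ρN ρL)) (θ : Dual k (leftHoms ρN ρL)) :
    ∃ x : CoHomL ρ ρL, ∀ f, pairL f x = θ ⟨f.1 ∘ₗ i, leftHoms_comp f.2 hi⟩ := by
  obtain ⟨t, rfl⟩ := evL_surj ρN ρL h θ
  refine ⟨projL ρ ρL (i.rTensor _ t), fun f => ?_⟩
  induction t with
  | zero => simp
  | add x y hx hy => simp only [map_add, hx, hy, LinearMap.add_apply]
  | tmul v ξ => rw [LinearMap.rTensor_tmul, pairL_projR, evL_tmul]; rfl

theorem exists_etaL_of {N : Type u} [AddCommGroup N] [Module k N] {ρ : M →ₗ[k] C ⊗[k] M}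
    {ρL : L →ₗ[k] C ⊗[k] L} {ρN : N →ₗ[k] C ⊗[k] N} {i : N →ₗ[k] M} (hi : i ∈ leftHoms ρN ρ)
    (h : Module.Finite k (leftHoms ρN ρL)) (n : N) :
    ∃ t : L ⊗[k] CoHomL ρ ρL, ∀ ξ, sliceL _ ξ t = projL ρ ρL (i n ⊗ₜ ξ) := by
  choose x hx using exists_pairL (ρL := ρL) hi h
  let b := Module.finBasis k (leftHoms ρN ρL)
  refine ⟨∑ j, (b j).1 n ⊗ₜ[k] x (b.coord j), fun ξ => ?_⟩
  refine pairL_sep fun f => ?_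
  let f' : leftHoms ρN ρL := ⟨f.1 ∘ₗ i, leftHoms_comp f.2 hi⟩
  have h2 : f'.1 = ∑ j, b.repr f' j • (b j).1 := by
    have := congrArg Subtype.val (b.sum_repr f')
    rw [← this]
    simp only [Submodule.coe_sum, Submodule.coe_smul]
  have h3 : f.1 (i n) = ∑ j, b.repr f' j • (b j).1 n := by
    have := LinearMap.congr_fun h2 n
    rw [LinearMap.sum_apply] at this
    exact this
  rw [pairL_projR, h3, map_sum, map_sum, map_sum]
  refine Finset.sum_congr rfl fun j _ => ?_
  rw [sliceL_tmul, map_smul, hx, map_smul, smul_eq_mul, smul_eq_mul, mul_comm]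
  rfl

theorem exists_etaL {ρ : M →ₗ[k] C ⊗[k] M} (hρ : IsLeftCoaction ρ) {ρL : L →ₗ[k] C ⊗[k] L}
    (hq : ∀ V : LeftComod k C, Module.Finite k V → Module.Finite k (leftHoms V.coact ρL))
    (m : M) : ∃ t : L ⊗[k] CoHomL ρ ρL, ∀ ξ, sliceL _ ξ t = projL ρ ρL (m ⊗ₜ ξ) := by
  obtain ⟨S, ρS, hm, hfin, hρS, hS⟩ := exists_finite_left hρ m
  exact exists_etaL_of hS (hq ⟨S, ρS, hρS⟩ hfin) ⟨m, hm⟩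

/-- The unit `M → L ⊗ _Ch(L, M)`, for `L` quasifinite. -/
def etaL {ρ : M →ₗ[k] C ⊗[k] M} (hρ : IsLeftCoaction ρ) {ρL : L →ₗ[k] C ⊗[k] L}
    (hq : ∀ V : LeftComod k C, Module.Finite k V → Module.Finite k (leftHoms V.coact ρL)) :
    M →ₗ[k] L ⊗[k] CoHomL ρ ρL where
  toFun m := (exists_etaL hρ hq m).choose
  map_add' m n := sliceL_ext fun ξ => by
    rw [map_add, (exists_etaL hρ hq m).choose_spec, (exists_etaL hρ hq n).choose_spec,
      (exists_etaL hρ hq (m + n)).choose_spec, TensorProduct.add_tmul, map_add]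
  map_smul' c m := sliceL_ext fun ξ => by
    rw [map_smul, (exists_etaL hρ hq m).choose_spec,
      (exists_etaL hρ hq (c • m)).choose_spec, ← TensorProduct.smul_tmul', map_smul,
      RingHom.id_apply]

variable {ρ : M →ₗ[k] C ⊗[k] M} (hρ : IsLeftCoaction ρ) {ρL : L →ₗ[k] C ⊗[k] L}
  (hq : ∀ V : LeftComod k C, Module.Finite k V → Module.Finite k (leftHoms V.coact ρL))

theorem etaL_slice (m : M) (ξ : Dual k L) :
    sliceL _ ξ (etaL hρ hq m) = projL ρ ρL (m ⊗ₜ ξ) :=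
  (exists_etaL hρ hq m).choose_spec ξ

theorem etaL_pair (f : leftHoms ρ ρL) (m : M) : sliceR L (pairL f) (etaL hρ hq m) = f.1 m := by
  refine sub_eq_zero.1 ((Module.forall_dual_apply_eq_zero_iff k _).1 fun ξ => ?_)
  rw [map_sub, sub_eq_zero, ← pairL_projR, ← etaL_slice hρ hq]
  generalize etaL hρ hq m = t
  induction t with
  | zero => simp
  | add x y hx hy => simp only [map_add, hx, hy]
  | tmul a w => simp [mul_comm]

theorem etaL_colin : etaL hρ hq ∈ leftHoms ρ (leftTensor (CoHomL ρ ρL) ρL) := fun m => by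
  apply (TensorProduct.assoc k C L (CoHomL ρ ρL)).symm.injective
  refine pairL_tensor_sep fun f => ?_
  rw [leftTensor, LinearMap.comp_apply, LinearEquiv.coe_coe, LinearEquiv.symm_apply_apply,
    sliceR_rTensor, etaL_pair, f.2 m]
  have key : ∀ t : C ⊗[k] (L ⊗[k] CoHomL ρ ρL),
      sliceR (C ⊗[k] L) (pairL f) ((TensorProduct.assoc k C L (CoHomL ρ ρL)).symm t) =
        (sliceR L (pairL f)).lTensor C t := fun t => by
    obtain ⟨t, rfl⟩ := (TensorProduct.assoc k C L (CoHomL ρ ρL)).surjective t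
    rw [LinearEquiv.symm_apply_apply]
    exact LinearMap.congr_fun (f := sliceR (C ⊗[k] L) (pairL f))
      (g := (sliceR L (pairL f)).lTensor C ∘ₗ
        (TensorProduct.assoc k C L (CoHomL ρ ρL)).toLinearMap)
      (TensorProduct.ext_threefold fun a b c => by simp) t
  rw [key, ← LinearMap.lTensor_comp_apply,
    show sliceR L (pairL f) ∘ₗ etaL hρ hq = f.1 from LinearMap.ext (etaL_pair hρ hq f)]

theorem etaL_ext {h h' : CoHomL ρ ρL →ₗ[k] W}
    (H : ∀ m, h.lTensor L (etaL hρ hq m) = h'.lTensor L (etaL hρ hq m)) : h = h' := by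
  have : h ∘ₗ projL ρ ρL = h' ∘ₗ projL ρ ρL := TensorProduct.ext' fun m ξ => by
    rw [LinearMap.comp_apply, LinearMap.comp_apply, ← etaL_slice hρ hq, ← sliceL_lTensor, H,
      sliceL_lTensor]
  ext x
  obtain ⟨t, rfl⟩ := projL_surj ρ ρL x
  exact LinearMap.congr_fun this t

theorem exists_descL {g : M →ₗ[k] L ⊗[k] W} (hg : g ∈ leftHoms ρ (leftTensor W ρL)) :
    ∃ h : CoHomL ρ ρL →ₗ[k] W, ∀ m, h.lTensor L (etaL hρ hq m) = g m := by
  let G : M ⊗[k] Dual k L →ₗ[k] W := TensorProduct.lift (LinearMap.mk₂ k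
    (fun m ξ => sliceL W ξ (g m))
    (fun _ _ _ => by simp) (fun _ _ _ => by simp)
    (fun _ _ _ => by simp [sliceL, LinearMap.rTensor_add])
    (fun _ _ _ => by simp [sliceL, LinearMap.rTensor_smul]))
  have hG : ∀ m ξ, G (m ⊗ₜ ξ) = sliceL W ξ (g m) := fun m ξ => rfl
  have hw : ∀ w : Dual k W, sliceR L w ∘ₗ g ∈ leftHoms ρ ρL := by
    intro w
    refine leftHoms_comp (fun t => ?_) hg
    induction t with
    | zero => simp
    | add x y hx hy => simp only [map_add, hx, hy]
    | tmul x a =>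
      simp only [leftTensor, sliceR_tmul, map_smul, LinearMap.comp_apply, LinearMap.rTensor_tmul,
        LinearEquiv.coe_coe]
      induction ρL x with
      | zero => simp
      | add x y hx hy => simp only [map_add, TensorProduct.add_tmul, smul_add, hx, hy]
      | tmul a x => simp
  have hker : LinearMap.ker (evL ρ ρL) ≤ LinearMap.ker G := by
    intro t ht
    refine (Module.forall_dual_apply_eq_zero_iff k _).1 fun w => ?_
    have : ∀ t, w (G t) = evL ρ ρL t ⟨_, hw w⟩ := by
      intro t
      induction t with
      | zero => simp
      | add x y hx hy => simp only [map_add, hx, hy, LinearMap.add_apply]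
      | tmul m ξ =>
        rw [hG, evL_tmul, LinearMap.comp_apply]
        generalize g m = t
        induction t with
        | zero => simp
        | add x y hx hy => simp only [map_add, hx, hy]
        | tmul a x => simp [mul_comm]
    rw [this, LinearMap.mem_ker.1 ht, LinearMap.zero_apply]
  have hproj : LinearMap.ker (projL ρ ρL) ≤ LinearMap.ker G := fun t ht => hker (by
    rw [LinearMap.mem_ker, ← inclL_projR, LinearMap.mem_ker.1 ht, map_zero])
  refine ⟨(LinearMap.ker (projL ρ ρL)).liftQ G hproj ∘ₗ
    ((projL ρ ρL).quotKerEquivOfSurjective (projL_surj ρ ρL)).symm.toLinearMap,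
    fun m => sliceL_ext fun ξ => ?_⟩
  rw [sliceL_lTensor, etaL_slice, ← hG]
  have : ((projL ρ ρL).quotKerEquivOfSurjective (projL_surj ρ ρL)).symm (projL ρ ρL (m ⊗ₜ ξ)) =
      Submodule.Quotient.mk (m ⊗ₜ ξ) := by
    rw [LinearEquiv.symm_apply_eq]
    rfl
  rw [LinearMap.comp_apply, LinearEquiv.coe_coe, this]
  rfl

/-- The linear map `_Ch(L, M) → W` corresponding to a colinear map `M → L ⊗ W`. -/
def descL {g : M →ₗ[k] L ⊗[k] W} (hg : g ∈ leftHoms ρ (leftTensor W ρL)) :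
    CoHomL ρ ρL →ₗ[k] W :=
  (exists_descL hρ hq hg).choose

theorem descL_spec {g : M →ₗ[k] L ⊗[k] W} (hg : g ∈ leftHoms ρ (leftTensor W ρL)) (m : M) :
    (descL hρ hq hg).lTensor L (etaL hρ hq m) = g m :=
  (exists_descL hρ hq hg).choose_spec m

end CoHomSpace

section CoHomLeftCoaction

variable {M X N V W : Type u} [AddCommGroup M] [Module k M] [AddCommGroup X] [Module k X]
  [AddCommGroup N] [Module k N] [AddCommGroup V] [Module k V] [AddCommGroup W] [Module k W]

theorem assoc_mem_leftHoms (l : N →ₗ[k] C ⊗[k] N) :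
    (TensorProduct.assoc k N V W).toLinearMap ∈
      leftHoms (leftTensor W (leftTensor V l)) (leftTensor (V ⊗[k] W) l) := by
  intro t
  simp only [leftTensor, LinearMap.comp_apply, LinearEquiv.coe_coe, LinearMap.rTensor_comp,
    ← assoc_nat1]
  generalize (l.rTensor V).rTensor W t = s
  exact LinearMap.congr_fun (f := (TensorProduct.assoc k C N (V ⊗[k] W)).toLinearMap ∘ₗ
      (TensorProduct.assoc k (C ⊗[k] N) V W).toLinearMap)
    (g := (TensorProduct.assoc k N V W).toLinearMap.lTensor C ∘ₗ
      (TensorProduct.assoc k C (N ⊗[k] V) W).toLinearMap ∘ₗ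
      (TensorProduct.assoc k C N V).toLinearMap.rTensor W)
    (TensorProduct.ext_fourfold fun a b c d => by simp) s

theorem Bicoassoc.mem_leftHoms {l : X →ₗ[k] C ⊗[k] X} {r : X →ₗ[k] X ⊗[k] D}
    (h : Bicoassoc l r) : r ∈ leftHoms l (leftTensor D l) := h

theorem rTensor_mem_leftHoms {l : M →ₗ[k] C ⊗[k] M} {l' : N →ₗ[k] C ⊗[k] N}
    {g : M →ₗ[k] N} (hg : g ∈ leftHoms l l') :
    g.rTensor V ∈ leftHoms (leftTensor V l) (leftTensor V l') :=
  map_mem_leftHoms LinearMap.id hg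

variable {l : M →ₗ[k] C ⊗[k] M} (hl : IsLeftCoaction l) {lX : X →ₗ[k] C ⊗[k] X}
  (hq : ∀ V : LeftComod k C, Module.Finite k V → Module.Finite k (leftHoms V.coact lX))
  {rX : X →ₗ[k] X ⊗[k] D} {rM : M →ₗ[k] M ⊗[k] E}

theorem deltaL_aux (hb : Bicoassoc lX rX) : (TensorProduct.assoc k X D (CoHomL l lX)).toLinearMap ∘ₗ
    rX.rTensor (CoHomL l lX) ∘ₗ etaL hl hq ∈ leftHoms l (leftTensor (D ⊗[k] CoHomL l lX) lX) :=
  leftHoms_comp (assoc_mem_leftHoms lX)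
    (leftHoms_comp (rTensor_mem_leftHoms hb.mem_leftHoms) (etaL_colin hl hq))

/-- The left `D`-coaction of `_Ch(X, M)`, for a `(C, D)`-bicomodule `X`: it is determined by
`(X ⊗ δ) ∘ η = (r ⊗ _Ch(X, M)) ∘ η`, where `r : X → X ⊗ D` is the right coaction. -/
def deltaL (hb : Bicoassoc lX rX) : CoHomL l lX →ₗ[k] D ⊗[k] CoHomL l lX :=
  descL hl hq (deltaL_aux hl hq hb)

theorem deltaL_spec (hb : Bicoassoc lX rX) (m : M) : (deltaL hl hq hb).lTensor X (etaL hl hq m) =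
    TensorProduct.assoc k X D (CoHomL l lX) (rX.rTensor (CoHomL l lX) (etaL hl hq m)) := by
  rw [deltaL, descL_spec]
  rfl

theorem deltaL_spec' (hb : Bicoassoc lX rX) : (deltaL hl hq hb).lTensor X ∘ₗ etaL hl hq =
    (TensorProduct.assoc k X D (CoHomL l lX)).toLinearMap ∘ₗ
      rX.rTensor (CoHomL l lX) ∘ₗ etaL hl hq :=
  LinearMap.ext (deltaL_spec hl hq hb)

theorem deltaL_isCoaction (hb : Bicoassoc lX rX) (hr : IsRightCoaction rX) :
    IsLeftCoaction (deltaL hl hq hb) where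
  coassoc := by
    refine LinearMap.congr_fun (f := (TensorProduct.assoc k D D (CoHomL l lX)).toLinearMap ∘ₗ
      Coalgebra.comul.rTensor (CoHomL l lX) ∘ₗ deltaL hl hq hb)
      (g := (deltaL hl hq hb).lTensor D ∘ₗ deltaL hl hq hb)
      (etaL_ext hl hq fun m => ?_)
    have h1 : Coalgebra.comul.lTensor X ∘ₗ rX =
        (TensorProduct.assoc k X D D).toLinearMap ∘ₗ rX.rTensor D ∘ₗ rX :=
      LinearMap.ext fun x => (hr.coassoc x).symm
    rw [LinearMap.lTensor_comp_apply, LinearMap.lTensor_comp_apply, LinearMap.lTensor_comp_apply,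
      deltaL_spec, ← assoc_nat2, ← assoc_nat3, ← rl_comm, deltaL_spec, ← assoc_nat1,
      ← LinearMap.rTensor_comp_apply, h1, LinearMap.rTensor_comp_apply, assoc_pent,
      LinearMap.rTensor_comp_apply]
  counit := by
    refine LinearMap.congr_fun (f := Coalgebra.counit.rTensor (CoHomL l lX) ∘ₗ deltaL hl hq hb)
      (g := TensorProduct.mk k k (CoHomL l lX) 1) (etaL_ext hl hq fun m => ?_)
    rw [LinearMap.lTensor_comp_apply, deltaL_spec, ← assoc_nat2, ← LinearMap.rTensor_comp_apply,
      show Coalgebra.counit.lTensor X ∘ₗ rX = (TensorProduct.mk k X k).flip 1 from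
        LinearMap.ext hr.counit]
    generalize etaL hl hq m = t
    induction t with
    | zero => simp
    | add x y hx hy => simp only [map_add, hx, hy]
    | tmul a x => simp

theorem etaL_mem_cot (hb : Bicoassoc lX rX) (m : M) : etaL hl hq m ∈ cot rX (deltaL hl hq hb) :=
  mem_cot.2 (deltaL_spec hl hq hb m).symm

theorem descL_colin (hb : Bicoassoc lX rX) {lN : N →ₗ[k] D ⊗[k] N} {g : M →ₗ[k] X ⊗[k] N}
    (hg : g ∈ leftHoms l (leftTensor N lX)) (hg' : ∀ m, g m ∈ cot rX lN) :
    descL hl hq hg ∈ leftHoms (deltaL hl hq hb) lN := by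
  refine LinearMap.congr_fun (f := lN ∘ₗ descL hl hq hg)
    (g := (descL hl hq hg).lTensor D ∘ₗ deltaL hl hq hb) (etaL_ext hl hq fun m => ?_)
  rw [LinearMap.lTensor_comp_apply, LinearMap.lTensor_comp_apply, descL_spec, deltaL_spec,
    ← assoc_nat3, ← rl_comm, descL_spec]
  exact (mem_cot.1 (hg' m)).symm

theorem lambdaL_aux (hM : Bicoassoc l rM) : (TensorProduct.assoc k X (CoHomL l lX) E).toLinearMap ∘ₗ
    (etaL hl hq).rTensor E ∘ₗ rM ∈ leftHoms l (leftTensor (CoHomL l lX ⊗[k] E) lX) :=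
  leftHoms_comp (assoc_mem_leftHoms lX)
    (leftHoms_comp (rTensor_mem_leftHoms (etaL_colin hl hq)) hM.mem_leftHoms)

/-- The right `E`-coaction of `_Ch(X, M)`, for a `(C, E)`-bicomodule `M`: it is determined by
`(X ⊗ λ) ∘ η = (η ⊗ E) ∘ r`, where `r : M → M ⊗ E` is the right coaction. -/
def lambdaL (hM : Bicoassoc l rM) : CoHomL l lX →ₗ[k] CoHomL l lX ⊗[k] E :=
  descL hl hq (lambdaL_aux hl hq hM)

theorem lambdaL_spec (hM : Bicoassoc l rM) (m : M) : (lambdaL hl hq hM).lTensor X (etaL hl hq m) =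
    TensorProduct.assoc k X (CoHomL l lX) E ((etaL hl hq).rTensor E (rM m)) := by
  rw [lambdaL, descL_spec]
  rfl

theorem lambdaL_spec' (hM : Bicoassoc l rM) : (lambdaL hl hq hM).lTensor X ∘ₗ etaL hl hq =
    (TensorProduct.assoc k X (CoHomL l lX) E).toLinearMap ∘ₗ (etaL hl hq).rTensor E ∘ₗ rM :=
  LinearMap.ext (lambdaL_spec hl hq hM)

theorem lambdaL_isCoaction (hM : Bicoassoc l rM) (hr : IsRightCoaction rM) :
    IsRightCoaction (lambdaL hl hq hM) where
  coassoc := by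
    refine LinearMap.congr_fun (f := (TensorProduct.assoc k (CoHomL l lX) E E).toLinearMap ∘ₗ
      (lambdaL hl hq hM).rTensor E ∘ₗ lambdaL hl hq hM)
      (g := Coalgebra.comul.lTensor (CoHomL l lX) ∘ₗ lambdaL hl hq hM)
      (etaL_ext hl hq fun m => ?_)
    rw [LinearMap.lTensor_comp_apply, LinearMap.lTensor_comp_apply, LinearMap.lTensor_comp_apply,
      lambdaL_spec, ← assoc_nat2, ← assoc_nat3, ← rl_comm, ← hr.coassoc,
      ← LinearMap.rTensor_comp_apply, lambdaL_spec', LinearMap.rTensor_comp_apply, assoc_pent,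
      LinearMap.rTensor_comp_apply, assoc_nat1]
  counit := by
    refine LinearMap.congr_fun (f := Coalgebra.counit.lTensor (CoHomL l lX) ∘ₗ lambdaL hl hq hM)
      (g := (TensorProduct.mk k (CoHomL l lX) k).flip 1) (etaL_ext hl hq fun m => ?_)
    rw [LinearMap.lTensor_comp_apply, lambdaL_spec, ← assoc_nat3, ← rl_comm, hr.counit,
      LinearMap.rTensor_tmul]
    generalize etaL hl hq m = t
    induction t with
    | zero => simp
    | add x y hx hy => simp only [map_add, TensorProduct.add_tmul, hx, hy]
    | tmul a x => simp

theorem coHomL_bicoassoc (hb : Bicoassoc lX rX) (hM : Bicoassoc l rM) :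
    Bicoassoc (deltaL hl hq hb) (lambdaL hl hq hM) := by
  refine LinearMap.congr_fun (f := (TensorProduct.assoc k D (CoHomL l lX) E).toLinearMap ∘ₗ
    (deltaL hl hq hb).rTensor E ∘ₗ lambdaL hl hq hM)
    (g := (lambdaL hl hq hM).lTensor D ∘ₗ deltaL hl hq hb) (etaL_ext hl hq fun m => ?_)
  rw [LinearMap.lTensor_comp_apply, LinearMap.lTensor_comp_apply, LinearMap.lTensor_comp_apply,
    lambdaL_spec, deltaL_spec, ← assoc_nat2, ← assoc_nat3, ← rl_comm, lambdaL_spec, ← assoc_nat1,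
    ← LinearMap.rTensor_comp_apply, deltaL_spec', LinearMap.rTensor_comp_apply, assoc_pent,
    LinearMap.rTensor_comp_apply]

end CoHomLeftCoaction

/-! ### The left-handed co-Hom functor -/

/-- The left `D`-comodule `_Ch(X, M)`, for `X` a `(C, D)`-bicomodule that is quasifinite as a
left `C`-comodule. -/
@[reducible] def LeftComod.coHom (X : Bicomod k C D) (hX : X.toLeft.Quasifinite)
    (M : LeftComod k C) : LeftComod k D where
  carrier := CoHomL M.coact X.lcoact
  coact := deltaL M.isCoaction hX X.bicoassoc
  isCoaction := deltaL_isCoaction M.isCoaction hX X.bicoassoc X.isRight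

theorem coHomLeft_aux (X : Bicomod k C D) (hX : X.toLeft.Quasifinite) (M : LeftComod k C)
    (N : LeftComod k D) (h : LeftComod.coHom X hX M ⟶ N) :
    h.lin.lTensor X ∘ₗ etaL M.isCoaction hX ∈ leftHoms M.coact (leftTensor N X.lcoact) :=
  leftHoms_comp (map_mem_leftHoms h.lin (leftHoms_id X.lcoact)) (etaL_colin M.isCoaction hX)

theorem coHomLeft_aux' (X : Bicomod k C D) (M : LeftComod k C) (N : LeftComod k D)
    (f : M ⟶ (cotensorLeft X).obj N) :
    (cot X.rcoact N.coact).subtype ∘ₗ f.lin ∈ leftHoms M.coact (leftTensor N X.lcoact) :=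
  leftHoms_comp (subtype_mem_leftHoms X.bicoassoc N.coact) f.colin

/-- The universal property of `_Ch(X, M)`: colinear maps `_Ch(X, M) → N` correspond to colinear
maps `M → X □_D N`. -/
def coHomLeftEquiv (X : Bicomod k C D) (hX : X.toLeft.Quasifinite) (M : LeftComod k C)
    (N : LeftComod k D) :
    (LeftComod.coHom X hX M ⟶ N) ≃ (M ⟶ (cotensorLeft X).obj N) where
  toFun h := ⟨(h.lin.lTensor X ∘ₗ etaL M.isCoaction hX).codRestrict _ fun m =>
      map_mem_cot (rightHoms_id X.rcoact) h.colin _ (etaL_mem_cot M.isCoaction hX X.bicoassoc m),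
    mem_leftHoms_leftCot X.bicoassoc (coHomLeft_aux X hX M N h)⟩
  invFun f := ⟨descL M.isCoaction hX (coHomLeft_aux' X M N f),
    descL_colin M.isCoaction hX X.bicoassoc _ fun m => (f.lin m).2⟩
  left_inv h := LeftComod.Hom.ext (etaL_ext M.isCoaction hX fun m =>
    descL_spec M.isCoaction hX (coHomLeft_aux X hX M N h) m)
  right_inv f := LeftComod.Hom.ext (LinearMap.ext fun m => Subtype.ext
    (descL_spec M.isCoaction hX (coHomLeft_aux' X M N f) m))

theorem coHomLeftEquiv_naturality (X : Bicomod k C D) (hX : X.toLeft.Quasifinite)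
    (M : LeftComod k C) (N N' : LeftComod k D) (g : N ⟶ N') (h : LeftComod.coHom X hX M ⟶ N) :
    coHomLeftEquiv X hX M N' (h ≫ g) = coHomLeftEquiv X hX M N h ≫ (cotensorLeft X).map g :=
  LeftComod.Hom.ext (LinearMap.ext fun m => Subtype.ext
    (LinearMap.lTensor_comp_apply X g.lin h.lin (etaL M.isCoaction hX m)))

/-- The co-Hom functor `_Ch(X, -) : ᶜM ⥤ ᴰM`, for `X` a `(C, D)`-bicomodule that is quasifinite as
a left `C`-comodule. -/
def coHomLeft (X : Bicomod k C D) (hX : X.toLeft.Quasifinite) :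
    LeftComod k C ⥤ LeftComod k D :=
  Adjunction.leftAdjointOfEquiv (G := cotensorLeft X) (F_obj := LeftComod.coHom X hX)
    (coHomLeftEquiv X hX) fun M N N' g h => coHomLeftEquiv_naturality X hX M N N' g h

/-- The co-Hom functor `_Ch(X, -)` is left adjoint to `X □_D -`. -/
def coHomLeftAdjunction (X : Bicomod k C D) (hX : X.toLeft.Quasifinite) :
    coHomLeft X hX ⊣ cotensorLeft X :=
  Adjunction.adjunctionOfEquivLeft _ _

/-- The `(D, C)`-bicomodule `_Ch(X, C)`, for `X` a `(C, D)`-bicomodule that is quasifinite as a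
left `C`-comodule. -/
@[reducible] def Bicomod.coHomLeft (X : Bicomod k C D) (hX : X.toLeft.Quasifinite) :
    Bicomod k D C where
  carrier := CoHomL (Bicomod.regular k C).lcoact X.lcoact
  lcoact := deltaL (Bicomod.regular k C).isLeft hX X.bicoassoc
  rcoact := lambdaL (Bicomod.regular k C).isLeft hX (Bicomod.regular k C).bicoassoc
  isLeft := deltaL_isCoaction _ _ _ X.isRight
  isRight := lambdaL_isCoaction _ _ _ (Bicomod.regular k C).isRight
  bicoassoc := coHomL_bicoassoc _ _ _ _

theorem Bicomod.coHomLeft_toLeft (X : Bicomod k C D) (hX : X.toLeft.Quasifinite) :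
    (Bicomod.coHomLeft X hX).toLeft =
      (MoritaTakeuchi.coHomLeft X hX).obj (LeftComod.regular k C) := rfl

end

end MoritaTakeuchi

open MoritaTakeuchi

/-! Adjunctions between cotensor functors amount to a duality between Λ and X as bicomodules. The
link is of Eilenberg–Watts type: a natural transformation built from cotensor functors is determined
by its value at the regular comodule. Indeed the coaction maps any comodule M colinearly into the
cofree comodule M ⊗ C, and naturality along the maps c ↦ m ⊗ c computes the value at M ⊗ C from the
value at C.

Every property is compared with one piece of linear algebra, `IsDualPair`: a bicolinear ψ : C → X ⊗
Λ with values in X □_D Λ, and a scalar form e on Λ ⊗ X, subject to two zigzag identities. The form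
replaces ω through e = ε_D ∘ ω, extended from Λ □_C X to all of Λ ⊗ X, which is possible over a
field. The zigzags then live in plain tensor products, where no associativity of □ intervenes.
Conversely ω is recovered by splitting off a D-factor with a coaction and contracting with e. The
coaction of Λ gives a visibly left colinear formula and that of X a visibly right colinear one;
`IsDualPair.balanced` shows that they agree on Λ □_C X.

A dual pair gives units M → M ⊗ X ⊗ Λ from ψ and counits N ⊗ Λ ⊗ X → N from e, on either side, hence
both adjunctions. An adjunction returns a dual pair on evaluating unit and counit at C and D and
applying the counits of these coalgebras (`unitIncl_eq`, `counitLin_eq`). The comparison with co-Hom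
functors is uniqueness of left adjoints. The required quasifiniteness holds because a colinear f : V
→ Λ is determined by e ∘ (f ⊗ X) on a finite dimensional subspace of V ⊗ X.

The first zigzag makes Λ a retract of the cofree comodule Λ ⊗ C, so Λ is injective; moreover ψ has
the universal property of the unit η_C (`contrR_rTensor_eq`), so X ≅ h_C(Λ, C). Conversely, if Λ is
injective, a colinear retraction Λ ⊗ C → Λ assigns to each element of Λ a colinear map C → Λ. Such
maps pair with h_C(Λ, C) ≅ X, which produces e, and η_C produces ψ. The left-handed statements are
mirror images and lead to the same notion of dual pair. -/

namespace MoritaTakeuchi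

noncomputable section

set_option linter.unusedSectionVars false

/-! ### Contractions against a bilinear form -/

section Contractions

open Module (Dual)

variable {k : Type u} [Field k]
variable {C : Type u} [AddCommGroup C] [Module k C] [Coalgebra k C]
variable {D : Type u} [AddCommGroup D] [Module k D] [Coalgebra k D]
variable {L X V W W' : Type u} [AddCommGroup L] [Module k L] [AddCommGroup X] [Module k X]
  [AddCommGroup V] [Module k V] [AddCommGroup W] [Module k W] [AddCommGroup W'] [Module k W']

variable (W) in
/-- The contraction `L ⊗ (X ⊗ W) → W` against a bilinear form on `L × X`. -/
def contrL (e : Dual k (L ⊗[k] X)) : L ⊗[k] (X ⊗[k] W) →ₗ[k] W :=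
  sliceL W e ∘ₗ (TensorProduct.assoc k L X W).symm.toLinearMap

variable (W) in
/-- The contraction `(W ⊗ L) ⊗ X → W` against a bilinear form on `L × X`. -/
def contrR (e : Dual k (L ⊗[k] X)) : (W ⊗[k] L) ⊗[k] X →ₗ[k] W :=
  sliceR W e ∘ₗ (TensorProduct.assoc k W L X).toLinearMap

@[simp] theorem contrL_tmul (e : Dual k (L ⊗[k] X)) (l : L) (x : X) (w : W) :
    contrL W e (l ⊗ₜ (x ⊗ₜ w)) = e (l ⊗ₜ x) • w := by
  simp [contrL]

@[simp] theorem contrR_tmul (e : Dual k (L ⊗[k] X)) (l : L) (x : X) (w : W) :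
    contrR W e ((w ⊗ₜ l) ⊗ₜ x) = e (l ⊗ₜ x) • w := by
  simp [contrR]

theorem contrL_nat (e : Dual k (L ⊗[k] X)) (f : W →ₗ[k] W') (l : L) (t : X ⊗[k] W) :
    f (contrL W e (l ⊗ₜ t)) = contrL W' e (l ⊗ₜ f.lTensor X t) := by
  induction t with
  | zero => simp
  | add x y hx hy => simp only [map_add, TensorProduct.tmul_add, hx, hy]
  | tmul x w => simp

theorem contrR_nat (e : Dual k (L ⊗[k] X)) (f : W →ₗ[k] W') (t : W ⊗[k] L) (x : X) :
    f (contrR W e (t ⊗ₜ x)) = contrR W' e (f.rTensor L t ⊗ₜ x) := by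
  induction t with
  | zero => simp
  | add x y hx hy => simp only [map_add, TensorProduct.add_tmul, hx, hy]
  | tmul x w => simp

/-- The two contractions act on opposite ends of X ⊗ W ⊗ L, so their order is immaterial. With W = D
this is the interchange behind `IsDualPair.balanced`. -/
theorem contrL_contrR (e : Dual k (L ⊗[k] X)) (l : L) (x : X) (u : X ⊗[k] (W ⊗[k] L)) :
    contrL W e (l ⊗ₜ contrR (X ⊗[k] W) e ((TensorProduct.assoc k X W L).symm u ⊗ₜ x)) =
      contrR W e (contrL (W ⊗[k] L) e (l ⊗ₜ u) ⊗ₜ x) := by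
  induction u with
  | zero => simp
  | add x y hx hy => simp only [map_add, TensorProduct.add_tmul, TensorProduct.tmul_add, hx, hy]
  | tmul a u =>
    induction u with
    | zero => simp
    | add x y hx hy => simp only [map_add, TensorProduct.add_tmul, TensorProduct.tmul_add, hx, hy]
    | tmul w b =>
      simp only [TensorProduct.assoc_symm_tmul, contrR_tmul, contrL_tmul, map_smul,
        TensorProduct.tmul_smul, ← TensorProduct.smul_tmul', smul_smul, mul_comm]

/-! ### Slices by functionals and coactions as colinear maps. -/

theorem sliceL_counit_coact {l : W →ₗ[k] C ⊗[k] W} (hl : IsLeftCoaction l) (w : W) :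
    sliceL W Coalgebra.counit (l w) = w := by
  rw [sliceL, LinearMap.comp_apply, hl.counit]
  simp

theorem sliceR_counit_coact {r : W →ₗ[k] W ⊗[k] C} (hr : IsRightCoaction r) (w : W) :
    sliceR W Coalgebra.counit (r w) = w := by
  rw [sliceR, LinearMap.comp_apply, hr.counit]
  simp

theorem sliceL_mem_rightHoms (ξ : Dual k V) (ρ : W →ₗ[k] W ⊗[k] C) :
    sliceL W ξ ∈ rightHoms (rightTensor V ρ) ρ := fun t => by
  induction t with
  | zero => simp
  | add x y hx hy => simp only [map_add, hx, hy]
  | tmul v w =>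
    simp only [rightTensor, sliceL_tmul, map_smul, LinearMap.comp_apply, LinearMap.lTensor_tmul,
      LinearEquiv.coe_coe]
    induction ρ w with
    | zero => simp
    | add x y hx hy => simp only [map_add, TensorProduct.tmul_add, smul_add, hx, hy]
    | tmul a c => simp [TensorProduct.smul_tmul']

theorem sliceR_mem_leftHoms (ξ : Dual k V) (l : W →ₗ[k] C ⊗[k] W) :
    sliceR W ξ ∈ leftHoms (leftTensor V l) l := fun t => by
  induction t with
  | zero => simp
  | add x y hx hy => simp only [map_add, hx, hy]
  | tmul w v =>
    simp only [leftTensor, sliceR_tmul, map_smul, LinearMap.comp_apply, LinearMap.rTensor_tmul,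
      LinearEquiv.coe_coe]
    induction l w with
    | zero => simp
    | add x y hx hy => simp only [map_add, TensorProduct.add_tmul, smul_add, hx, hy]
    | tmul c a => simp

/-- Coassociativity, read as colinearity of the coaction into the cofree comodule on the underlying
space. -/
theorem IsRightCoaction.mem_rightHoms {ρ : W →ₗ[k] W ⊗[k] C}
    (hρ : IsRightCoaction ρ) :
    ρ ∈ rightHoms ρ (rightTensor W Coalgebra.comul) := fun m => by
  rw [rightTensor, LinearMap.comp_apply, ← hρ.coassoc m, LinearEquiv.coe_coe,
    LinearEquiv.symm_apply_apply]

theorem IsLeftCoaction.mem_leftHoms {l : W →ₗ[k] C ⊗[k] W} (hl : IsLeftCoaction l) :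
    l ∈ leftHoms l (leftTensor W Coalgebra.comul) := fun w => hl.coassoc w

end Contractions

/-! ### Dual pairs of bicomodules -/

section DualPair

open Module (Dual)

variable {k : Type u} [Field k]
variable {C : Type u} [AddCommGroup C] [Module k C] [Coalgebra k C]
variable {D : Type u} [AddCommGroup D] [Module k D] [Coalgebra k D]

/-- A coevaluation `ψ : C → X ⊗ Λ` and a bilinear form `e` on `Λ × X` that exhibit `X` and `Λ` as
dual to each other. The form `e` matters only on `Λ □_C X`, where it is `ε ∘ ω`. -/
structure IsDualPair (L : Bicomod k D C) (X : Bicomod k C D) (ψ : C →ₗ[k] X ⊗[k] L)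
    (e : Dual k (L ⊗[k] X)) : Prop where
  left_colin : ψ ∈ leftHoms Coalgebra.comul (leftTensor L X.lcoact)
  right_colin : ψ ∈ rightHoms Coalgebra.comul (rightTensor X L.rcoact)
  mem : ∀ c, ψ c ∈ cot X.rcoact L.lcoact
  zigzagL : ∀ l, contrL L e (ψ.lTensor L (L.rcoact l)) = l
  zigzagR : ∀ x, contrR X e (ψ.rTensor X (X.lcoact x)) = x

variable {L : Bicomod k D C} {X : Bicomod k C D} {ψ : C →ₗ[k] X ⊗[k] L} {e : Dual k (L ⊗[k] X)}

theorem IsDualPair.zigzagL' (h : IsDualPair L X ψ e) :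
    contrL L e ∘ₗ ψ.lTensor L ∘ₗ L.rcoact = LinearMap.id := LinearMap.ext h.zigzagL

theorem IsDualPair.zigzagR' (h : IsDualPair L X ψ e) :
    contrR X e ∘ₗ ψ.rTensor X ∘ₗ X.lcoact = LinearMap.id := LinearMap.ext h.zigzagR

/-- The form of a dual pair is balanced over `D` on the cotensor product over `C`. -/
theorem IsDualPair.balanced (h : IsDualPair L X ψ e) {t : L ⊗[k] X}
    (ht : t ∈ cot L.rcoact X.lcoact) :
    contrL D e (X.rcoact.lTensor L t) = contrR D e (L.lcoact.rTensor X t) := by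
  -- On l ⊗ c ⊗ x both sides contract the outer ends of l ⊗ ψ(c) ⊗ x and split off D in between,
  -- from the X-factor of ψ(c) on the left and from its Λ-factor on the right. These agree because
  -- ψ(c) lies in X □_D Λ.
  have key : contrL D e ∘ₗ X.rcoact.lTensor L ∘ₗ (contrR X e ∘ₗ ψ.rTensor X).lTensor L ∘ₗ
      (TensorProduct.assoc k L C X).toLinearMap =
      contrR D e ∘ₗ L.lcoact.rTensor X ∘ₗ (contrL L e ∘ₗ ψ.lTensor L).rTensor X :=
    TensorProduct.ext_threefold fun l c x => by
      have hw := mem_cot.1 (h.mem c)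
      simp only [LinearMap.comp_apply, LinearEquiv.coe_coe, TensorProduct.assoc_tmul,
        LinearMap.lTensor_tmul, LinearMap.rTensor_tmul]
      rw [contrR_nat, contrL_nat, ← contrL_contrR, ← hw, LinearEquiv.symm_apply_apply]
  -- Inserting C by a coaction and collapsing it by a zigzag returns t, on either side. Since t lies
  -- in Λ □_C X, the two insertions are the same element of Λ ⊗ C ⊗ X, to which `key` applies.
  have h1 : (contrR X e ∘ₗ ψ.rTensor X).lTensor L (X.lcoact.lTensor L t) = t := by
    rw [← LinearMap.lTensor_comp_apply, LinearMap.comp_assoc, h.zigzagR',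
      LinearMap.lTensor_id_apply]
  have h2 : (contrL L e ∘ₗ ψ.lTensor L).rTensor X (L.rcoact.rTensor X t) = t := by
    rw [← LinearMap.rTensor_comp_apply, LinearMap.comp_assoc, h.zigzagL',
      LinearMap.rTensor_id_apply]
  have h3 : contrL D e (X.rcoact.lTensor L ((contrR X e ∘ₗ ψ.rTensor X).lTensor L
      (TensorProduct.assoc k L C X (L.rcoact.rTensor X t)))) =
      contrR D e (L.lcoact.rTensor X ((contrL L e ∘ₗ ψ.lTensor L).rTensor X
        (L.rcoact.rTensor X t))) := LinearMap.congr_fun key _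
  rwa [mem_cot.1 ht, h1, h2] at h3

/-! #### The pairing `ω : Λ □_C X → D` attached to a dual pair -/

/-- The map factors as the coaction into a cofree comodule followed by a slice of the inert factor,
both of them colinear whatever e is. This gives one half of the bicolinearity of ω; the next lemma
gives the other half for the other formula. -/
theorem contrR_mem_leftHoms (e : Dual k (L ⊗[k] X)) :
    contrR D e ∘ₗ L.lcoact.rTensor X ∈ leftHoms (leftTensor X L.lcoact) Coalgebra.comul := by
  have h1 : leftTensor X L.lcoact ∈
      leftHoms (leftTensor X L.lcoact) (leftTensor (L ⊗[k] X) Coalgebra.comul) := by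
    refine leftHoms_comp (assoc_mem_leftHoms Coalgebra.comul) (rTensor_mem_leftHoms ?_)
    exact L.isLeft.mem_leftHoms
  change sliceR D e ∘ₗ leftTensor X L.lcoact ∈ _
  exact leftHoms_comp (sliceR_mem_leftHoms e Coalgebra.comul) h1

theorem contrL_mem_rightHoms (e : Dual k (L ⊗[k] X)) :
    contrL D e ∘ₗ X.rcoact.lTensor L ∈ rightHoms (rightTensor L X.rcoact) Coalgebra.comul := by
  have h1 : rightTensor L X.rcoact ∈
      rightHoms (rightTensor L X.rcoact) (rightTensor (L ⊗[k] X) Coalgebra.comul) := by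
    refine rightHoms_comp (assoc_symm_mem_rightHoms Coalgebra.comul) (lTensor_mem_rightHoms ?_)
    exact X.isRight.mem_rightHoms
  change sliceL D e ∘ₗ rightTensor L X.rcoact ∈ _
  exact rightHoms_comp (sliceL_mem_rightHoms e Coalgebra.comul) h1

/-- The associativity isomorphism matches elements having the same image in M ⊗ (X ⊗ N). Later
arguments use only this property of it, so they can be carried out in the ambient tensor product. -/
theorem inclRight_cotAssoc {M N X : Type u} [AddCommGroup M] [Module k M] [AddCommGroup N]
    [Module k N] [AddCommGroup X] [Module k X] (ρ : M →ₗ[k] M ⊗[k] C) {l : X →ₗ[k] C ⊗[k] X}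
    {r : X →ₗ[k] X ⊗[k] D} (hX : Bicoassoc l r) (lN : N →ₗ[k] D ⊗[k] N)
    (s : cot (rightCot ρ hX) lN) :
    inclRight ρ hX lN (cotAssoc ρ hX lN s) = inclLeft ρ hX lN s := by
  have := LinearEquiv.apply_symm_apply
    (LinearEquiv.ofInjective (inclRight ρ hX lN) (inclRight_inj ρ hX lN))
    (LinearEquiv.ofEq _ _ (range_incl_eq ρ hX lN)
      (LinearEquiv.ofInjective (inclLeft ρ hX lN) (inclLeft_inj ρ hX lN) s))
  exact congrArg Subtype.val this

theorem inclLeft_cotAssoc_symm {M N X : Type u} [AddCommGroup M] [Module k M] [AddCommGroup N]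
    [Module k N] [AddCommGroup X] [Module k X] (ρ : M →ₗ[k] M ⊗[k] C) {l : X →ₗ[k] C ⊗[k] X}
    {r : X →ₗ[k] X ⊗[k] D} (hX : Bicoassoc l r) (lN : N →ₗ[k] D ⊗[k] N)
    (s : cot ρ (leftCot hX lN)) :
    inclLeft ρ hX lN ((cotAssoc ρ hX lN).symm s) = inclRight ρ hX lN s := by
  rw [← inclRight_cotAssoc, LinearEquiv.apply_symm_apply]

end DualPair

/-! #### Dual pairs and the triangle identities -/

section Triangles

open Module (Dual)

variable {k : Type u} [Field k]
variable {C : Type u} [AddCommGroup C] [Module k C] [Coalgebra k C]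
variable {D : Type u} [AddCommGroup D] [Module k D] [Coalgebra k D]
variable {L : Bicomod k D C} {X : Bicomod k C D} {ψ : C →ₗ[k] X ⊗[k] L} {e : Dual k (L ⊗[k] X)}

/-- The inverse associativity isomorphism has no explicit formula. The witness s describes its value
by the image in Λ ⊗ (X ⊗ Λ), which is enough to compute the triangle composite in both directions of
the comparison with zigzags. -/
theorem triangleLeft_apply (ψ : Bicomod.regular k C ⟶ X.cotensor L)
    (ω : L.cotensor X ⟶ Bicomod.regular k D) (a : L) :
    ∃ s : cot L.rcoact X.lcoact ⊗[k] L,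
      TensorProduct.assoc k L X L ((cot L.rcoact X.lcoact).subtype.rTensor L s) =
        ((cot X.rcoact L.lcoact).subtype ∘ₗ ψ.lin).lTensor L (L.rcoact a) ∧
      ((cotMap ω.rcolin (leftHoms_id L.lcoact) ∘ₗ
        (cotAssoc L.rcoact X.bicoassoc L.lcoact).symm.toLinearMap ∘ₗ
        cotMap (rightHoms_id L.rcoact) ψ.lcolin ∘ₗ rightUnit L.toRight) a).1 =
          ω.lin.rTensor L s := by
  refine ⟨((cotAssoc L.rcoact X.bicoassoc L.lcoact).symm
    (cotMap (rightHoms_id L.rcoact) ψ.lcolin (rightUnit L.toRight a))).1, ?_, rfl⟩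
  refine (inclLeft_cotAssoc_symm L.rcoact X.bicoassoc L.lcoact _).trans ?_
  exact (LinearMap.lTensor_comp_apply L _ _ _).symm

theorem triangleRight_apply (ψ : Bicomod.regular k C ⟶ X.cotensor L)
    (ω : L.cotensor X ⟶ Bicomod.regular k D) (a : X) :
    ∃ s : X ⊗[k] cot L.rcoact X.lcoact,
      (cot L.rcoact X.lcoact).subtype.lTensor X s = TensorProduct.assoc k X L X
        (((cot X.rcoact L.lcoact).subtype ∘ₗ ψ.lin).rTensor X (X.lcoact a)) ∧
      ((cotMap (rightHoms_id X.rcoact) ω.lcolin ∘ₗ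
        (cotAssoc X.rcoact L.bicoassoc X.lcoact).toLinearMap ∘ₗ
        cotMap ψ.rcolin (leftHoms_id X.lcoact) ∘ₗ leftUnit X.toLeft) a).1 =
          ω.lin.lTensor X s := by
  refine ⟨(cotAssoc X.rcoact L.bicoassoc X.lcoact
    (cotMap ψ.rcolin (leftHoms_id X.lcoact) (leftUnit X.toLeft a))).1, ?_, rfl⟩
  refine (inclRight_cotAssoc X.rcoact L.bicoassoc X.lcoact _).trans ?_
  exact congrArg _ (LinearMap.rTensor_comp_apply X _ _ _).symm

/-- Applying ε_D to the D-factor of a triangle identity turns the canonical isomorphisms with D □_D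
Λ and X □_D D into identities, and turns ω into e. -/
theorem isDualPair_of_triangles {ψ : Bicomod.regular k C ⟶ X.cotensor L}
    {ω : L.cotensor X ⟶ Bicomod.regular k D} (hl : TriangleLeft L X ψ ω)
    (hr : TriangleRight L X ψ ω)
    (he : e ∘ₗ (cot L.rcoact X.lcoact).subtype = Coalgebra.counit ∘ₗ ω.lin) :
    IsDualPair L X ((cot X.rcoact L.lcoact).subtype ∘ₗ ψ.lin) e where
  left_colin := leftHoms_comp (subtype_mem_leftHoms X.bicoassoc L.lcoact) ψ.lcolin
  right_colin := rightHoms_comp (subtype_mem_rightHoms X.rcoact L.bicoassoc) ψ.rcolin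
  mem c := (ψ.lin c).2
  zigzagL a := by
    obtain ⟨s, h1, h2⟩ := triangleLeft_apply ψ ω a
    -- The ascription unfolds `TriangleLeft` to the equation of linear maps it abbreviates, so that
    -- it can rewrite the composite.
    rw [show _ = _ from hl] at h2
    rw [← h1, contrL, LinearMap.comp_apply, LinearEquiv.coe_coe, LinearEquiv.symm_apply_apply,
      sliceL_rTensor, he, ← sliceL_rTensor, ← h2]
    exact sliceL_counit_coact L.isLeft a
  zigzagR a := by
    obtain ⟨s, h1, h2⟩ := triangleRight_apply ψ ω a
    rw [show _ = _ from hr] at h2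
    rw [contrR, LinearMap.comp_apply, LinearEquiv.coe_coe, ← h1,
      sliceR_lTensor, he, ← sliceR_lTensor, ← h2]
    exact sliceR_counit_coact X.isRight a

/-- The bicolinear coevaluation `C → X □_D Λ` of a dual pair. -/
def IsDualPair.coev (h : IsDualPair L X ψ e) : Bicomod.regular k C ⟶ X.cotensor L :=
  ⟨ψ.codRestrict _ h.mem, mem_leftHoms_leftCot X.bicoassoc h.left_colin,
    mem_rightHoms_rightCot L.bicoassoc h.right_colin⟩

theorem IsDualPair.balanced' (h : IsDualPair L X ψ e) :
    (contrR D e ∘ₗ L.lcoact.rTensor X) ∘ₗ (cot L.rcoact X.lcoact).subtype =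
      (contrL D e ∘ₗ X.rcoact.lTensor L) ∘ₗ (cot L.rcoact X.lcoact).subtype :=
  LinearMap.ext fun t => (h.balanced t.2).symm

/-- The bicolinear evaluation `Λ □_C X → D` of a dual pair. -/
def IsDualPair.ev (h : IsDualPair L X ψ e) : L.cotensor X ⟶ Bicomod.regular k D :=
  ⟨(contrR D e ∘ₗ L.lcoact.rTensor X) ∘ₗ (cot L.rcoact X.lcoact).subtype,
    leftHoms_comp (contrR_mem_leftHoms e) (subtype_mem_leftHoms L.bicoassoc X.lcoact), by
    -- Right colinearity is visible only for the formula that uses the coaction of X, so the balance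
    -- identity is used to switch to it.
    rw [h.balanced']
    exact rightHoms_comp (contrL_mem_rightHoms e) (subtype_mem_rightHoms L.rcoact X.bicoassoc)⟩

/-- The coaction acts on the first Λ and the contraction on the inner Λ ⊗ X, so the D-factor can be
pulled to the far left. What remains behind it is exactly the map occurring in the first zigzag. -/
theorem contrR_rTensor_assoc (l : L →ₗ[k] D ⊗[k] L) (ψ : C →ₗ[k] X ⊗[k] L) (t : L ⊗[k] C) :
    (contrR D e ∘ₗ l.rTensor X).rTensor L
        ((TensorProduct.assoc k L X L).symm (ψ.lTensor L t)) =
      (contrL L e ∘ₗ ψ.lTensor L).lTensor D (TensorProduct.assoc k D L C (l.rTensor C t)) := by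
  induction t with
  | zero => simp
  | add x y hx hy => simp only [map_add, hx, hy]
  | tmul a c =>
    have key : ∀ (z : D ⊗[k] L) (w : X ⊗[k] L),
        (contrR D e).rTensor L ((TensorProduct.assoc k (D ⊗[k] L) X L).symm (z ⊗ₜ w)) =
        (contrL L e).lTensor D (TensorProduct.assoc k D L (X ⊗[k] L) (z ⊗ₜ w)) := by
      intro z w
      induction z with
      | zero => simp
      | add x y hx hy => simp only [map_add, TensorProduct.add_tmul, hx, hy]
      | tmul d b =>
        induction w with
        | zero => simp
        | add x y hx hy => simp only [map_add, TensorProduct.tmul_add, hx, hy]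
        | tmul x b' => simp [TensorProduct.smul_tmul]
    rw [LinearMap.rTensor_comp_apply, LinearMap.lTensor_comp_apply, ← assoc_nat3,
      LinearMap.rTensor_tmul, LinearMap.lTensor_tmul, LinearMap.lTensor_tmul, ← key]
    congr 1
    generalize ψ c = w
    induction w with
    | zero => simp
    | add x y hx hy => simp only [map_add, TensorProduct.tmul_add, hx, hy]
    | tmul x b' => simp

/-- Mirror image: the D-factor comes from the last X and moves to the far right, leaving the map of
the second zigzag. -/
theorem contrL_lTensor_assoc (r : X →ₗ[k] X ⊗[k] D) (ψ : C →ₗ[k] X ⊗[k] L) (t : C ⊗[k] X) :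
    (contrL D e ∘ₗ r.lTensor L).lTensor X
        (TensorProduct.assoc k X L X (ψ.rTensor X t)) =
      (contrR X e ∘ₗ ψ.rTensor X).rTensor D
        ((TensorProduct.assoc k C X D).symm (r.lTensor C t)) := by
  induction t with
  | zero => simp
  | add x y hx hy => simp only [map_add, hx, hy]
  | tmul c a =>
    have key : ∀ (w : X ⊗[k] L) (z : X ⊗[k] D),
        (contrL D e).lTensor X (TensorProduct.assoc k X L (X ⊗[k] D) (w ⊗ₜ z)) =
        (contrR X e).rTensor D ((TensorProduct.assoc k (X ⊗[k] L) X D).symm (w ⊗ₜ z)) := by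
      intro w z
      induction z with
      | zero => simp
      | add x y hx hy => simp only [map_add, TensorProduct.tmul_add, hx, hy]
      | tmul d b =>
        induction w with
        | zero => simp
        | add x y hx hy => simp only [map_add, TensorProduct.add_tmul, hx, hy]
        | tmul x b' => simp [TensorProduct.smul_tmul]
    have h2 : (ψ.rTensor X).rTensor D ((TensorProduct.assoc k C X D).symm (c ⊗ₜ r a)) =
        (TensorProduct.assoc k (X ⊗[k] L) X D).symm (ψ c ⊗ₜ r a) := by
      generalize r a = w
      induction w with
      | zero => simp
      | add x y hx hy => simp only [map_add, TensorProduct.tmul_add, hx, hy]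
      | tmul x b' => simp
    rw [LinearMap.rTensor_comp_apply, LinearMap.lTensor_comp_apply, ← assoc_nat3,
      LinearMap.rTensor_tmul, LinearMap.lTensor_tmul, LinearMap.lTensor_tmul, key, h2]

/-- Once D has been pulled out of ω, commutation of the two coactions of Λ brings its C-coaction
next to ψ. The zigzag then acts as the identity on the Λ-factor of the left coaction. -/
theorem IsDualPair.triangleLeft (h : IsDualPair L X ψ e) : TriangleLeft L X h.coev h.ev := by
  refine LinearMap.ext fun a => Subtype.ext ?_
  obtain ⟨s, h1, h2⟩ := triangleLeft_apply h.coev h.ev a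
  have h3 : (TensorProduct.assoc k L X L).symm (ψ.lTensor L (L.rcoact a)) =
      (cot L.rcoact X.lcoact).subtype.rTensor L s := (LinearEquiv.symm_apply_eq _).2 h1.symm
  rw [h2, show h.ev.lin = (contrR D e ∘ₗ L.lcoact.rTensor X) ∘ₗ (cot L.rcoact X.lcoact).subtype
    from rfl, LinearMap.rTensor_comp_apply, ← h3, contrR_rTensor_assoc, L.bicoassoc a,
    ← LinearMap.lTensor_comp_apply, LinearMap.comp_assoc, h.zigzagL', LinearMap.lTensor_id_apply]
  rfl

theorem IsDualPair.triangleRight (h : IsDualPair L X ψ e) : TriangleRight L X h.coev h.ev := by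
  refine LinearMap.ext fun a => Subtype.ext ?_
  obtain ⟨s, h1, h2⟩ := triangleRight_apply h.coev h.ev a
  have h3 : TensorProduct.assoc k X L X (ψ.rTensor X (X.lcoact a)) =
      (cot L.rcoact X.lcoact).subtype.lTensor X s := h1.symm
  -- The evaluation is defined with the coaction of Λ; here the D-factor has to come from X, hence
  -- the balanced form.
  rw [h2, show h.ev.lin = (contrL D e ∘ₗ X.rcoact.lTensor L) ∘ₗ (cot L.rcoact X.lcoact).subtype
    from h.balanced', LinearMap.lTensor_comp_apply, ← h3, contrL_lTensor_assoc, ← X.bicoassoc a,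
    LinearEquiv.symm_apply_apply, ← LinearMap.rTensor_comp_apply, LinearMap.comp_assoc,
    h.zigzagR', LinearMap.rTensor_id_apply]
  rfl

variable (L X) in
/-- Dual pairs are the same as solutions of the triangle identities. -/
theorem exists_triangles_iff :
    (∃ (ψ : Bicomod.regular k C ⟶ X.cotensor L) (ω : L.cotensor X ⟶ Bicomod.regular k D),
      TriangleLeft L X ψ ω ∧ TriangleRight L X ψ ω) ↔
    ∃ (ψ : C →ₗ[k] X ⊗[k] L) (e : Dual k (L ⊗[k] X)), IsDualPair L X ψ e := by
  constructor
  · rintro ⟨ψ, ω, hl, hr⟩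
    -- Any linear extension of ε_D ∘ ω from Λ □_C X to Λ ⊗ X will do: only the restriction enters
    -- the verification of the zigzags.
    obtain ⟨e, he⟩ := LinearMap.exists_extend
      ((Coalgebra.counit (R := k) (A := D)) ∘ₗ ω.lin : cot L.rcoact X.lcoact →ₗ[k] k)
    exact ⟨_, e, isDualPair_of_triangles hl hr he⟩
  · rintro ⟨ψ, e, h⟩
    exact ⟨h.coev, h.ev, h.triangleLeft, h.triangleRight⟩

end Triangles

/-! ### Dual pairs and adjunctions between right cotensor functors -/

section RightAdjunction

open Module (Dual)

variable {k : Type u} [Field k]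
variable {C : Type u} [AddCommGroup C] [Module k C] [Coalgebra k C]
variable {D : Type u} [AddCommGroup D] [Module k D] [Coalgebra k D]
variable {E : Type u} [AddCommGroup E] [Module k E] [Coalgebra k E]

/-- Over a field i ⊗ C is still injective, so colinearity can be checked after a colinear embedding.
This reduces questions about iterated cotensor products to their ambient tensor products. -/
theorem rightHoms_of_comp {M N P : Type u} [AddCommGroup M] [Module k M] [AddCommGroup N]
    [Module k N] [AddCommGroup P] [Module k P] {ρM : M →ₗ[k] M ⊗[k] C} {ρN : N →ₗ[k] N ⊗[k] C}
    {ρP : P →ₗ[k] P ⊗[k] C} {i : N →ₗ[k] P} (hi : Function.Injective i) (h : i ∈ rightHoms ρN ρP)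
    {f : M →ₗ[k] N} (hf : i ∘ₗ f ∈ rightHoms ρM ρP) : f ∈ rightHoms ρM ρN := fun m => by
  apply rTensor_inj (N := C) hi
  rw [← h, ← LinearMap.rTensor_comp_apply, ← hf m]
  rfl

theorem leftHoms_of_comp {M N P : Type u} [AddCommGroup M] [Module k M] [AddCommGroup N]
    [Module k N] [AddCommGroup P] [Module k P] {ρM : M →ₗ[k] C ⊗[k] M} {ρN : N →ₗ[k] C ⊗[k] N}
    {ρP : P →ₗ[k] C ⊗[k] P} {i : N →ₗ[k] P} (hi : Function.Injective i) (h : i ∈ leftHoms ρN ρP)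
    {f : M →ₗ[k] N} (hf : i ∘ₗ f ∈ leftHoms ρM ρP) : f ∈ leftHoms ρM ρN := fun m => by
  apply lTensor_inj (N := C) hi
  rw [← h, ← LinearMap.lTensor_comp_apply, ← hf m]
  rfl

theorem assoc_mem_rightHoms {V W N : Type u} [AddCommGroup V] [Module k V] [AddCommGroup W]
    [Module k W] [AddCommGroup N] [Module k N] (ρ : N →ₗ[k] N ⊗[k] C) :
    (TensorProduct.assoc k V W N).toLinearMap ∈
      rightHoms (rightTensor (V ⊗[k] W) ρ) (rightTensor V (rightTensor W ρ)) := by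
  refine rightHoms_of_comp (TensorProduct.assoc k V W N).symm.injective
    (assoc_symm_mem_rightHoms ρ) ?_
  rw [LinearEquiv.symm_comp]
  exact rightHoms_id _

theorem inclLeft_mem_rightHoms (M : RightComod k C) (X : Bicomod k C D) (Y : Bicomod k D E) :
    inclLeft M.coact X.bicoassoc Y.lcoact ∈ rightHoms ((M.cotensor X).cotensor Y).coact
      (rightTensor M (rightTensor X Y.rcoact)) :=
  rightHoms_comp (assoc_mem_rightHoms Y.rcoact) (rightHoms_comp
    (map_mem_rightHoms (cot M.coact X.lcoact).subtype (rightHoms_id Y.rcoact))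
    (subtype_mem_rightHoms (M.cotensor X).coact Y.bicoassoc))

/-- The defining condition of the first cotensor product in `(M □_C X) □_D N ⊆ M ⊗ (X ⊗ N)`. -/
theorem rTensor_inclLeft {M X N : Type u} [AddCommGroup M] [Module k M] [AddCommGroup X]
    [Module k X] [AddCommGroup N] [Module k N] (ρ : M →ₗ[k] M ⊗[k] C) {l : X →ₗ[k] C ⊗[k] X}
    {r : X →ₗ[k] X ⊗[k] D} (hX : Bicoassoc l r) (lN : N →ₗ[k] D ⊗[k] N)
    (s : cot (rightCot ρ hX) lN) :
    TensorProduct.assoc k M C (X ⊗[k] N) (ρ.rTensor (X ⊗[k] N) (inclLeft ρ hX lN s)) =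
      (leftTensor N l).lTensor M (inclLeft ρ hX lN s) := by
  -- The condition concerns only the first cotensor product. It is therefore proved on all of (M □_C
  -- X) ⊗ N, where it follows from simple tensors.
  have hz : ∀ z : cot ρ l ⊗[k] N,
      TensorProduct.assoc k M C (X ⊗[k] N) (ρ.rTensor (X ⊗[k] N)
        (TensorProduct.assoc k M X N ((cot ρ l).subtype.rTensor N z))) =
      (leftTensor N l).lTensor M (TensorProduct.assoc k M X N ((cot ρ l).subtype.rTensor N z)) := by
    intro z
    induction z with
    | zero => simp
    | add x y hx hy => simp only [map_add, hx, hy]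
    | tmul t n =>
      have ht := mem_cot.1 t.2
      rw [LinearMap.rTensor_tmul, ← assoc_nat1, ← assoc_pent, leftTensor,
        LinearMap.lTensor_comp_apply, ← assoc_nat2]
      simp only [LinearMap.rTensor_tmul, Submodule.subtype_apply, LinearEquiv.coe_coe]
      rw [ht]
  exact hz s.1

variable {L : Bicomod k D C} {X : Bicomod k C D} {ψ : C →ₗ[k] X ⊗[k] L} {e : Dual k (L ⊗[k] X)}

/-! #### The adjunction attached to a dual pair -/

/-- The unit `M → (M □_C X) □_D Λ` attached to a dual pair. -/
def IsDualPair.unitR (h : IsDualPair L X ψ e) (M : RightComod k C) :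
    M →ₗ[k] cot (M.cotensor X).coact L.lcoact :=
  (cotAssoc M.coact X.bicoassoc L.lcoact).symm.toLinearMap ∘ₗ
    cotMap (rightHoms_id M.coact) h.coev.lcolin ∘ₗ rightUnit M

/-- Inside M ⊗ (X ⊗ Λ) associativity becomes invisible. Colinearity, naturality and the triangle
identities of the unit are all derived from this formula. -/
theorem IsDualPair.inclLeft_unitR (h : IsDualPair L X ψ e) (M : RightComod k C) (m : M) :
    inclLeft M.coact X.bicoassoc L.lcoact (h.unitR M m) = ψ.lTensor M (M.coact m) := by
  refine (inclLeft_cotAssoc_symm M.coact X.bicoassoc L.lcoact _).trans ?_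
  exact (LinearMap.lTensor_comp_apply M (cot X.rcoact L.lcoact).subtype h.coev.lin _).symm

theorem IsDualPair.unitR_colin (h : IsDualPair L X ψ e) (M : RightComod k C) :
    h.unitR M ∈ rightHoms M.coact ((M.cotensor X).cotensor L).coact := by
  refine rightHoms_of_comp (inclLeft_inj M.coact X.bicoassoc L.lcoact)
    (inclLeft_mem_rightHoms M X L) ?_
  rw [show inclLeft M.coact X.bicoassoc L.lcoact ∘ₗ h.unitR M = ψ.lTensor M ∘ₗ M.coact from
    LinearMap.ext (h.inclLeft_unitR M)]
  exact rightHoms_comp (lTensor_mem_rightHoms h.right_colin) M.isCoaction.mem_rightHoms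

variable (e) in
/-- The map `(N □_D Λ) □_C X → N` given by a bilinear form on `Λ × X`. -/
def counitR (N : RightComod k D) : cot (N.cotensor L).coact X.lcoact →ₗ[k] N :=
  sliceR N e ∘ₗ inclLeft N.coact L.bicoassoc X.lcoact

/-- The coaction on the source comes from X. Balance moves the D-factor from X to Λ, and membership
in N □_D Λ moves it on from Λ to N, where it is the coaction of the target. -/
theorem IsDualPair.counitR_colin (h : IsDualPair L X ψ e) (N : RightComod k D) :
    counitR e N ∈ rightHoms ((N.cotensor L).cotensor X).coact N.coact := by
  intro s
  have h1 := inclLeft_mem_rightHoms N L X s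
  -- Associativity places the element in N ⊗ (Λ □_C X), the domain on which the balance identity is
  -- available.
  obtain ⟨t, ht⟩ : ∃ t : N ⊗[k] cot L.rcoact X.lcoact,
      inclLeft N.coact L.bicoassoc X.lcoact s = (cot L.rcoact X.lcoact).subtype.lTensor N t :=
    ⟨_, (inclRight_cotAssoc N.coact L.bicoassoc X.lcoact s).symm⟩
  have h2 := rTensor_inclLeft N.coact L.bicoassoc X.lcoact s
  rw [counitR, LinearMap.rTensor_comp_apply, ← h1, LinearMap.comp_apply, ← sliceR_rTensor]
  have h3 : ∀ w : N ⊗[k] (L ⊗[k] X), (sliceR N e).rTensor D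
      (rightTensor N (rightTensor L X.rcoact) w) =
      (contrL D e ∘ₗ X.rcoact.lTensor L).lTensor N w := by
    intro w
    rw [LinearMap.lTensor_comp_apply, rightTensor, rightTensor, LinearMap.comp_apply,
      LinearMap.lTensor_comp_apply]
    generalize (X.rcoact.lTensor L).lTensor N w = y
    refine LinearMap.congr_fun (f := (sliceR N e).rTensor D ∘ₗ
      (TensorProduct.assoc k N (L ⊗[k] X) D).symm.toLinearMap ∘ₗ
      (TensorProduct.assoc k L X D).symm.toLinearMap.lTensor N) (g := (contrL D e).lTensor N)
      (TensorProduct.ext' fun n z => ?_) y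
    obtain ⟨z, rfl⟩ := (TensorProduct.assoc k L X D).surjective z
    induction z with
    | zero => simp
    | add x y hx hy => simp only [map_add, TensorProduct.tmul_add, hx, hy]
    | tmul z d =>
      induction z with
      | zero => simp
      | add x y hx hy => simp only [map_add, TensorProduct.add_tmul, TensorProduct.tmul_add, hx, hy]
      | tmul a b => simp [TensorProduct.smul_tmul]
  have h4 : ∀ w : N ⊗[k] (D ⊗[k] (L ⊗[k] X)),
      sliceR (N ⊗[k] D) e ((TensorProduct.assoc k N D (L ⊗[k] X)).symm w) =
      (sliceR D e).lTensor N w := by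
    intro w
    obtain ⟨w, rfl⟩ := (TensorProduct.assoc k N D (L ⊗[k] X)).surjective w
    rw [LinearEquiv.symm_apply_apply]
    exact LinearMap.congr_fun (f := sliceR (N ⊗[k] D) e)
      (g := (sliceR D e).lTensor N ∘ₗ (TensorProduct.assoc k N D (L ⊗[k] X)).toLinearMap)
      (TensorProduct.ext_threefold fun a b c => by simp) w
  -- Both sides are now N ⊗ (a formula for ω) applied to t, with D taken from Λ on one side and from
  -- X on the other.
  rw [h3, ← (LinearEquiv.symm_apply_eq _).2 h2.symm, h4, ht, ← LinearMap.lTensor_comp_apply,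
    ← LinearMap.lTensor_comp_apply, ← LinearMap.lTensor_comp_apply, ← h.balanced']
  rfl

/-- The counit on `M □_C X`, composed with a unit on `M`. -/
theorem counitR_cot {M : RightComod k C}
    {f : M →ₗ[k] cot (M.cotensor X).coact L.lcoact}
    (hf : ∀ m, inclLeft M.coact X.bicoassoc L.lcoact (f m) = ψ.lTensor M (M.coact m))
    (z : cot M.coact X.lcoact)
    (v : cot ((M.cotensor X).cotensor L).coact X.lcoact)
    (hv : v.1 = f.rTensor X z.1) :
    (counitR e (M.cotensor X) v).1 =
      (contrR X e ∘ₗ ψ.rTensor X ∘ₗ X.lcoact).lTensor M z.1 := by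
  have h1 : (counitR e (M.cotensor X) v).1 = sliceR (M ⊗[k] X) e
      ((cot M.coact X.lcoact).subtype.rTensor (L ⊗[k] X)
        (inclLeft (M.cotensor X).coact L.bicoassoc X.lcoact v)) :=
    (sliceR_rTensor e (cot M.coact X.lcoact).subtype _).symm
  -- Only the formula `hf` is known about f, so the lemma applies both to the unit of a dual pair
  -- and to the unit of an arbitrary adjunction.
  have h2 : (cot M.coact X.lcoact).subtype.rTensor L ∘ₗ
      (cot (M.cotensor X).coact L.lcoact).subtype ∘ₗ f =
      (TensorProduct.assoc k M X L).symm.toLinearMap ∘ₗ ψ.lTensor M ∘ₗ M.coact :=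
    LinearMap.ext fun m => (LinearEquiv.symm_apply_eq _).2 (hf m).symm |>.symm
  -- Membership of z in M □_C X trades the coaction of M, which the unit brings in, for the coaction
  -- of X, which the zigzag needs.
  have h3 : (TensorProduct.assoc k M C X) (M.coact.rTensor X z.1) = X.lcoact.lTensor M z.1 :=
    mem_cot.1 z.2
  rw [h1, inclLeft, LinearMap.comp_apply, LinearMap.comp_apply, LinearEquiv.coe_coe, ← assoc_nat1,
    Submodule.subtype_apply, hv, ← LinearMap.rTensor_comp_apply, ← LinearMap.rTensor_comp_apply,
    LinearMap.comp_assoc, h2, LinearMap.rTensor_comp_apply, LinearMap.rTensor_comp_apply,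
    ← LinearMap.comp_assoc, LinearMap.lTensor_comp_apply, ← h3]
  generalize M.coact.rTensor X z.1 = y
  refine LinearMap.congr_fun (f := sliceR (M ⊗[k] X) e ∘ₗ
    (TensorProduct.assoc k (M ⊗[k] X) L X).toLinearMap ∘ₗ
    (TensorProduct.assoc k M X L).symm.toLinearMap.rTensor X ∘ₗ (ψ.lTensor M).rTensor X)
    (g := (contrR X e ∘ₗ ψ.rTensor X).lTensor M ∘ₗ (TensorProduct.assoc k M C X).toLinearMap)
    (TensorProduct.ext_threefold fun m c x => ?_) y
  simp only [LinearMap.comp_apply, LinearMap.rTensor_tmul, LinearMap.lTensor_tmul,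
    LinearEquiv.coe_coe, TensorProduct.assoc_tmul]
  generalize ψ c = w
  induction w with
  | zero => simp
  | add x y hx hy => simp only [map_add, TensorProduct.tmul_add, TensorProduct.add_tmul, hx, hy]
  | tmul a b => simp

/-- The unit on `N □_D Λ`, composed with the counit on `N`. -/
theorem counitR_rTensor {N : RightComod k D} (y : cot N.coact L.lcoact)
    (w : cot ((N.cotensor L).cotensor X).coact L.lcoact)
    (hw : inclLeft (N.cotensor L).coact X.bicoassoc L.lcoact w =
      ψ.lTensor (cot N.coact L.lcoact) ((N.cotensor L).coact y)) :
    (counitR e N).rTensor L w.1 =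
      (contrL L e ∘ₗ ψ.lTensor L ∘ₗ L.rcoact).lTensor N y.1 := by
  -- Embedding N □_D Λ in N ⊗ Λ replaces its coaction by N ⊗ ρ_Λ, so ψ ends up next to the
  -- C-coaction of Λ.
  have h1 := congrArg ((cot N.coact L.lcoact).subtype.rTensor (X ⊗[k] L)) hw
  rw [rl_comm, ← subtype_mem_rightHoms, inclLeft, LinearMap.comp_apply, LinearMap.comp_apply,
    LinearEquiv.coe_coe, ← assoc_nat1, ← LinearEquiv.eq_symm_apply] at h1
  rw [counitR, inclLeft, LinearMap.rTensor_comp_apply, LinearMap.rTensor_comp_apply,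
    LinearMap.rTensor_comp_apply]
  have h2 : ((cot N.coact L.lcoact).subtype.rTensor X).rTensor L
      ((cot (N.cotensor L).coact X.lcoact).subtype.rTensor L w.1) =
      (TensorProduct.assoc k (N ⊗[k] L) X L).symm (ψ.lTensor (N ⊗[k] L)
        (rightTensor N L.rcoact y.1)) := h1
  rw [h2, rightTensor, LinearMap.comp_apply, LinearMap.lTensor_comp_apply N (contrL L e),
    LinearMap.lTensor_comp_apply N (ψ.lTensor L)]
  generalize L.rcoact.lTensor N y.1 = y
  obtain ⟨y, rfl⟩ := (TensorProduct.assoc k N L C).surjective y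
  rw [LinearEquiv.coe_coe, LinearEquiv.symm_apply_apply]
  refine LinearMap.congr_fun (f := (sliceR N e).rTensor L ∘ₗ
    (TensorProduct.assoc k N L X).toLinearMap.rTensor L ∘ₗ
    (TensorProduct.assoc k (N ⊗[k] L) X L).symm.toLinearMap ∘ₗ ψ.lTensor (N ⊗[k] L))
    (g := (contrL L e).lTensor N ∘ₗ (ψ.lTensor L).lTensor N ∘ₗ
      (TensorProduct.assoc k N L C).toLinearMap)
    (TensorProduct.ext_threefold fun m c x => ?_) y
  simp only [LinearMap.comp_apply, LinearMap.lTensor_tmul,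
    LinearEquiv.coe_coe, TensorProduct.assoc_tmul]
  generalize ψ x = w
  induction w with
  | zero => simp
  | add x y hx hy => simp only [map_add, TensorProduct.tmul_add, hx, hy]
  | tmul a b => simp [TensorProduct.smul_tmul]

end RightAdjunction

/-! ### The right-hand adjunction of a dual pair, and dual pairs recovered from right-hand
adjunctions. -/

section RightAdjunction

open Module (Dual)

variable {k : Type u} [Field k]
variable {C : Type u} [AddCommGroup C] [Module k C] [Coalgebra k C]
variable {D : Type u} [AddCommGroup D] [Module k D] [Coalgebra k D]
variable {E : Type u} [AddCommGroup E] [Module k E] [Coalgebra k E]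

theorem inclLeft_map (X : Bicomod k C D) (Y : Bicomod k D E) {M N : RightComod k C} (f : M ⟶ N)
    (s : (M.cotensor X).cotensor Y) :
    inclLeft N.coact X.bicoassoc Y.lcoact
        (((cotensorRight Y).map ((cotensorRight X).map f)).lin s) =
      f.lin.rTensor (X ⊗[k] Y) (inclLeft M.coact X.bicoassoc Y.lcoact s) := by
  refine Eq.trans ?_ (assoc_nat1 f.lin ((cot M.coact X.lcoact).subtype.rTensor Y s.1))
  rw [← LinearMap.rTensor_comp_apply]
  exact congrArg _ (LinearMap.rTensor_comp_apply Y _ _ _).symm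

variable {L : Bicomod k D C} {X : Bicomod k C D} {ψ : C →ₗ[k] X ⊗[k] L} {e : Dual k (L ⊗[k] X)}

/-- The adjunction between right cotensor functors attached to a dual pair. -/
def IsDualPair.adjunctionRight (h : IsDualPair L X ψ e) : cotensorRight X ⊣ cotensorRight L where
  unit :=
    { app := fun M => ⟨h.unitR M, h.unitR_colin M⟩
      naturality := fun M N f => RightComod.Hom.ext (LinearMap.ext fun m => by
        refine inclLeft_inj N.coact X.bicoassoc L.lcoact ?_
        refine (h.inclLeft_unitR N (f.lin m)).trans ?_
        refine Eq.trans ?_ (inclLeft_map X L f (h.unitR M m)).symm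
        rw [h.inclLeft_unitR, f.colin m, rl_comm]) }
  counit :=
    { app := fun N => ⟨counitR e N, h.counitR_colin N⟩
      naturality := fun M N f => RightComod.Hom.ext (LinearMap.ext fun s =>
        (congrArg (sliceR N e) (inclLeft_map L X f s)).trans (sliceR_rTensor e f.lin _)) }
  left_triangle_components := fun M => RightComod.Hom.ext (LinearMap.ext fun z => Subtype.ext (by
    -- On M □_C X ⊆ M ⊗ X the composite is M ⊗ (second zigzag); the other triangle is N ⊗ (first
    -- zigzag) in the same way.
    refine (counitR_cot (h.inclLeft_unitR M) z _ rfl).trans ?_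
    rw [h.zigzagR', LinearMap.lTensor_id_apply]
    rfl))
  right_triangle_components := fun N => RightComod.Hom.ext (LinearMap.ext fun y => Subtype.ext (by
    refine (counitR_rTensor y (h.unitR (N.cotensor L) y) (h.inclLeft_unitR _ y)).trans ?_
    rw [h.zigzagL', LinearMap.lTensor_id_apply]
    rfl))

/-! #### The dual pair attached to an adjunction -/

/-- The comodule `V ⊗ M`, for a vector space `V`. -/
@[reducible] def RightComod.tensor (V : Type u) [AddCommGroup V] [Module k V]
    (M : RightComod k C) : RightComod k C where
  carrier := V ⊗[k] M
  coact := rightTensor V M.coact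
  isCoaction := M.isCoaction.tensor

/-- The colinear map `m ↦ v ⊗ m`. -/
def RightComod.tensorMk {V : Type u} [AddCommGroup V] [Module k V] (M : RightComod k C) (v : V) :
    M ⟶ M.tensor V :=
  ⟨TensorProduct.mk k V M v, mk_mem_rightHoms M.coact v⟩

/-- The coaction, as a colinear map to a cofree comodule. -/
def RightComod.coactHom (M : RightComod k C) : M ⟶ (RightComod.regular k C).tensor M :=
  ⟨M.coact, M.isCoaction.mem_rightHoms⟩

/-! ### The coevaluation extracted from the unit at C. -/

section Unit

variable (adj : cotensorRight X ⊣ cotensorRight L)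

/-- The unit of an adjunction, as a map `M → M ⊗ (X ⊗ Λ)`. -/
def unitIncl (M : RightComod k C) : M →ₗ[k] M ⊗[k] (X ⊗[k] L) :=
  inclLeft M.coact X.bicoassoc L.lcoact ∘ₗ (adj.unit.app M).lin

theorem unitIncl_nat {M N : RightComod k C} (f : M ⟶ N) (m : M) :
    unitIncl adj N (f.lin m) = f.lin.rTensor (X ⊗[k] L) (unitIncl adj M m) := by
  have h := congrArg (fun g => inclLeft N.coact X.bicoassoc L.lcoact (RightComod.Hom.lin g m))
    (adj.unit.naturality f)
  exact h.trans (inclLeft_map X L f ((adj.unit.app M).lin m))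

/-- The images of the colinear maps m ↦ v ⊗ m span V ⊗ M, so naturality along them fixes the unit
there. No compatibility of the functors with tensoring by V has to be established. -/
theorem unitIncl_tensor (M : RightComod k C) {V : Type u} [AddCommGroup V] [Module k V]
    (t : V ⊗[k] M) : TensorProduct.assoc k V M (X ⊗[k] L) (unitIncl adj (M.tensor V) t) =
      (unitIncl adj M).lTensor V t := by
  induction t with
  | zero => simp
  | add x y hx hy => rw [map_add, map_add, hx, hy, map_add]
  | tmul v m =>
    refine (congrArg _ (unitIncl_nat adj (M.tensorMk v) m)).trans ?_
    rw [LinearMap.lTensor_tmul]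
    change TensorProduct.assoc k V M (X ⊗[k] L)
      ((TensorProduct.mk k V M v).rTensor (X ⊗[k] L) (unitIncl adj M m)) = _
    generalize unitIncl adj M m = s
    induction s with
    | zero => simp
    | add x y hx hy => simp only [map_add, TensorProduct.tmul_add, hx, hy]
    | tmul a b => simp

/-- The coevaluation `C → X ⊗ Λ` of an adjunction. -/
def unitCoev : C →ₗ[k] X ⊗[k] L :=
  sliceL (X ⊗[k] L) Coalgebra.counit ∘ₗ unitIncl adj (RightComod.regular k C)

/-- Naturality along the coaction M → M ⊗ C expresses the unit at M by the unit at C. Applying ε_C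
to the factor C then removes the coaction on one side and leaves the coevaluation on the other. -/
theorem unitIncl_eq (M : RightComod k C) (m : M) :
    unitIncl adj M m = (unitCoev adj).lTensor M (M.coact m) := by
  have h1 : TensorProduct.assoc k M C (X ⊗[k] L)
      (M.coact.rTensor (X ⊗[k] L) (unitIncl adj M m)) =
      (unitIncl adj (RightComod.regular k C)).lTensor M (M.coact m) :=
    (congrArg _ (unitIncl_nat adj M.coactHom m)).symm.trans
      (unitIncl_tensor adj (RightComod.regular k C) (M.coact m))
  rw [unitCoev, LinearMap.lTensor_comp_apply, ← h1]
  generalize unitIncl adj M m = s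
  have h2 : (sliceL (X ⊗[k] L) Coalgebra.counit).lTensor M ∘ₗ
      (TensorProduct.assoc k M C (X ⊗[k] L)).toLinearMap =
      (sliceR M Coalgebra.counit).rTensor (X ⊗[k] L) :=
    TensorProduct.ext_threefold fun a b c => by simp [TensorProduct.smul_tmul]
  have h3 := LinearMap.congr_fun h2 (M.coact.rTensor (X ⊗[k] L) s)
  rw [← LinearMap.rTensor_comp_apply, show sliceR M Coalgebra.counit ∘ₗ M.coact = LinearMap.id from
    LinearMap.ext (sliceR_counit_coact M.isCoaction), LinearMap.rTensor_id_apply] at h3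
  exact h3.symm

/-- By associativity the unit at C takes values in C ⊗ (X □_D Λ), and slicing off the factor C stays
inside X □_D Λ. -/
theorem unitCoev_mem (c : C) : unitCoev adj c ∈ cot X.rcoact L.lcoact := by
  let s := (adj.unit.app (RightComod.regular k C)).lin c
  have h := inclRight_cotAssoc (RightComod.regular k C).coact X.bicoassoc L.lcoact s
  change sliceL (X ⊗[k] L) Coalgebra.counit
    (inclLeft (RightComod.regular k C).coact X.bicoassoc L.lcoact s) ∈ _
  rw [← h, inclRight, LinearMap.comp_apply, sliceL_lTensor]
  exact Subtype.coe_prop _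

/-- The values of the unit at C lie in the cotensor product over C. Slicing that condition by ε_C
identifies the left coaction of ψ(c) with the full unit at c, and `unitIncl_eq` at M = C rewrites
the latter as (C ⊗ ψ)Δ(c). -/
theorem unitCoev_left_colin :
    unitCoev adj ∈ leftHoms Coalgebra.comul (leftTensor L X.lcoact) := fun c => by
  have h := rTensor_inclLeft (RightComod.regular k C).coact X.bicoassoc L.lcoact
    ((adj.unit.app (RightComod.regular k C)).lin c)
  have h' := congrArg (sliceL (C ⊗[k] (X ⊗[k] L)) Coalgebra.counit) h
  rw [sliceL_lTensor] at h'
  refine h'.symm.trans (Eq.trans ?_ (unitIncl_eq adj (RightComod.regular k C) c))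
  change _ = inclLeft (RightComod.regular k C).coact X.bicoassoc L.lcoact _
  generalize inclLeft (RightComod.regular k C).coact X.bicoassoc L.lcoact
    ((adj.unit.app (RightComod.regular k C)).lin c) = s
  have h2 : sliceL (C ⊗[k] (X ⊗[k] L)) Coalgebra.counit ∘ₗ
      (TensorProduct.assoc k C C (X ⊗[k] L)).toLinearMap =
      (sliceL C Coalgebra.counit).rTensor (X ⊗[k] L) :=
    TensorProduct.ext_threefold fun a b c => by simp [TensorProduct.smul_tmul']
  have h3 := LinearMap.congr_fun h2 ((RightComod.regular k C).coact.rTensor (X ⊗[k] L) s)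
  rw [← LinearMap.rTensor_comp_apply,
    show sliceL C Coalgebra.counit ∘ₗ (RightComod.regular k C).coact = LinearMap.id from
      LinearMap.ext (sliceL_counit_coact (LeftComod.regular k C).isCoaction),
    LinearMap.rTensor_id_apply] at h3
  exact h3

theorem unitCoev_right_colin :
    unitCoev adj ∈ rightHoms Coalgebra.comul (rightTensor X L.rcoact) :=
  rightHoms_comp (sliceL_mem_rightHoms Coalgebra.counit _)
    (rightHoms_comp (inclLeft_mem_rightHoms (RightComod.regular k C) X L)
      (adj.unit.app (RightComod.regular k C)).colin)

end Unit

/-! ### The evaluation extracted from the counit at D. -/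

section Counit

variable (adj : cotensorRight X ⊣ cotensorRight L)

/-- The counit of an adjunction, as a linear map. -/
def counitLin (N : RightComod k D) : cot (N.cotensor L).coact X.lcoact →ₗ[k] N :=
  (adj.counit.app N).lin

theorem counitLin_nat {M N : RightComod k D} (f : M ⟶ N) (s : (M.cotensor L).cotensor X) :
    counitLin adj N (((cotensorRight X).map ((cotensorRight L).map f)).lin s) =
      f.lin (counitLin adj M s) :=
  congrArg (fun g => RightComod.Hom.lin g s) (adj.counit.naturality f)

/-- The counterpart of `unitIncl_tensor`. Producing a preimage s for each t avoids constructing an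
isomorphism between the iterated cotensor product of V ⊗ N and V tensored with that of N;
injectivity of the inclusion makes s unambiguous. -/
theorem exists_counitLin_tensor (N : RightComod k D) {V : Type u} [AddCommGroup V] [Module k V]
    (t : V ⊗[k] cot (N.cotensor L).coact X.lcoact) :
    ∃ s : cot ((N.tensor V).cotensor L).coact X.lcoact,
      TensorProduct.assoc k V N (L ⊗[k] X)
        (inclLeft (N.tensor V).coact L.bicoassoc X.lcoact s) =
          (inclLeft N.coact L.bicoassoc X.lcoact).lTensor V t ∧
      counitLin adj (N.tensor V) s = (counitLin adj N).lTensor V t := by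
  induction t with
  | zero => exact ⟨0, by simp, by simp⟩
  | add x y hx hy =>
    obtain ⟨s, h1, h2⟩ := hx
    obtain ⟨s', h3, h4⟩ := hy
    exact ⟨s + s', by simp only [map_add, h1, h3], by simp only [map_add, h2, h4]⟩
  | tmul v s =>
    refine ⟨((cotensorRight X).map ((cotensorRight L).map (N.tensorMk v))).lin s, ?_,
      counitLin_nat adj (N.tensorMk v) s⟩
    refine (congrArg _ (inclLeft_map L X (N.tensorMk v) s)).trans ?_
    rw [LinearMap.lTensor_tmul]
    change TensorProduct.assoc k V N (L ⊗[k] X) ((TensorProduct.mk k V N v).rTensor (L ⊗[k] X)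
      (inclLeft N.coact L.bicoassoc X.lcoact s)) = _
    generalize inclLeft N.coact L.bicoassoc X.lcoact s = s
    induction s with
    | zero => simp
    | add x y hx hy => simp only [map_add, TensorProduct.tmul_add, hx, hy]
    | tmul a b => simp

/-- Commutation of the two coactions of Λ, in the form that allows Λ → D □_D Λ to be cotensored with
X over C. -/
theorem leftUnit_mem_rightHoms (L : Bicomod k D C) :
    leftUnit L.toLeft ∈ rightHoms L.rcoact (rightCot (RightComod.regular k D).coact L.bicoassoc) :=
  mem_rightHoms_rightCot L.bicoassoc (ρ := (RightComod.regular k D).coact)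
    (f := leftUnit L.toLeft) L.bicoassoc.mem_rightHoms

/-- The evaluation `Λ □_C X → D` of an adjunction. -/
def counitEv : cot L.rcoact X.lcoact →ₗ[k] D :=
  counitLin adj (RightComod.regular k D) ∘ₗ
    cotMap (leftUnit_mem_rightHoms L) (leftHoms_id X.lcoact)

/-- The argument is dual to `unitIncl_eq`: naturality along N → N ⊗ D reduces the counit at N to the
counit at D, and ε_D applied to the D-factor undoes the coaction. What is left is ε_D ∘ ω on Λ □_C
X, that is, e. -/
theorem counitLin_eq (he : e ∘ₗ (cot L.rcoact X.lcoact).subtype =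
    Coalgebra.counit ∘ₗ counitEv adj) (N : RightComod k D)
    (s : cot (N.cotensor L).coact X.lcoact) : counitLin adj N s = counitR e N s := by
  let t : N ⊗[k] cot L.rcoact X.lcoact := (cotAssoc N.coact L.bicoassoc X.lcoact s).1
  have ht : (cot L.rcoact X.lcoact).subtype.lTensor N t =
      inclLeft N.coact L.bicoassoc X.lcoact s :=
    inclRight_cotAssoc N.coact L.bicoassoc X.lcoact s
  obtain ⟨s', h1, h2⟩ := exists_counitLin_tensor adj (RightComod.regular k D) (V := N)
    ((cotMap (leftUnit_mem_rightHoms L) (leftHoms_id X.lcoact)).lTensor N t)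
  -- The coaction of N may be replaced by that of Λ because s satisfies the cotensor condition over
  -- D. The result is the preimage s' built from t.
  have h3 : ((cotensorRight X).map ((cotensorRight L).map N.coactHom)).lin s = s' := by
    refine inclLeft_inj ((RightComod.regular k D).tensor N).coact L.bicoassoc X.lcoact ?_
    refine (inclLeft_map L X N.coactHom s).trans ?_
    apply (TensorProduct.assoc k N D (L ⊗[k] X)).injective
    refine Eq.trans ?_ h1.symm
    refine (rTensor_inclLeft N.coact L.bicoassoc X.lcoact s).trans ?_
    rw [← ht, ← LinearMap.lTensor_comp_apply, ← LinearMap.lTensor_comp_apply]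
    congr 2
    refine LinearMap.ext fun z => ?_
    refine congrArg (TensorProduct.assoc k D L X) ?_
    exact (LinearMap.rTensor_comp_apply X (cot _ _).subtype (leftUnit L.toLeft) z.1)
  have h4 := counitLin_nat adj N.coactHom s
  rw [h3, h2, ← LinearMap.lTensor_comp_apply] at h4
  have h5 := congrArg (sliceR N Coalgebra.counit) h4
  rw [sliceR_lTensor] at h5
  refine ((sliceR_counit_coact N.isCoaction _).symm.trans h5.symm).trans ?_
  have h6 : Coalgebra.counit ∘ₗ counitLin adj (RightComod.regular k D) ∘ₗ
    cotMap (leftUnit_mem_rightHoms L) (leftHoms_id X.lcoact) =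
      e ∘ₗ (cot L.rcoact X.lcoact).subtype := he.symm
  rw [h6, ← sliceR_lTensor, ht]
  rfl

end Counit

/-- Unit and counit are now known to be given by ψ and e, so the formulas proved for dual pairs
compute the triangle identities of the adjunction. Evaluated at C and D, and sliced by the counits
of these coalgebras, they become the zigzags. -/
theorem exists_isDualPair_of_adjunctionRight (adj : cotensorRight X ⊣ cotensorRight L) :
    ∃ (ψ : C →ₗ[k] X ⊗[k] L) (e : Dual k (L ⊗[k] X)), IsDualPair L X ψ e := by
  obtain ⟨e, he⟩ := LinearMap.exists_extend
    ((Coalgebra.counit (R := k) (A := D)) ∘ₗ counitEv adj)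
  refine ⟨unitCoev adj, e, unitCoev_left_colin adj, unitCoev_right_colin adj, unitCoev_mem adj,
    fun l => ?_, fun x => ?_⟩
  -- The element l is inserted through Λ ≅ D □_D Λ; slicing the D-factor by ε_D afterwards gives l
  -- back.
  · have h := congrArg (fun g : (cotensorRight L).obj (RightComod.regular k D) ⟶
      (cotensorRight L).obj (RightComod.regular k D) => (g.lin (leftUnit L.toLeft l)).1)
      (adj.right_triangle_components (RightComod.regular k D))
    have h1 := counitR_rTensor (e := e) (N := RightComod.regular k D) (leftUnit L.toLeft l) _
      (unitIncl_eq adj ((RightComod.regular k D).cotensor L) (leftUnit L.toLeft l))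
    rw [← show counitLin adj (RightComod.regular k D) = counitR e _ from
      LinearMap.ext (counitLin_eq adj he _)] at h1
    have h2 := congrArg (sliceL L Coalgebra.counit) (h1.symm.trans h)
    rw [sliceL_lTensor] at h2
    have h3 := sliceL_counit_coact L.isLeft l
    refine Eq.trans ?_ (h2.trans h3)
    exact congrArg (contrL L e ∘ₗ (unitCoev adj).lTensor L ∘ₗ L.rcoact) h3.symm
  · have h := congrArg (fun g : (cotensorRight X).obj (RightComod.regular k C) ⟶
      (cotensorRight X).obj (RightComod.regular k C) => (g.lin (leftUnit X.toLeft x)).1)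
      (adj.left_triangle_components (RightComod.regular k C))
    have h1 := counitR_cot (e := e) (unitIncl_eq adj (RightComod.regular k C))
      (leftUnit X.toLeft x)
      (((cotensorRight X).map (adj.unit.app (RightComod.regular k C))).lin (leftUnit X.toLeft x))
      rfl
    have h1' := (congrArg Subtype.val (counitLin_eq adj he
      ((RightComod.regular k C).cotensor X) (((cotensorRight X).map
        (adj.unit.app (RightComod.regular k C))).lin (leftUnit X.toLeft x)))).trans h1
    have h2 := congrArg (sliceL X Coalgebra.counit) (h1'.symm.trans h)
    rw [sliceL_lTensor] at h2
    have h3 := sliceL_counit_coact X.isLeft x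
    refine Eq.trans ?_ (h2.trans h3)
    exact congrArg (contrR X e ∘ₗ (unitCoev adj).rTensor X ∘ₗ X.lcoact) h3.symm

end RightAdjunction

/-! ### Dual pairs, quasifiniteness and injectivity on the right -/

section RightInjective

open Module (Dual)

variable {k : Type u} [Field k]
variable {C : Type u} [AddCommGroup C] [Module k C] [Coalgebra k C]
variable {D : Type u} [AddCommGroup D] [Module k D] [Coalgebra k D]
variable {L : Bicomod k D C} {X : Bicomod k C D} {ψ : C →ₗ[k] X ⊗[k] L} {e : Dual k (L ⊗[k] X)}

/-- Apply the first zigzag to f(v) and move f past the coaction. The element of V ⊗ X ⊗ Λ that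
remains does not depend on f, so f is recovered from the functional e ∘ (f ⊗ X) alone. -/
theorem IsDualPair.apply_eq_sliceL (h : IsDualPair L X ψ e) {V : RightComod k C}
    {f : V →ₗ[k] L} (hf : f ∈ rightHoms V.coact L.rcoact) (v : V) :
    f v = sliceL L (e ∘ₗ f.rTensor X)
      ((TensorProduct.assoc k V X L).symm (ψ.lTensor V (V.coact v))) := by
  rw [← sliceL_rTensor]
  refine (h.zigzagL (f v)).symm.trans ?_
  rw [hf v, ← rl_comm, contrL, LinearMap.comp_apply, LinearEquiv.coe_coe]
  congr 1
  rw [LinearEquiv.symm_apply_eq, assoc_nat1, LinearEquiv.apply_symm_apply]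

/-- A colinear map is determined by the restriction of e ∘ (f ⊗ X) to a finite dimensional subspace
of V ⊗ X, which embeds the space of colinear maps in the dual of that subspace. -/
theorem IsDualPair.quasifinite_toRight (h : IsDualPair L X ψ e) : L.toRight.Quasifinite := by
  intro V hV
  let b := Module.finBasis k V
  let u : V →ₗ[k] (V ⊗[k] X) ⊗[k] L :=
    (TensorProduct.assoc k V X L).symm.toLinearMap ∘ₗ ψ.lTensor V ∘ₗ V.coact
  -- The slices in V ⊗ X of the tensors u(b i) span a finite dimensional space. The functionals
  -- attached to colinear maps are ever evaluated only there.
  choose S hS hS' using fun i => exists_finite_sliceR (u (b i))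
  let T : Submodule k (V ⊗[k] X) := ⨆ i, S i
  have hT : Module.Finite k T := Submodule.finite_iSup S
  let Φ : rightHoms V.coact L.rcoact →ₗ[k] Dual k T :=
    { toFun := fun f => (e ∘ₗ f.1.rTensor X) ∘ₗ T.subtype
      map_add' := fun f g => by
        rw [Submodule.coe_add, LinearMap.rTensor_add, LinearMap.comp_add, LinearMap.add_comp]
      map_smul' := fun c f => by
        rw [Submodule.coe_smul, LinearMap.rTensor_smul, LinearMap.comp_smul, LinearMap.smul_comp]
        rfl }
  refine Module.Finite.of_injective Φ ((injective_iff_map_eq_zero Φ).2 fun f hf => ?_)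
  refine Subtype.ext (b.ext fun i => ?_)
  refine (Module.forall_dual_apply_eq_zero_iff k _).1 fun ξ => ?_
  -- Testing with ξ on Λ first lets the functional g be evaluated at an element of T.
  have key : ∀ (g : Dual k (V ⊗[k] X)) (t : (V ⊗[k] X) ⊗[k] L),
      ξ (sliceL L g t) = g (sliceR (V ⊗[k] X) ξ t) := by
    intro g t
    induction t with
    | zero => simp
    | add x y hx hy => simp only [map_add, hx, hy]
    | tmul a w => simp [mul_comm]
  rw [h.apply_eq_sliceL f.2, key]
  exact LinearMap.congr_fun hf ⟨_, Submodule.mem_iSup_of_mem i (hS' i ξ)⟩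

/-- Over a field the kernel of a colinear map is a subcomodule. Its inclusion and the zero map
become equal after composition with f, hence are equal. -/
theorem RightComod.injective_of_mono {M N : RightComod k C} (f : M ⟶ N) [Mono f] :
    Function.Injective f.lin := by
  rw [← LinearMap.ker_eq_bot]
  let K := LinearMap.ker f.lin
  have hK : ∀ x : K, (M.coact ∘ₗ K.subtype) x ∈ LinearMap.range (K.subtype.rTensor C) := by
    intro x
    rw [mem_range_rTensor_ker]
    refine (f.colin x.1).symm.trans ?_
    rw [LinearMap.mem_ker.1 x.2, map_zero]
  let ρ := lift (K.subtype.rTensor C) (rTensor_inj K.injective_subtype) (M.coact ∘ₗ K.subtype) hK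
  have hρ : K.subtype ∈ rightHoms ρ M.coact := fun s => (lift_spec _ _ _ hK s).symm
  let KM : RightComod k C := ⟨K, ρ, M.isCoaction.of_inj K.injective_subtype hρ⟩
  let i : KM ⟶ M := ⟨K.subtype, hρ⟩
  let z : KM ⟶ M := ⟨0, Submodule.zero_mem _⟩
  have hiz : i = z := by
    rw [← cancel_mono f]
    refine RightComod.Hom.ext (LinearMap.ext fun x => ?_)
    exact (LinearMap.mem_ker.1 x.2).trans (map_zero f.lin).symm
  rw [eq_bot_iff]
  intro x hx
  exact LinearMap.congr_fun (congrArg RightComod.Hom.lin hiz) (⟨x, hx⟩ : K)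

theorem RightComod.mono_of_injective {M N : RightComod k C} (f : M ⟶ N)
    (hf : Function.Injective f.lin) : Mono f where
  right_cancellation _ _ hgh := RightComod.Hom.ext (LinearMap.ext fun x =>
    hf (LinearMap.congr_fun (congrArg RightComod.Hom.lin hgh) x))

/-- By the first zigzag this map retracts the coaction Λ → Λ ⊗ C, so its colinearity makes Λ a
direct summand of a cofree comodule. -/
theorem IsDualPair.contrL_colin (h : IsDualPair L X ψ e) :
    contrL L e ∘ₗ ψ.lTensor L ∈ rightHoms (rightTensor L Coalgebra.comul) L.rcoact := by
  refine rightHoms_comp ?_ (lTensor_mem_rightHoms h.right_colin)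
  exact rightHoms_comp (sliceL_mem_rightHoms e L.rcoact) (assoc_symm_mem_rightHoms L.rcoact)

/-- Cofree comodules are injective since f has a linear left inverse p. The extension is g ∘ p made
colinear through B → B ⊗ C → Λ ⊗ C, followed by the retraction onto Λ. -/
theorem IsDualPair.injective_toRight (h : IsDualPair L X ψ e) : Injective L.toRight where
  factors {A B} g f _ := by
    obtain ⟨p, hp⟩ := LinearMap.exists_leftInverse_of_injective f.lin
      (LinearMap.ker_eq_bot.2 (RightComod.injective_of_mono f))
    refine ⟨⟨(contrL L e ∘ₗ ψ.lTensor L) ∘ₗ (g.lin ∘ₗ p).rTensor C ∘ₗ B.coact,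
      rightHoms_comp h.contrL_colin (rightHoms_comp
        (map_mem_rightHoms (g.lin ∘ₗ p) (rightHoms_id Coalgebra.comul))
        B.isCoaction.mem_rightHoms)⟩, RightComod.Hom.ext (LinearMap.ext fun a => ?_)⟩
    change contrL L e (ψ.lTensor L ((g.lin ∘ₗ p).rTensor C (B.coact (f.lin a)))) = g.lin a
    rw [f.colin a, ← LinearMap.rTensor_comp_apply, LinearMap.comp_assoc, hp, LinearMap.comp_id,
      ← g.colin a]
    exact h.zigzagL (g.lin a)

/-- Every colinear φ : C → H ⊗ Λ factors through ψ by an explicit linear map X → H, just as it does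
through η_C. Left colinearity of ψ and right colinearity of φ carry the coactions past each other,
and the first zigzag finishes. The second zigzag is not among the assumptions, so the lemma can be
used to prove it. -/
theorem contrR_rTensor_eq (hψ : ψ ∈ leftHoms Coalgebra.comul (leftTensor L X.lcoact))
    (hz : ∀ l, contrL L e (ψ.lTensor L (L.rcoact l)) = l)
    {H : Type u} [AddCommGroup H] [Module k H] {φ : C →ₗ[k] H ⊗[k] L}
    (hφ : φ ∈ rightHoms Coalgebra.comul (rightTensor H L.rcoact)) (c : C) :
    (contrR H e ∘ₗ φ.rTensor X ∘ₗ X.lcoact).rTensor L (ψ c) = φ c := by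
  have h1 : X.lcoact.rTensor L (ψ c) =
      (TensorProduct.assoc k C X L).symm (ψ.lTensor C (Coalgebra.comul c)) :=
    (LinearEquiv.eq_symm_apply _).2 (hψ c)
  have h2 : TensorProduct.assoc k H L C (φ.rTensor C (Coalgebra.comul c)) =
      L.rcoact.lTensor H (φ c) := by
    rw [← hφ c, rightTensor, LinearMap.comp_apply, LinearEquiv.coe_coe,
      LinearEquiv.apply_symm_apply]
  have h3 : (contrR H e ∘ₗ φ.rTensor X).rTensor L ∘ₗ
      (TensorProduct.assoc k C X L).symm.toLinearMap ∘ₗ ψ.lTensor C =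
      (contrL L e ∘ₗ ψ.lTensor L).lTensor H ∘ₗ
        (TensorProduct.assoc k H L C).toLinearMap ∘ₗ φ.rTensor C :=
    TensorProduct.ext' fun a b => by
      have key : ∀ w : X ⊗[k] L, (contrR H e ∘ₗ φ.rTensor X).rTensor L
          ((TensorProduct.assoc k C X L).symm (a ⊗ₜ w)) =
          (contrL L e).lTensor H (TensorProduct.assoc k H L (X ⊗[k] L) (φ a ⊗ₜ w)) := by
        intro w
        induction w with
        | zero => simp
        | add x y hx hy => simp only [map_add, TensorProduct.tmul_add, hx, hy]
        | tmul x l =>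
          simp only [TensorProduct.assoc_symm_tmul, LinearMap.rTensor_tmul, LinearMap.comp_apply]
          generalize φ a = v
          induction v with
          | zero => simp
          | add x y hx hy => simp only [map_add, TensorProduct.add_tmul, hx, hy]
          | tmul y l' => simp [TensorProduct.smul_tmul]
      rw [LinearMap.comp_apply, LinearMap.comp_apply, LinearMap.comp_apply, LinearMap.comp_apply,
        LinearMap.lTensor_tmul, LinearMap.rTensor_tmul, LinearMap.lTensor_comp_apply,
        LinearEquiv.coe_coe, LinearEquiv.coe_coe, ← assoc_nat3, LinearMap.lTensor_tmul]
      exact key (ψ b)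
  have h4 := LinearMap.congr_fun h3 (Coalgebra.comul c)
  simp only [LinearMap.comp_apply, LinearEquiv.coe_coe] at h4
  rw [← LinearMap.comp_assoc, LinearMap.rTensor_comp_apply, h1]
  refine h4.trans ?_
  rw [h2, ← LinearMap.lTensor_comp_apply, LinearMap.comp_assoc,
    show contrL L e ∘ₗ ψ.lTensor L ∘ₗ L.rcoact = LinearMap.id from LinearMap.ext hz,
    LinearMap.lTensor_id_apply]

/-- A bicolinear map with a linear inverse is an isomorphism of bicomodules. -/
def Bicomod.isoOfInverse {X Y : Bicomod k C D} (f : X ⟶ Y) (g : Y →ₗ[k] X)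
    (hfg : f.lin ∘ₗ g = LinearMap.id) (hgf : g ∘ₗ f.lin = LinearMap.id) : X ≅ Y where
  hom := f
  inv :=
    have hi : Function.Injective f.lin := Function.LeftInverse.injective (LinearMap.congr_fun hgf)
    ⟨g, leftHoms_of_comp hi f.lcolin (by rw [hfg]; exact leftHoms_id _),
      rightHoms_of_comp hi f.rcolin (by rw [hfg]; exact rightHoms_id _)⟩
  hom_inv_id := Bicomod.Hom.ext hgf
  inv_hom_id := Bicomod.Hom.ext hfg

/-- Maps out of the co-Hom space are determined by their effect on η. There the claim becomes the
left colinearity of g. -/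
theorem descR_mem_leftHoms {M N W : Type u} [AddCommGroup M] [Module k M] [AddCommGroup N]
    [Module k N] [AddCommGroup W] [Module k W] {ρ : M →ₗ[k] M ⊗[k] C} (hρ : IsRightCoaction ρ)
    {ρN : N →ₗ[k] N ⊗[k] C}
    (hq : ∀ V : RightComod k C, Module.Finite k V → Module.Finite k (rightHoms V.coact ρN))
    {lM : M →ₗ[k] D ⊗[k] M} (hM : Bicoassoc lM ρ) {lW : W →ₗ[k] D ⊗[k] W} {g : M →ₗ[k] W ⊗[k] N}
    (hg : g ∈ rightHoms ρ (rightTensor W ρN)) (hg' : g ∈ leftHoms lM (leftTensor N lW)) :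
    descR hρ hq hg ∈ leftHoms (lambdaR hρ hq hM) lW := by
  refine LinearMap.congr_fun (f := lW ∘ₗ descR hρ hq hg)
    (g := (descR hρ hq hg).lTensor D ∘ₗ lambdaR hρ hq hM) (etaR_ext hρ hq fun m => ?_)
  apply (TensorProduct.assoc k D W N).injective
  rw [LinearMap.rTensor_comp_apply, LinearMap.rTensor_comp_apply, descR_spec, assoc_nat2,
    lambdaR_spec, ← LinearMap.lTensor_comp_apply,
    show (descR hρ hq hg).rTensor N ∘ₗ etaR hρ hq = g from LinearMap.ext (descR_spec hρ hq hg)]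
  exact hg' m

/-- The comparison map `h_C(Λ, C) → X` of a dual pair. -/
def IsDualPair.fromCoHomRight (h : IsDualPair L X ψ e) (hL : L.toRight.Quasifinite) :
    Bicomod.coHomRight L hL ⟶ X where
  lin := descR (RightComod.regular k C).isCoaction hL h.right_colin
  lcolin := descR_mem_leftHoms (RightComod.regular k C).isCoaction hL
    (Bicomod.regular k C).bicoassoc h.right_colin h.left_colin
  rcolin := descR_colin _ hL L.bicoassoc h.right_colin h.mem

/-- The bicomodule `X` of a dual pair is the co-Hom bicomodule `h_C(Λ, C)`. -/
def IsDualPair.isoCoHomRight (h : IsDualPair L X ψ e) (hL : L.toRight.Quasifinite) :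
    X ≅ Bicomod.coHomRight L hL :=
  (Bicomod.isoOfInverse (h.fromCoHomRight hL)
    (contrR _ e ∘ₗ (etaR (RightComod.regular k C).isCoaction hL).rTensor X ∘ₗ X.lcoact)
    (LinearMap.ext fun x => by
      -- The comparison map carries η to ψ, so it turns the candidate inverse into the left side of
      -- the second zigzag.
      have h2 : (h.fromCoHomRight hL).lin ∘ₗ contrR _ e ∘ₗ
          (etaR (RightComod.regular k C).isCoaction hL).rTensor X = contrR X e ∘ₗ ψ.rTensor X :=
        TensorProduct.ext' fun c x => (contrR_nat e (h.fromCoHomRight hL).lin _ x).trans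
          (congrArg (fun t => contrR X e (t ⊗ₜ[k] x)) (descR_spec _ hL h.right_colin c))
      exact (LinearMap.congr_fun h2 (X.lcoact x)).trans (h.zigzagR x))
    -- The other composite is tested on η, where it is the factorisation of φ = η through ψ.
    (etaR_ext (RightComod.regular k C).isCoaction hL fun c => by
      rw [LinearMap.rTensor_comp_apply, LinearMap.rTensor_id_apply]
      refine (congrArg _ (descR_spec _ hL h.right_colin c)).trans ?_
      exact contrR_rTensor_eq h.left_colin h.zigzagL
        (etaR_colin (RightComod.regular k C).isCoaction hL) c)).symm

/-- Injectivity splits the coaction of Λ by a colinear π : Λ ⊗ C → Λ. Taking ψ from η_C and e from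
the pairing of h_C(Λ, C) with the maps π(l ⊗ –), contraction against ψ reproduces π; hence the first
zigzag. The second then follows from the universal property of η_C. -/
theorem exists_isDualPair_of_injective_toRight (hL : L.toRight.Quasifinite)
    (hinj : Injective L.toRight) (i : X ≅ Bicomod.coHomRight L hL) :
    ∃ (ψ : C →ₗ[k] X ⊗[k] L) (e : Dual k (L ⊗[k] X)), IsDualPair L X ψ e := by
  let η := etaR (RightComod.regular k C).isCoaction hL
  have hη : η ∈ rightHoms Coalgebra.comul (rightTensor _ L.rcoact) := etaR_colin _ hL
  let q : Bicomod.coHomRight L hL →ₗ[k] X := i.inv.lin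
  let q' : X →ₗ[k] Bicomod.coHomRight L hL := i.hom.lin
  have hq : q' ∘ₗ q = LinearMap.id := congrArg Bicomod.Hom.lin i.inv_hom_id
  have hq' : q ∘ₗ q' = LinearMap.id := congrArg Bicomod.Hom.lin i.hom_inv_id
  have hmono : Mono L.toRight.coactHom := RightComod.mono_of_injective _
    (Function.LeftInverse.injective (sliceR_counit_coact L.isRight))
  let π := Injective.factorThru (𝟙 L.toRight) L.toRight.coactHom
  have hπ : ∀ l, π.lin (L.rcoact l) = l := fun l => LinearMap.congr_fun
    (congrArg RightComod.Hom.lin (Injective.comp_factorThru (𝟙 L.toRight) L.toRight.coactHom)) l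
  -- Fixing the first argument of π gives, for each l, a colinear map C → Λ, which is what the
  -- co-Hom space pairs with.
  let P : L →ₗ[k] rightHoms (Coalgebra.comul (R := k) (A := C)) L.rcoact :=
    (TensorProduct.curry π.lin).codRestrict _ fun l =>
      rightHoms_comp π.colin (mk_mem_rightHoms Coalgebra.comul l)
  let e : Dual k (L ⊗[k] X) := TensorProduct.lift ((inclR _ _ ∘ₗ q').flip ∘ₗ P)
  have he : ∀ l x, e (l ⊗ₜ x) = pairR (P l) (q' x) := fun l x => rfl
  let ψ : C →ₗ[k] X ⊗[k] L := q.rTensor L ∘ₗ η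
  have hψ : contrL L e ∘ₗ ψ.lTensor L = π.lin := TensorProduct.ext' fun l c => by
    have h1 : ∀ w : X ⊗[k] L, contrL L e (l ⊗ₜ w) = sliceL L (pairR (P l) ∘ₗ q') w := by
      intro w
      induction w with
      | zero => simp
      | add x y hx hy => simp only [map_add, TensorProduct.tmul_add, hx, hy]
      | tmul x l' => simp [he]
    have h2 : pairR (P l) ∘ₗ q' ∘ₗ q = pairR (P l) := by rw [hq]; rfl
    rw [LinearMap.comp_apply, LinearMap.lTensor_tmul, h1, LinearMap.comp_apply, sliceL_rTensor,
      LinearMap.comp_assoc, h2]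
    exact etaR_pair (RightComod.regular k C).isCoaction hL (P l) c
  have hz : ∀ l, contrL L e (ψ.lTensor L (L.rcoact l)) = l := fun l =>
    (LinearMap.congr_fun hψ (L.rcoact l)).trans (hπ l)
  have hleft : ψ ∈ leftHoms Coalgebra.comul (leftTensor L X.lcoact) := by
    refine leftHoms_comp (rTensor_mem_leftHoms i.inv.lcolin) fun c => ?_
    exact lambdaR_spec (RightComod.regular k C).isCoaction hL (Bicomod.regular k C).bicoassoc c
  have hright : ψ ∈ rightHoms Coalgebra.comul (rightTensor X L.rcoact) :=
    rightHoms_comp (map_mem_rightHoms q (rightHoms_id L.rcoact)) hη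
  refine ⟨ψ, e, hleft, hright, fun c => ?_, hz, fun x => ?_⟩
  · exact map_mem_cot i.inv.rcolin (leftHoms_id L.lcoact) _
      (etaR_mem_cot (RightComod.regular k C).isCoaction hL L.bicoassoc c)
  -- After the isomorphism with the co-Hom space the second zigzag may be tested on η, where it says
  -- that ψ factors through itself.
  · have h1 : (contrR X e ∘ₗ ψ.rTensor X ∘ₗ X.lcoact) ∘ₗ q = q :=
      etaR_ext (RightComod.regular k C).isCoaction hL fun c => by
        rw [LinearMap.rTensor_comp_apply]
        exact contrR_rTensor_eq hleft hz hright c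
    have h2 := LinearMap.congr_fun h1 (q' x)
    have h3 : q (q' x) = x := LinearMap.congr_fun hq' x
    rw [LinearMap.comp_apply, h3] at h2
    exact h2

end RightInjective

/-! ### Dual pairs and adjunctions between left cotensor functors -/

section LeftAdjunction

open Module (Dual)

variable {k : Type u} [Field k]
variable {C : Type u} [AddCommGroup C] [Module k C] [Coalgebra k C]
variable {D : Type u} [AddCommGroup D] [Module k D] [Coalgebra k D]
variable {E : Type u} [AddCommGroup E] [Module k E] [Coalgebra k E]

theorem assoc_symm_mem_leftHoms {V W N : Type u} [AddCommGroup V] [Module k V] [AddCommGroup W]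
    [Module k W] [AddCommGroup N] [Module k N] (l : N →ₗ[k] C ⊗[k] N) :
    (TensorProduct.assoc k N V W).symm.toLinearMap ∈
      leftHoms (leftTensor (V ⊗[k] W) l) (leftTensor W (leftTensor V l)) := by
  refine leftHoms_of_comp (TensorProduct.assoc k N V W).injective (assoc_mem_leftHoms l) ?_
  rw [LinearEquiv.comp_symm]
  exact leftHoms_id _

/-! ### Iterated cotensor products inside (M ⊗ X) ⊗ N. -/

section Incl

variable {M N X : Type u} [AddCommGroup M] [Module k M] [AddCommGroup X] [Module k X]
  [AddCommGroup N] [Module k N]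

/-- The inclusion `M □_C (X □_D N) → (M ⊗ X) ⊗ N`. -/
def inclRight' (ρ : M →ₗ[k] M ⊗[k] C) {l : X →ₗ[k] C ⊗[k] X} {r : X →ₗ[k] X ⊗[k] D}
    (hX : Bicoassoc l r) (lN : N →ₗ[k] D ⊗[k] N) :
    cot ρ (leftCot hX lN) →ₗ[k] (M ⊗[k] X) ⊗[k] N :=
  (TensorProduct.assoc k M X N).symm.toLinearMap ∘ₗ
    (cot r lN).subtype.lTensor M ∘ₗ (cot ρ (leftCot hX lN)).subtype

theorem inclRight'_inj (ρ : M →ₗ[k] M ⊗[k] C) {l : X →ₗ[k] C ⊗[k] X} {r : X →ₗ[k] X ⊗[k] D}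
    (hX : Bicoassoc l r) (lN : N →ₗ[k] D ⊗[k] N) : Function.Injective (inclRight' ρ hX lN) :=
  (TensorProduct.assoc k M X N).symm.injective.comp (inclRight_inj ρ hX lN)

theorem inclRight'_cotAssoc (ρ : M →ₗ[k] M ⊗[k] C) {l : X →ₗ[k] C ⊗[k] X}
    {r : X →ₗ[k] X ⊗[k] D} (hX : Bicoassoc l r) (lN : N →ₗ[k] D ⊗[k] N)
    (s : cot (rightCot ρ hX) lN) :
    inclRight' ρ hX lN (cotAssoc ρ hX lN s) = (cot ρ l).subtype.rTensor N s.1 :=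
  (LinearEquiv.symm_apply_eq _).2 (inclRight_cotAssoc ρ hX lN s)

/-- The defining condition of the second cotensor product in `M □_C (X □_D N) ⊆ (M ⊗ X) ⊗ N`. -/
theorem lTensor_inclRight' (ρ : M →ₗ[k] M ⊗[k] C) {l : X →ₗ[k] C ⊗[k] X}
    {r : X →ₗ[k] X ⊗[k] D} (hX : Bicoassoc l r) (lN : N →ₗ[k] D ⊗[k] N)
    (s : cot ρ (leftCot hX lN)) :
    TensorProduct.assoc k (M ⊗[k] X) D N
        ((rightTensor M r).rTensor N (inclRight' ρ hX lN s)) =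
      lN.lTensor (M ⊗[k] X) (inclRight' ρ hX lN s) := by
  -- Only the inner cotensor product matters, so the claim is checked on simple tensors of M ⊗ (X
  -- □_D N).
  have hz : ∀ z : M ⊗[k] cot r lN,
      TensorProduct.assoc k (M ⊗[k] X) D N ((rightTensor M r).rTensor N
        ((TensorProduct.assoc k M X N).symm ((cot r lN).subtype.lTensor M z))) =
      lN.lTensor (M ⊗[k] X)
        ((TensorProduct.assoc k M X N).symm ((cot r lN).subtype.lTensor M z)) := by
    intro z
    induction z with
    | zero => simp
    | add x y hx hy => simp only [map_add, hx, hy]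
    | tmul m t =>
      have ht := mem_cot.1 t.2
      apply (TensorProduct.assoc k M X (D ⊗[k] N)).injective
      have h1 : (TensorProduct.assoc k M X D).toLinearMap ∘ₗ rightTensor M r = r.lTensor M :=
        LinearMap.ext fun x => LinearEquiv.apply_symm_apply (TensorProduct.assoc k M X D) _
      rw [← assoc_pent, ← LinearMap.rTensor_comp_apply, h1, assoc_nat2, assoc_nat3,
        LinearEquiv.apply_symm_apply, LinearMap.lTensor_tmul, LinearMap.lTensor_tmul,
        LinearMap.lTensor_tmul, LinearMap.lTensor_tmul]
      exact congrArg (fun y => m ⊗ₜ[k] y) ht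
  exact hz s.1

end Incl

theorem inclRight'_mem_leftHoms (Y : Bicomod k E D) (X : Bicomod k D C) (M : LeftComod k C) :
    inclRight' Y.rcoact X.bicoassoc M.coact ∈
      leftHoms (LeftComod.cotensor Y (LeftComod.cotensor X M)).coact
        (leftTensor M (leftTensor X Y.lcoact)) :=
  leftHoms_comp (assoc_symm_mem_leftHoms Y.lcoact) (leftHoms_comp
    (map_mem_leftHoms (cot X.rcoact M.coact).subtype (leftHoms_id Y.lcoact))
    (subtype_mem_leftHoms Y.bicoassoc (LeftComod.cotensor X M).coact))

variable {L : Bicomod k D C} {X : Bicomod k C D} {ψ : C →ₗ[k] X ⊗[k] L} {e : Dual k (L ⊗[k] X)}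

/-! #### The adjunction attached to a dual pair -/

/-- The unit `M → X □_D (Λ □_C M)` attached to a dual pair. -/
def IsDualPair.unitL (h : IsDualPair L X ψ e) (M : LeftComod k C) :
    M →ₗ[k] cot X.rcoact (LeftComod.cotensor L M).coact :=
  (cotAssoc X.rcoact L.bicoassoc M.coact).toLinearMap ∘ₗ
    cotMap h.coev.rcolin (leftHoms_id M.coact) ∘ₗ leftUnit M

/-- With the bracketing (X ⊗ Λ) ⊗ M the unit is ψ applied after the coaction; this bracketing keeps
the comodule variable separate on the right. -/
theorem IsDualPair.inclRight'_unitL (h : IsDualPair L X ψ e) (M : LeftComod k C) (m : M) :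
    inclRight' X.rcoact L.bicoassoc M.coact (h.unitL M m) = ψ.rTensor M (M.coact m) := by
  refine (inclRight'_cotAssoc X.rcoact L.bicoassoc M.coact _).trans ?_
  exact (LinearMap.rTensor_comp_apply M (cot X.rcoact L.lcoact).subtype h.coev.lin _).symm

theorem IsDualPair.unitL_colin (h : IsDualPair L X ψ e) (M : LeftComod k C) :
    h.unitL M ∈ leftHoms M.coact (LeftComod.cotensor X (LeftComod.cotensor L M)).coact := by
  refine leftHoms_of_comp (inclRight'_inj X.rcoact L.bicoassoc M.coact)
    (inclRight'_mem_leftHoms X L M) ?_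
  rw [show inclRight' X.rcoact L.bicoassoc M.coact ∘ₗ h.unitL M = ψ.rTensor M ∘ₗ M.coact from
    LinearMap.ext (h.inclRight'_unitL M)]
  exact leftHoms_comp (rTensor_mem_leftHoms h.left_colin) M.isCoaction.mem_leftHoms

variable (e) in
/-- The map `Λ □_C (X □_D N) → N` given by a bilinear form on `Λ × X`. -/
def counitL (N : LeftComod k D) : cot L.rcoact (LeftComod.cotensor X N).coact →ₗ[k] N :=
  sliceL N e ∘ₗ inclRight' L.rcoact X.bicoassoc N.coact

/-- Here the source coaction comes from Λ. Balance exchanges it for the coaction of X, and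
membership in X □_D N passes it on to N. -/
theorem IsDualPair.counitL_colin (h : IsDualPair L X ψ e) (N : LeftComod k D) :
    counitL e N ∈ leftHoms (LeftComod.cotensor L (LeftComod.cotensor X N)).coact N.coact := by
  intro s
  have h1 := inclRight'_mem_leftHoms L X N s
  -- The balance identity needs an element of (Λ □_C X) ⊗ N, so the associativity isomorphism is
  -- traversed backwards.
  obtain ⟨t, ht⟩ : ∃ t : cot L.rcoact X.lcoact ⊗[k] N,
      inclRight' L.rcoact X.bicoassoc N.coact s = (cot L.rcoact X.lcoact).subtype.rTensor N t := by
    obtain ⟨s, rfl⟩ := (cotAssoc L.rcoact X.bicoassoc N.coact).surjective s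
    exact ⟨_, inclRight'_cotAssoc L.rcoact X.bicoassoc N.coact s⟩
  have h2 := lTensor_inclRight' L.rcoact X.bicoassoc N.coact s
  rw [counitL, LinearMap.lTensor_comp_apply, ← h1, LinearMap.comp_apply, ← sliceL_lTensor]
  have h3 : ∀ w : (L ⊗[k] X) ⊗[k] N, (sliceL N e).lTensor D
      (leftTensor N (leftTensor X L.lcoact) w) =
      (contrR D e ∘ₗ L.lcoact.rTensor X).rTensor N w := by
    intro w
    rw [LinearMap.rTensor_comp_apply, leftTensor, leftTensor, LinearMap.comp_apply,
      LinearMap.rTensor_comp_apply]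
    generalize (L.lcoact.rTensor X).rTensor N w = y
    refine LinearMap.congr_fun (f := (sliceL N e).lTensor D ∘ₗ
      (TensorProduct.assoc k D (L ⊗[k] X) N).toLinearMap ∘ₗ
      (TensorProduct.assoc k D L X).toLinearMap.rTensor N) (g := (contrR D e).rTensor N)
      (TensorProduct.ext_fourfold fun d a b n => ?_) y
    simp [TensorProduct.smul_tmul]
  have h4 : ∀ w : ((L ⊗[k] X) ⊗[k] D) ⊗[k] N,
      sliceL (D ⊗[k] N) e (TensorProduct.assoc k (L ⊗[k] X) D N w) =
      (sliceL D e).rTensor N w := by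
    intro w
    exact LinearMap.congr_fun (f := sliceL (D ⊗[k] N) e ∘ₗ
      (TensorProduct.assoc k (L ⊗[k] X) D N).toLinearMap) (g := (sliceL D e).rTensor N)
      (TensorProduct.ext_threefold fun a b c => by simp [TensorProduct.smul_tmul']) w
  rw [h3, ← h2, h4, ht, ← LinearMap.rTensor_comp_apply,
    ← LinearMap.rTensor_comp_apply, ← LinearMap.rTensor_comp_apply, h.balanced']
  rfl

/-- The counit on `Λ □_C M`, composed with a unit on `M`. -/
theorem counitL_cot {M : LeftComod k C}
    {f : M →ₗ[k] cot X.rcoact (LeftComod.cotensor L M).coact}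
    (hf : ∀ m, inclRight' X.rcoact L.bicoassoc M.coact (f m) = ψ.rTensor M (M.coact m))
    (z : cot L.rcoact M.coact)
    (v : cot L.rcoact (LeftComod.cotensor X (LeftComod.cotensor L M)).coact)
    (hv : v.1 = f.lTensor L z.1) :
    (counitL e (LeftComod.cotensor L M) v).1 =
      (contrL L e ∘ₗ ψ.lTensor L ∘ₗ L.rcoact).rTensor M z.1 := by
  have h1 : (counitL e (LeftComod.cotensor L M) v).1 = sliceL (L ⊗[k] M) e
      ((cot L.rcoact M.coact).subtype.lTensor (L ⊗[k] X)
        (inclRight' L.rcoact X.bicoassoc (LeftComod.cotensor L M).coact v)) :=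
    (sliceL_lTensor e (cot L.rcoact M.coact).subtype _).symm
  have h2 : (cot L.rcoact M.coact).subtype.lTensor X ∘ₗ
      (cot X.rcoact (LeftComod.cotensor L M).coact).subtype ∘ₗ f =
      (TensorProduct.assoc k X L M).toLinearMap ∘ₗ ψ.rTensor M ∘ₗ M.coact :=
    LinearMap.ext fun m => (LinearEquiv.symm_apply_eq _).1 (hf m)
  -- Membership of z in Λ □_C M trades the coaction of M for that of Λ, which feeds the first
  -- zigzag.
  have h3 : (TensorProduct.assoc k L C M) (L.rcoact.rTensor M z.1) = M.coact.lTensor L z.1 :=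
    mem_cot.1 z.2
  have h4 : ∀ t, (cot L.rcoact M.coact).subtype.lTensor (L ⊗[k] X)
      ((TensorProduct.assoc k L X _).symm t) = (TensorProduct.assoc k L X (L ⊗[k] M)).symm
      (((cot L.rcoact M.coact).subtype.lTensor X).lTensor L t) := fun t => by
    rw [LinearEquiv.eq_symm_apply, assoc_nat3, LinearEquiv.apply_symm_apply]
  rw [h1, inclRight', LinearMap.comp_apply, LinearMap.comp_apply, LinearEquiv.coe_coe, h4,
    Submodule.subtype_apply, hv, ← LinearMap.lTensor_comp_apply, ← LinearMap.lTensor_comp_apply,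
    LinearMap.comp_assoc, h2, LinearMap.lTensor_comp_apply, LinearMap.lTensor_comp_apply,
    ← LinearMap.comp_assoc, LinearMap.rTensor_comp_apply, ← h3]
  generalize L.rcoact.rTensor M z.1 = y
  refine LinearMap.congr_fun (f := sliceL (L ⊗[k] M) e ∘ₗ
    (TensorProduct.assoc k L X (L ⊗[k] M)).symm.toLinearMap ∘ₗ
    (TensorProduct.assoc k X L M).toLinearMap.lTensor L ∘ₗ (ψ.rTensor M).lTensor L ∘ₗ
      (TensorProduct.assoc k L C M).toLinearMap)
    (g := (contrL L e ∘ₗ ψ.lTensor L).rTensor M)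
    (TensorProduct.ext_threefold fun l c m => ?_) y
  simp only [LinearMap.comp_apply, LinearMap.rTensor_tmul, LinearMap.lTensor_tmul,
    LinearEquiv.coe_coe, TensorProduct.assoc_tmul]
  generalize ψ c = w
  induction w with
  | zero => simp
  | add x y hx hy => simp only [map_add, TensorProduct.tmul_add, TensorProduct.add_tmul, hx, hy]
  | tmul a b => simp [TensorProduct.smul_tmul']

/-- The unit on `X □_D N`, composed with the counit on `N`. -/
theorem counitL_lTensor {N : LeftComod k D} (y : cot X.rcoact N.coact)
    (w : cot X.rcoact (LeftComod.cotensor L (LeftComod.cotensor X N)).coact)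
    (hw : inclRight' X.rcoact L.bicoassoc (LeftComod.cotensor X N).coact w =
      ψ.rTensor (cot X.rcoact N.coact) ((LeftComod.cotensor X N).coact y)) :
    (counitL e N).lTensor X w.1 =
      (contrR X e ∘ₗ ψ.rTensor X ∘ₗ X.lcoact).rTensor N y.1 := by
  have h0 : ∀ t, (cot X.rcoact N.coact).subtype.lTensor (X ⊗[k] L)
      ((TensorProduct.assoc k X L _).symm t) = (TensorProduct.assoc k X L (X ⊗[k] N)).symm
      (((cot X.rcoact N.coact).subtype.lTensor L).lTensor X t) := fun t => by
    rw [LinearEquiv.eq_symm_apply, assoc_nat3, LinearEquiv.apply_symm_apply]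
  have h1 := congrArg ((cot X.rcoact N.coact).subtype.lTensor (X ⊗[k] L)) hw
  rw [← rl_comm, ← subtype_mem_leftHoms, inclRight', LinearMap.comp_apply, LinearMap.comp_apply,
    LinearEquiv.coe_coe, h0, LinearEquiv.symm_apply_eq] at h1
  rw [counitL, inclRight', LinearMap.lTensor_comp_apply, LinearMap.lTensor_comp_apply,
    LinearMap.lTensor_comp_apply]
  have h2 : ((cot X.rcoact N.coact).subtype.lTensor L).lTensor X
      ((cot L.rcoact (LeftComod.cotensor X N).coact).subtype.lTensor X w.1) =
      TensorProduct.assoc k X L (X ⊗[k] N) (ψ.rTensor (X ⊗[k] N)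
        (leftTensor N X.lcoact y.1)) := h1
  rw [h2, leftTensor, LinearMap.comp_apply, LinearMap.rTensor_comp_apply N (contrR X e),
    LinearMap.rTensor_comp_apply N (ψ.rTensor X)]
  generalize X.lcoact.rTensor N y.1 = y
  rw [LinearEquiv.coe_coe]
  refine LinearMap.congr_fun (f := (sliceL N e).lTensor X ∘ₗ
    (TensorProduct.assoc k L X N).symm.toLinearMap.lTensor X ∘ₗ
    (TensorProduct.assoc k X L (X ⊗[k] N)).toLinearMap ∘ₗ ψ.rTensor (X ⊗[k] N) ∘ₗ
      (TensorProduct.assoc k C X N).toLinearMap)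
    (g := (contrR X e).rTensor N ∘ₗ (ψ.rTensor X).rTensor N)
    (TensorProduct.ext_threefold fun c x n => ?_) y
  simp only [LinearMap.comp_apply, LinearMap.rTensor_tmul,
    LinearEquiv.coe_coe, TensorProduct.assoc_tmul]
  generalize ψ c = w
  induction w with
  | zero => simp
  | add x y hx hy => simp only [map_add, TensorProduct.add_tmul, hx, hy]
  | tmul a b => simp [TensorProduct.smul_tmul]

theorem inclRight'_map (X : Bicomod k C D) (Y : Bicomod k D E) {M N : LeftComod k E} (f : M ⟶ N)
    (s : LeftComod.cotensor X (LeftComod.cotensor Y M)) :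
    inclRight' X.rcoact Y.bicoassoc N.coact
        (((cotensorLeft X).map ((cotensorLeft Y).map f)).lin s) =
      f.lin.lTensor (X ⊗[k] Y) (inclRight' X.rcoact Y.bicoassoc M.coact s) := by
  refine (LinearEquiv.symm_apply_eq _).2 ?_
  refine Eq.trans ?_ (assoc_nat3 f.lin _).symm
  refine Eq.trans ?_ (congrArg _ (LinearEquiv.apply_symm_apply _ _).symm)
  change _ = (f.lin.lTensor Y).lTensor X ((cot Y.rcoact M.coact).subtype.lTensor X s.1)
  rw [← LinearMap.lTensor_comp_apply]
  exact (LinearMap.lTensor_comp_apply X _ _ _).symm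

/-- The adjunction between left cotensor functors attached to a dual pair. -/
def IsDualPair.adjunctionLeft (h : IsDualPair L X ψ e) : cotensorLeft L ⊣ cotensorLeft X where
  unit :=
    { app := fun M => ⟨h.unitL M, h.unitL_colin M⟩
      naturality := fun M N f => LeftComod.Hom.ext (LinearMap.ext fun m => by
        refine inclRight'_inj X.rcoact L.bicoassoc N.coact ?_
        refine (h.inclRight'_unitL N (f.lin m)).trans ?_
        refine Eq.trans ?_ (inclRight'_map X L f (h.unitL M m)).symm
        rw [h.inclRight'_unitL, f.colin m, rl_comm]) }
  counit :=
    { app := fun N => ⟨counitL e N, h.counitL_colin N⟩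
      naturality := fun M N f => LeftComod.Hom.ext (LinearMap.ext fun s =>
        (congrArg (sliceL N e) (inclRight'_map L X f s)).trans (sliceL_lTensor e f.lin _)) }
  left_triangle_components := fun M => LeftComod.Hom.ext (LinearMap.ext fun z => Subtype.ext (by
    refine (counitL_cot (h.inclRight'_unitL M) z _ rfl).trans ?_
    rw [h.zigzagL', LinearMap.rTensor_id_apply]
    rfl))
  right_triangle_components := fun N => LeftComod.Hom.ext (LinearMap.ext fun y => Subtype.ext (by
    refine (counitL_lTensor y (h.unitL (LeftComod.cotensor X N) y)
      (h.inclRight'_unitL _ y)).trans ?_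
    rw [h.zigzagR', LinearMap.rTensor_id_apply]
    rfl))

end LeftAdjunction

/-! ### Dual pairs recovered from left-hand adjunctions. -/

section LeftAdjunction

open Module (Dual)

variable {k : Type u} [Field k]
variable {C : Type u} [AddCommGroup C] [Module k C] [Coalgebra k C]
variable {D : Type u} [AddCommGroup D] [Module k D] [Coalgebra k D]
variable {L : Bicomod k D C} {X : Bicomod k C D} {ψ : C →ₗ[k] X ⊗[k] L} {e : Dual k (L ⊗[k] X)}

/-! #### The dual pair attached to an adjunction -/

/-- The comodule `M ⊗ V`, for a vector space `V`. -/
@[reducible] def LeftComod.tensor (V : Type u) [AddCommGroup V] [Module k V]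
    (M : LeftComod k C) : LeftComod k C where
  carrier := M ⊗[k] V
  coact := leftTensor V M.coact
  isCoaction := M.isCoaction.tensor

/-- The colinear map `m ↦ m ⊗ v`. -/
def LeftComod.tensorMk {V : Type u} [AddCommGroup V] [Module k V] (M : LeftComod k C) (v : V) :
    M ⟶ M.tensor V :=
  ⟨(TensorProduct.mk k M V).flip v, mk_mem_leftHoms M.coact v⟩

/-- The coaction, as a colinear map to a cofree comodule. -/
def LeftComod.coactHom (M : LeftComod k C) : M ⟶ (LeftComod.regular k C).tensor M :=
  ⟨M.coact, M.isCoaction.mem_leftHoms⟩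

/-! ### The coevaluation extracted from the left-hand unit. -/

section Unit

variable (adj : cotensorLeft L ⊣ cotensorLeft X)

/-- The unit of an adjunction, as a map `M → (X ⊗ Λ) ⊗ M`. -/
def unitInclL (M : LeftComod k C) : M →ₗ[k] (X ⊗[k] L) ⊗[k] M :=
  inclRight' X.rcoact L.bicoassoc M.coact ∘ₗ (adj.unit.app M).lin

theorem unitInclL_nat {M N : LeftComod k C} (f : M ⟶ N) (m : M) :
    unitInclL adj N (f.lin m) = f.lin.lTensor (X ⊗[k] L) (unitInclL adj M m) := by
  have h := congrArg (fun g => inclRight' X.rcoact L.bicoassoc N.coact (LeftComod.Hom.lin g m))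
    (adj.unit.naturality f)
  exact h.trans (inclRight'_map X L f ((adj.unit.app M).lin m))

/-- Naturality along the maps m ↦ m ⊗ v suffices, as their images span M ⊗ V. -/
theorem unitInclL_tensor (M : LeftComod k C) {V : Type u} [AddCommGroup V] [Module k V]
    (t : M ⊗[k] V) : unitInclL adj (M.tensor V) t =
      TensorProduct.assoc k (X ⊗[k] L) M V ((unitInclL adj M).rTensor V t) := by
  induction t with
  | zero => simp
  | add x y hx hy => rw [map_add, hx, hy, map_add, map_add]
  | tmul m v =>
    refine (unitInclL_nat adj (M.tensorMk v) m).trans ?_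
    rw [LinearMap.rTensor_tmul]
    change ((TensorProduct.mk k M V).flip v).lTensor (X ⊗[k] L) (unitInclL adj M m) = _
    generalize unitInclL adj M m = s
    induction s with
    | zero => simp
    | add x y hx hy => simp only [map_add, TensorProduct.add_tmul, hx, hy]
    | tmul a b => simp

/-- The coevaluation `C → X ⊗ Λ` of an adjunction. -/
def unitCoevL : C →ₗ[k] X ⊗[k] L :=
  sliceR (X ⊗[k] L) Coalgebra.counit ∘ₗ unitInclL adj (LeftComod.regular k C)

/-- As on the right: naturality along M → C ⊗ M, followed by ε_C on the inserted factor C. -/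
theorem unitInclL_eq (M : LeftComod k C) (m : M) :
    unitInclL adj M m = (unitCoevL adj).rTensor M (M.coact m) := by
  have h1 : M.coact.lTensor (X ⊗[k] L) (unitInclL adj M m) =
      TensorProduct.assoc k (X ⊗[k] L) C M
        ((unitInclL adj (LeftComod.regular k C)).rTensor M (M.coact m)) :=
    (unitInclL_nat adj M.coactHom m).symm.trans
      (unitInclL_tensor adj (LeftComod.regular k C) (M.coact m))
  have h2 : (sliceL M Coalgebra.counit).lTensor (X ⊗[k] L) ∘ₗ
      (TensorProduct.assoc k (X ⊗[k] L) C M).toLinearMap =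
      (sliceR (X ⊗[k] L) Coalgebra.counit).rTensor M :=
    TensorProduct.ext_threefold fun a b c => by simp [TensorProduct.smul_tmul]
  have h3 := LinearMap.congr_fun h2
    ((unitInclL adj (LeftComod.regular k C)).rTensor M (M.coact m))
  rw [LinearMap.comp_apply, LinearEquiv.coe_coe, ← h1, ← LinearMap.lTensor_comp_apply,
    show sliceL M Coalgebra.counit ∘ₗ M.coact = LinearMap.id from
    LinearMap.ext (sliceL_counit_coact M.isCoaction), LinearMap.lTensor_id_apply] at h3
  rw [unitCoevL, LinearMap.rTensor_comp_apply]
  exact h3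

theorem unitCoevL_mem (c : C) : unitCoevL adj c ∈ cot X.rcoact L.lcoact := by
  obtain ⟨s, hs⟩ := (cotAssoc X.rcoact L.bicoassoc (LeftComod.regular k C).coact).surjective
    ((adj.unit.app (LeftComod.regular k C)).lin c)
  have h := inclRight'_cotAssoc X.rcoact L.bicoassoc (LeftComod.regular k C).coact s
  rw [hs] at h
  change sliceR (X ⊗[k] L) Coalgebra.counit
    (inclRight' X.rcoact L.bicoassoc (LeftComod.regular k C).coact
      ((adj.unit.app (LeftComod.regular k C)).lin c)) ∈ _
  rw [h, sliceR_rTensor]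
  exact Subtype.coe_prop _

/-- Compared with the right-hand adjunction the two colinearities change roles. The one for the
coaction of Λ now comes from the cotensor condition over C at the regular comodule, sliced by ε_C,
together with `unitInclL_eq`. -/
theorem unitCoevL_right_colin :
    unitCoevL adj ∈ rightHoms Coalgebra.comul (rightTensor X L.rcoact) := fun c => by
  have h := lTensor_inclRight' X.rcoact L.bicoassoc (LeftComod.regular k C).coact
    ((adj.unit.app (LeftComod.regular k C)).lin c)
  have h' := congrArg (sliceR ((X ⊗[k] L) ⊗[k] C) Coalgebra.counit)
    ((LinearEquiv.eq_symm_apply _).2 h)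
  rw [sliceR_rTensor] at h'
  refine h'.trans (Eq.trans ?_ (unitInclL_eq adj (LeftComod.regular k C) c))
  change _ = inclRight' X.rcoact L.bicoassoc (LeftComod.regular k C).coact _
  generalize inclRight' X.rcoact L.bicoassoc (LeftComod.regular k C).coact
    ((adj.unit.app (LeftComod.regular k C)).lin c) = s
  have h2 : ∀ t : (X ⊗[k] L) ⊗[k] (C ⊗[k] C), sliceR ((X ⊗[k] L) ⊗[k] C) Coalgebra.counit
      ((TensorProduct.assoc k (X ⊗[k] L) C C).symm t) =
      (sliceR C Coalgebra.counit).lTensor (X ⊗[k] L) t := fun t => by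
    obtain ⟨t, rfl⟩ := (TensorProduct.assoc k (X ⊗[k] L) C C).surjective t
    rw [LinearEquiv.symm_apply_apply]
    exact LinearMap.congr_fun (f := sliceR ((X ⊗[k] L) ⊗[k] C) Coalgebra.counit)
      (g := (sliceR C Coalgebra.counit).lTensor (X ⊗[k] L) ∘ₗ
        (TensorProduct.assoc k (X ⊗[k] L) C C).toLinearMap)
      (TensorProduct.ext_threefold fun a b c => by simp) t
  have h3 := h2 ((LeftComod.regular k C).coact.lTensor (X ⊗[k] L) s)
  rw [← LinearMap.lTensor_comp_apply,
    show sliceR C Coalgebra.counit ∘ₗ (LeftComod.regular k C).coact = LinearMap.id from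
      LinearMap.ext (sliceR_counit_coact (RightComod.regular k C).isCoaction),
    LinearMap.lTensor_id_apply] at h3
  exact h3

theorem unitCoevL_left_colin :
    unitCoevL adj ∈ leftHoms Coalgebra.comul (leftTensor L X.lcoact) :=
  leftHoms_comp (sliceR_mem_leftHoms Coalgebra.counit _)
    (leftHoms_comp (inclRight'_mem_leftHoms X L (LeftComod.regular k C))
      (adj.unit.app (LeftComod.regular k C)).colin)

end Unit

/-! ### The evaluation extracted from the left-hand counit. -/

section Counit

variable (adj : cotensorLeft L ⊣ cotensorLeft X)

/-- The counit of an adjunction, as a linear map. -/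
def counitLinL (N : LeftComod k D) : cot L.rcoact (LeftComod.cotensor X N).coact →ₗ[k] N :=
  (adj.counit.app N).lin

theorem counitLinL_nat {M N : LeftComod k D} (f : M ⟶ N)
    (s : LeftComod.cotensor L (LeftComod.cotensor X M)) :
    counitLinL adj N (((cotensorLeft L).map ((cotensorLeft X).map f)).lin s) =
      f.lin (counitLinL adj M s) :=
  congrArg (fun g => LeftComod.Hom.lin g s) (adj.counit.naturality f)

theorem exists_counitLinL_tensor (N : LeftComod k D) {V : Type u} [AddCommGroup V] [Module k V]
    (t : cot L.rcoact (LeftComod.cotensor X N).coact ⊗[k] V) :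
    ∃ s : cot L.rcoact (LeftComod.cotensor X (N.tensor V)).coact,
      inclRight' L.rcoact X.bicoassoc (N.tensor V).coact s =
        TensorProduct.assoc k (L ⊗[k] X) N V
          ((inclRight' L.rcoact X.bicoassoc N.coact).rTensor V t) ∧
      counitLinL adj (N.tensor V) s = (counitLinL adj N).rTensor V t := by
  induction t with
  | zero => exact ⟨0, by simp, by simp⟩
  | add x y hx hy =>
    obtain ⟨s, h1, h2⟩ := hx
    obtain ⟨s', h3, h4⟩ := hy
    exact ⟨s + s', by simp only [map_add, h1, h3], by simp only [map_add, h2, h4]⟩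
  | tmul s v =>
    refine ⟨((cotensorLeft L).map ((cotensorLeft X).map (N.tensorMk v))).lin s, ?_,
      counitLinL_nat adj (N.tensorMk v) s⟩
    refine (inclRight'_map L X (N.tensorMk v) s).trans ?_
    rw [LinearMap.rTensor_tmul]
    change ((TensorProduct.mk k N V).flip v).lTensor (L ⊗[k] X)
      (inclRight' L.rcoact X.bicoassoc N.coact s) = _
    generalize inclRight' L.rcoact X.bicoassoc N.coact s = s
    induction s with
    | zero => simp
    | add x y hx hy => simp only [map_add, TensorProduct.add_tmul, hx, hy]
    | tmul a b => simp

theorem rightUnit_mem_leftHoms (X : Bicomod k C D) :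
    rightUnit X.toRight ∈ leftHoms X.lcoact (leftCot X.bicoassoc (LeftComod.regular k D).coact) :=
  mem_leftHoms_leftCot X.bicoassoc (lN := (LeftComod.regular k D).coact)
    (f := rightUnit X.toRight) X.bicoassoc.mem_leftHoms

/-- The evaluation `Λ □_C X → D` of an adjunction. -/
def counitEvL : cot L.rcoact X.lcoact →ₗ[k] D :=
  counitLinL adj (LeftComod.regular k D) ∘ₗ
    cotMap (rightHoms_id L.rcoact) (rightUnit_mem_leftHoms X)

/-- Naturality along N → D ⊗ N reduces to the counit at D. The cotensor condition over D replaces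
the coaction of N by that of X, and ε_D recovers e. -/
theorem counitLinL_eq (he : e ∘ₗ (cot L.rcoact X.lcoact).subtype =
    Coalgebra.counit ∘ₗ counitEvL adj) (N : LeftComod k D)
    (s : cot L.rcoact (LeftComod.cotensor X N).coact) : counitLinL adj N s = counitL e N s := by
  let t : cot L.rcoact X.lcoact ⊗[k] N := ((cotAssoc L.rcoact X.bicoassoc N.coact).symm s).1
  have ht : (cot L.rcoact X.lcoact).subtype.rTensor N t =
      inclRight' L.rcoact X.bicoassoc N.coact s :=
    (LinearEquiv.eq_symm_apply _).2 (inclLeft_cotAssoc_symm L.rcoact X.bicoassoc N.coact s)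
  obtain ⟨s', h1, h2⟩ := exists_counitLinL_tensor adj (LeftComod.regular k D) (V := N)
    ((cotMap (rightHoms_id L.rcoact) (rightUnit_mem_leftHoms X)).rTensor N t)
  have h3 : ((cotensorLeft L).map ((cotensorLeft X).map N.coactHom)).lin s = s' := by
    refine inclRight'_inj L.rcoact X.bicoassoc ((LeftComod.regular k D).tensor N).coact ?_
    refine (inclRight'_map L X N.coactHom s).trans ?_
    refine Eq.trans ?_ h1.symm
    refine (lTensor_inclRight' L.rcoact X.bicoassoc N.coact s).symm.trans ?_
    rw [← ht, ← LinearMap.rTensor_comp_apply, ← LinearMap.rTensor_comp_apply]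
    congr 3
    refine LinearMap.ext fun z => ?_
    refine congrArg (TensorProduct.assoc k L X D).symm ?_
    exact (LinearMap.lTensor_comp_apply L (cot _ _).subtype (rightUnit X.toRight) z.1)
  have h4 := counitLinL_nat adj N.coactHom s
  rw [h3, h2, ← LinearMap.rTensor_comp_apply] at h4
  have h5 := congrArg (sliceL N Coalgebra.counit) h4
  rw [sliceL_rTensor] at h5
  refine ((sliceL_counit_coact N.isCoaction _).symm.trans h5.symm).trans ?_
  have h6 : Coalgebra.counit ∘ₗ counitLinL adj (LeftComod.regular k D) ∘ₗ
    cotMap (rightHoms_id L.rcoact) (rightUnit_mem_leftHoms X) =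
      e ∘ₗ (cot L.rcoact X.lcoact).subtype := he.symm
  rw [h6, ← sliceL_rTensor, ht]
  rfl

end Counit

/-- The left triangle at C now yields the first zigzag and the right triangle at D the second,
opposite to the right-hand case. Both adjunctions therefore lead to the same notion of dual pair. -/
theorem exists_isDualPair_of_adjunctionLeft (adj : cotensorLeft L ⊣ cotensorLeft X) :
    ∃ (ψ : C →ₗ[k] X ⊗[k] L) (e : Dual k (L ⊗[k] X)), IsDualPair L X ψ e := by
  obtain ⟨e, he⟩ := LinearMap.exists_extend
    ((Coalgebra.counit (R := k) (A := D)) ∘ₗ counitEvL adj)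
  refine ⟨unitCoevL adj, e, unitCoevL_left_colin adj, unitCoevL_right_colin adj,
    unitCoevL_mem adj, fun l => ?_, fun x => ?_⟩
  · have h := congrArg (fun g : (cotensorLeft L).obj (LeftComod.regular k C) ⟶ (cotensorLeft L).obj
      (LeftComod.regular k C) => (g.lin (rightUnit L.toRight l)).1)
      (adj.left_triangle_components (LeftComod.regular k C))
    have h1 := counitL_cot (e := e) (unitInclL_eq adj (LeftComod.regular k C))
      (rightUnit L.toRight l)
      (((cotensorLeft L).map (adj.unit.app (LeftComod.regular k C))).lin (rightUnit L.toRight l))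
      rfl
    have h1' := (congrArg Subtype.val (counitLinL_eq adj he
      (LeftComod.cotensor L (LeftComod.regular k C)) (((cotensorLeft L).map
        (adj.unit.app (LeftComod.regular k C))).lin (rightUnit L.toRight l)))).trans h1
    have h2 := congrArg (sliceR L Coalgebra.counit) (h1'.symm.trans h)
    rw [sliceR_rTensor] at h2
    have h3 := sliceR_counit_coact L.isRight l
    refine Eq.trans ?_ (h2.trans h3)
    exact congrArg (contrL L e ∘ₗ (unitCoevL adj).lTensor L ∘ₗ L.rcoact) h3.symm
  · have h := congrArg (fun g : (cotensorLeft X).obj (LeftComod.regular k D) ⟶ (cotensorLeft X).obj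
      (LeftComod.regular k D) => (g.lin (rightUnit X.toRight x)).1)
      (adj.right_triangle_components (LeftComod.regular k D))
    have h1 := counitL_lTensor (e := e) (N := LeftComod.regular k D) (rightUnit X.toRight x) _
      (unitInclL_eq adj (LeftComod.cotensor X (LeftComod.regular k D)) (rightUnit X.toRight x))
    rw [← show counitLinL adj (LeftComod.regular k D) = counitL e _ from
      LinearMap.ext (counitLinL_eq adj he _)] at h1
    have h2 := congrArg (sliceR X Coalgebra.counit) (h1.symm.trans h)
    rw [sliceR_rTensor] at h2
    have h3 := sliceR_counit_coact X.isRight x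
    refine Eq.trans ?_ (h2.trans h3)
    exact congrArg (contrR X e ∘ₗ (unitCoevL adj).rTensor X ∘ₗ X.lcoact) h3.symm

end LeftAdjunction

/-! ### Dual pairs, quasifiniteness and injectivity on the left -/

section LeftInjective

open Module (Dual)

variable {k : Type u} [Field k]
variable {C : Type u} [AddCommGroup C] [Module k C] [Coalgebra k C]
variable {D : Type u} [AddCommGroup D] [Module k D] [Coalgebra k D]
variable {L : Bicomod k D C} {X : Bicomod k C D} {ψ : C →ₗ[k] X ⊗[k] L} {e : Dual k (L ⊗[k] X)}

/-- The second zigzag recovers f from the functional e ∘ (Λ ⊗ f), evaluated on a tensor independent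
of f. -/
theorem IsDualPair.apply_eq_sliceR (h : IsDualPair L X ψ e) {V : LeftComod k C}
    {f : V →ₗ[k] X} (hf : f ∈ leftHoms V.coact X.lcoact) (v : V) :
    f v = sliceR X (e ∘ₗ f.lTensor L)
      (TensorProduct.assoc k X L V (ψ.rTensor V (V.coact v))) := by
  rw [← sliceR_lTensor]
  refine (h.zigzagR (f v)).symm.trans ?_
  rw [hf v, rl_comm, contrR, LinearMap.comp_apply, LinearEquiv.coe_coe, assoc_nat3]

theorem IsDualPair.quasifinite_toLeft (h : IsDualPair L X ψ e) : X.toLeft.Quasifinite := by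
  intro V hV
  let b := Module.finBasis k V
  let u : V →ₗ[k] X ⊗[k] (L ⊗[k] V) :=
    (TensorProduct.assoc k X L V).toLinearMap ∘ₗ ψ.rTensor V ∘ₗ V.coact
  choose S hS hS' using fun i => exists_finite_sliceL (u (b i))
  let T : Submodule k (L ⊗[k] V) := ⨆ i, S i
  have hT : Module.Finite k T := Submodule.finite_iSup S
  let Φ : leftHoms V.coact X.lcoact →ₗ[k] Dual k T :=
    { toFun := fun f => (e ∘ₗ f.1.lTensor L) ∘ₗ T.subtype
      map_add' := fun f g => by
        rw [Submodule.coe_add, LinearMap.lTensor_add, LinearMap.comp_add, LinearMap.add_comp]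
      map_smul' := fun c f => by
        rw [Submodule.coe_smul, LinearMap.lTensor_smul, LinearMap.comp_smul, LinearMap.smul_comp]
        rfl }
  refine Module.Finite.of_injective Φ ((injective_iff_map_eq_zero Φ).2 fun f hf => ?_)
  refine Subtype.ext (b.ext fun i => ?_)
  refine (Module.forall_dual_apply_eq_zero_iff k _).1 fun ξ => ?_
  have key : ∀ (g : Dual k (L ⊗[k] V)) (t : X ⊗[k] (L ⊗[k] V)),
      ξ (sliceR X g t) = g (sliceL (L ⊗[k] V) ξ t) := by
    intro g t
    induction t with
    | zero => simp
    | add x y hx hy => simp only [map_add, hx, hy]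
    | tmul a w => simp [mul_comm]
  rw [h.apply_eq_sliceR f.2, key]
  exact LinearMap.congr_fun hf ⟨_, Submodule.mem_iSup_of_mem i (hS' i ξ)⟩

theorem LeftComod.injective_of_mono {M N : LeftComod k C} (f : M ⟶ N) [Mono f] :
    Function.Injective f.lin := by
  rw [← LinearMap.ker_eq_bot]
  let K := LinearMap.ker f.lin
  have hK : ∀ x : K, (M.coact ∘ₗ K.subtype) x ∈ LinearMap.range (K.subtype.lTensor C) := by
    intro x
    rw [mem_range_lTensor_ker]
    refine (f.colin x.1).symm.trans ?_
    rw [LinearMap.mem_ker.1 x.2, map_zero]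
  let ρ := lift (K.subtype.lTensor C) (lTensor_inj K.injective_subtype) (M.coact ∘ₗ K.subtype) hK
  have hρ : K.subtype ∈ leftHoms ρ M.coact := fun s => (lift_spec _ _ _ hK s).symm
  let KM : LeftComod k C := ⟨K, ρ, M.isCoaction.of_inj K.injective_subtype hρ⟩
  let i : KM ⟶ M := ⟨K.subtype, hρ⟩
  let z : KM ⟶ M := ⟨0, Submodule.zero_mem _⟩
  have hiz : i = z := by
    rw [← cancel_mono f]
    refine LeftComod.Hom.ext (LinearMap.ext fun x => ?_)
    exact (LinearMap.mem_ker.1 x.2).trans (map_zero f.lin).symm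
  rw [eq_bot_iff]
  intro x hx
  exact LinearMap.congr_fun (congrArg LeftComod.Hom.lin hiz) (⟨x, hx⟩ : K)

theorem LeftComod.mono_of_injective {M N : LeftComod k C} (f : M ⟶ N)
    (hf : Function.Injective f.lin) : Mono f where
  right_cancellation _ _ hgh := LeftComod.Hom.ext (LinearMap.ext fun x =>
    hf (LinearMap.congr_fun (congrArg LeftComod.Hom.lin hgh) x))

/-- By the second zigzag this is a colinear retraction of the coaction X → C ⊗ X, the source of the
injectivity of X. -/
theorem IsDualPair.contrR_colin (h : IsDualPair L X ψ e) :
    contrR X e ∘ₗ ψ.rTensor X ∈ leftHoms (leftTensor X Coalgebra.comul) X.lcoact := by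
  refine leftHoms_comp ?_ (rTensor_mem_leftHoms h.left_colin)
  exact leftHoms_comp (sliceR_mem_leftHoms e X.lcoact) (assoc_mem_leftHoms X.lcoact)

theorem IsDualPair.injective_toLeft (h : IsDualPair L X ψ e) : Injective X.toLeft where
  factors {A B} g f _ := by
    obtain ⟨p, hp⟩ := LinearMap.exists_leftInverse_of_injective f.lin
      (LinearMap.ker_eq_bot.2 (LeftComod.injective_of_mono f))
    refine ⟨⟨(contrR X e ∘ₗ ψ.rTensor X) ∘ₗ (g.lin ∘ₗ p).lTensor C ∘ₗ B.coact,
      leftHoms_comp h.contrR_colin (leftHoms_comp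
        (map_mem_leftHoms (g.lin ∘ₗ p) (leftHoms_id Coalgebra.comul))
        B.isCoaction.mem_leftHoms)⟩, LeftComod.Hom.ext (LinearMap.ext fun a => ?_)⟩
    change contrR X e (ψ.rTensor X ((g.lin ∘ₗ p).lTensor C (B.coact (f.lin a)))) = g.lin a
    rw [f.colin a, ← LinearMap.lTensor_comp_apply, LinearMap.comp_assoc, hp, LinearMap.comp_id,
      ← g.colin a]
    exact h.zigzagR (g.lin a)

/-- The left-handed universal property of ψ: only the second zigzag is assumed, so the first can be
deduced from it when X is injective. -/
theorem contrL_lTensor_eq (hψ : ψ ∈ rightHoms Coalgebra.comul (rightTensor X L.rcoact))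
    (hz : ∀ x, contrR X e (ψ.rTensor X (X.lcoact x)) = x)
    {H : Type u} [AddCommGroup H] [Module k H] {φ : C →ₗ[k] X ⊗[k] H}
    (hφ : φ ∈ leftHoms Coalgebra.comul (leftTensor H X.lcoact)) (c : C) :
    (contrL H e ∘ₗ φ.lTensor L ∘ₗ L.rcoact).lTensor X (ψ c) = φ c := by
  have h1 : L.rcoact.lTensor X (ψ c) =
      TensorProduct.assoc k X L C (ψ.rTensor C (Coalgebra.comul c)) :=
    (LinearEquiv.symm_apply_eq _).1 (hψ c)
  have h2 : (TensorProduct.assoc k C X H).symm (φ.lTensor C (Coalgebra.comul c)) =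
      X.lcoact.rTensor H (φ c) := (LinearEquiv.symm_apply_eq _).2 (hφ c).symm
  have h3 : (contrL H e ∘ₗ φ.lTensor L).lTensor X ∘ₗ
      (TensorProduct.assoc k X L C).toLinearMap ∘ₗ ψ.rTensor C =
      (contrR X e ∘ₗ ψ.rTensor X).rTensor H ∘ₗ
        (TensorProduct.assoc k C X H).symm.toLinearMap ∘ₗ φ.lTensor C :=
    TensorProduct.ext' fun a b => by
      have key : ∀ w : X ⊗[k] H, (contrR X e ∘ₗ ψ.rTensor X).rTensor H
          ((TensorProduct.assoc k C X H).symm (a ⊗ₜ w)) =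
          (contrL H e).lTensor X (TensorProduct.assoc k X L (X ⊗[k] H) (ψ a ⊗ₜ w)) := by
        intro w
        induction w with
        | zero => simp
        | add x y hx hy => simp only [map_add, TensorProduct.tmul_add, hx, hy]
        | tmul x l =>
          simp only [TensorProduct.assoc_symm_tmul, LinearMap.rTensor_tmul, LinearMap.comp_apply]
          generalize ψ a = v
          induction v with
          | zero => simp
          | add x y hx hy => simp only [map_add, TensorProduct.add_tmul, hx, hy]
          | tmul y l' => simp [TensorProduct.smul_tmul]
      rw [LinearMap.comp_apply, LinearMap.comp_apply, LinearMap.comp_apply, LinearMap.comp_apply,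
        LinearMap.lTensor_tmul, LinearMap.rTensor_tmul, LinearMap.lTensor_comp_apply,
        LinearEquiv.coe_coe, LinearEquiv.coe_coe, ← assoc_nat3, LinearMap.lTensor_tmul]
      exact (key (φ b)).symm
  have h4 := LinearMap.congr_fun h3 (Coalgebra.comul c)
  simp only [LinearMap.comp_apply, LinearEquiv.coe_coe] at h4
  rw [← LinearMap.comp_assoc, LinearMap.lTensor_comp_apply, h1]
  refine h4.trans ?_
  rw [h2, ← LinearMap.rTensor_comp_apply, LinearMap.comp_assoc,
    show contrR X e ∘ₗ ψ.rTensor X ∘ₗ X.lcoact = LinearMap.id from LinearMap.ext hz,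
    LinearMap.rTensor_id_apply]

theorem descL_mem_rightHoms {M N W : Type u} [AddCommGroup M] [Module k M] [AddCommGroup N]
    [Module k N] [AddCommGroup W] [Module k W] {l : M →ₗ[k] C ⊗[k] M} (hl : IsLeftCoaction l)
    {lN : N →ₗ[k] C ⊗[k] N}
    (hq : ∀ V : LeftComod k C, Module.Finite k V → Module.Finite k (leftHoms V.coact lN))
    {rM : M →ₗ[k] M ⊗[k] D} (hM : Bicoassoc l rM) {rW : W →ₗ[k] W ⊗[k] D} {g : M →ₗ[k] N ⊗[k] W}
    (hg : g ∈ leftHoms l (leftTensor W lN)) (hg' : g ∈ rightHoms rM (rightTensor N rW)) :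
    descL hl hq hg ∈ rightHoms (lambdaL hl hq hM) rW := by
  refine LinearMap.congr_fun (f := rW ∘ₗ descL hl hq hg)
    (g := (descL hl hq hg).rTensor D ∘ₗ lambdaL hl hq hM) (etaL_ext hl hq fun m => ?_)
  rw [LinearMap.lTensor_comp_apply, LinearMap.lTensor_comp_apply, descL_spec,
    lambdaL_spec, ← assoc_nat2, ← LinearMap.rTensor_comp_apply,
    show (descL hl hq hg).lTensor N ∘ₗ etaL hl hq = g from LinearMap.ext (descL_spec hl hq hg)]
  exact (LinearEquiv.symm_apply_eq _).1 (hg' m)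

/-- The comparison map `_Ch(X, C) → Λ` of a dual pair. -/
def IsDualPair.fromCoHomLeft (h : IsDualPair L X ψ e) (hX : X.toLeft.Quasifinite) :
    Bicomod.coHomLeft X hX ⟶ L where
  lin := descL (LeftComod.regular k C).isCoaction hX h.left_colin
  lcolin := descL_colin _ hX X.bicoassoc h.left_colin h.mem
  rcolin := descL_mem_rightHoms (LeftComod.regular k C).isCoaction hX
    (Bicomod.regular k C).bicoassoc h.left_colin h.right_colin

/-- The bicomodule `Λ` of a dual pair is the co-Hom bicomodule `_Ch(X, C)`. -/
def IsDualPair.isoCoHomLeft (h : IsDualPair L X ψ e) (hX : X.toLeft.Quasifinite) :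
    L ≅ Bicomod.coHomLeft X hX :=
  (Bicomod.isoOfInverse (h.fromCoHomLeft hX)
    (contrL _ e ∘ₗ (etaL (LeftComod.regular k C).isCoaction hX).lTensor L ∘ₗ L.rcoact)
    (LinearMap.ext fun l => by
      have h2 : (h.fromCoHomLeft hX).lin ∘ₗ contrL _ e ∘ₗ
          (etaL (LeftComod.regular k C).isCoaction hX).lTensor L = contrL L e ∘ₗ ψ.lTensor L :=
        TensorProduct.ext' fun l c => (contrL_nat e (h.fromCoHomLeft hX).lin l _).trans
          (congrArg (fun t => contrL L e (l ⊗ₜ[k] t)) (descL_spec _ hX h.left_colin c))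
      exact (LinearMap.congr_fun h2 (L.rcoact l)).trans (h.zigzagL l))
    (etaL_ext (LeftComod.regular k C).isCoaction hX fun c => by
      rw [LinearMap.lTensor_comp_apply, LinearMap.lTensor_id_apply]
      refine (congrArg _ (descL_spec _ hX h.left_colin c)).trans ?_
      exact contrL_lTensor_eq h.right_colin h.zigzagR
        (etaL_colin (LeftComod.regular k C).isCoaction hX) c)).symm

/-- A colinear retraction C ⊗ X → X gives, for each x, a colinear map C → X. Pairing these with the
co-Hom space defines e and yields the second zigzag; the first follows from universality of η. -/
theorem exists_isDualPair_of_injective_toLeft (hX : X.toLeft.Quasifinite)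
    (hinj : Injective X.toLeft) (i : L ≅ Bicomod.coHomLeft X hX) :
    ∃ (ψ : C →ₗ[k] X ⊗[k] L) (e : Dual k (L ⊗[k] X)), IsDualPair L X ψ e := by
  let η := etaL (LeftComod.regular k C).isCoaction hX
  have hη : η ∈ leftHoms Coalgebra.comul (leftTensor _ X.lcoact) := etaL_colin _ hX
  let q : Bicomod.coHomLeft X hX →ₗ[k] L := i.inv.lin
  let q' : L →ₗ[k] Bicomod.coHomLeft X hX := i.hom.lin
  have hq : q' ∘ₗ q = LinearMap.id := congrArg Bicomod.Hom.lin i.inv_hom_id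
  have hq' : q ∘ₗ q' = LinearMap.id := congrArg Bicomod.Hom.lin i.hom_inv_id
  have hmono : Mono X.toLeft.coactHom := LeftComod.mono_of_injective _
    (Function.LeftInverse.injective (sliceL_counit_coact X.isLeft))
  let π := Injective.factorThru (𝟙 X.toLeft) X.toLeft.coactHom
  have hπ : ∀ x, π.lin (X.lcoact x) = x := fun x => LinearMap.congr_fun
    (congrArg LeftComod.Hom.lin (Injective.comp_factorThru (𝟙 X.toLeft) X.toLeft.coactHom)) x
  let P : X →ₗ[k] leftHoms (Coalgebra.comul (R := k) (A := C)) X.lcoact :=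
    (TensorProduct.curry π.lin).flip.codRestrict _ fun x =>
      leftHoms_comp π.colin (mk_mem_leftHoms Coalgebra.comul x)
  -- The outer flip restores the order Λ ⊗ X: the co-Hom space now stands for Λ, and the colinear
  -- maps are indexed by X.
  let e : Dual k (L ⊗[k] X) := TensorProduct.lift ((inclL _ _ ∘ₗ q').flip ∘ₗ P).flip
  have he : ∀ l x, e (l ⊗ₜ x) = pairL (P x) (q' l) := fun l x => rfl
  let ψ : C →ₗ[k] X ⊗[k] L := q.lTensor X ∘ₗ η
  have hψ : contrR X e ∘ₗ ψ.rTensor X = π.lin := TensorProduct.ext' fun c x => by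
    have h1 : ∀ w : X ⊗[k] L, contrR X e (w ⊗ₜ x) = sliceR X (pairL (P x) ∘ₗ q') w := by
      intro w
      induction w with
      | zero => simp
      | add x y hx hy => simp only [map_add, TensorProduct.add_tmul, hx, hy]
      | tmul x l' => simp [he]
    have h2 : pairL (P x) ∘ₗ q' ∘ₗ q = pairL (P x) := by rw [hq]; rfl
    rw [LinearMap.comp_apply, LinearMap.rTensor_tmul, h1, LinearMap.comp_apply, sliceR_lTensor,
      LinearMap.comp_assoc, h2]
    exact etaL_pair (LeftComod.regular k C).isCoaction hX (P x) c
  have hz : ∀ x, contrR X e (ψ.rTensor X (X.lcoact x)) = x := fun x =>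
    (LinearMap.congr_fun hψ (X.lcoact x)).trans (hπ x)
  have hright : ψ ∈ rightHoms Coalgebra.comul (rightTensor X L.rcoact) := by
    refine rightHoms_comp (lTensor_mem_rightHoms i.inv.rcolin) fun c => ?_
    exact (LinearEquiv.symm_apply_eq _).2
      (lambdaL_spec (LeftComod.regular k C).isCoaction hX (Bicomod.regular k C).bicoassoc c)
  have hleft : ψ ∈ leftHoms Coalgebra.comul (leftTensor L X.lcoact) :=
    leftHoms_comp (map_mem_leftHoms q (leftHoms_id X.lcoact)) hη
  refine ⟨ψ, e, hleft, hright, fun c => ?_, fun l => ?_, hz⟩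
  · exact map_mem_cot (rightHoms_id X.rcoact) i.inv.lcolin _
      (etaL_mem_cot (LeftComod.regular k C).isCoaction hX X.bicoassoc c)
  · have h1 : (contrL L e ∘ₗ ψ.lTensor L ∘ₗ L.rcoact) ∘ₗ q = q :=
      etaL_ext (LeftComod.regular k C).isCoaction hX fun c => by
        rw [LinearMap.lTensor_comp_apply]
        exact contrL_lTensor_eq hright hz hleft c
    have h2 := LinearMap.congr_fun h1 (q' l)
    have h3 : q (q' l) = l := LinearMap.congr_fun hq' l
    rw [LinearMap.comp_apply, h3] at h2
    exact h2

end LeftInjective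

end

end MoritaTakeuchi

/-! ### Assembly of the equivalences through dual pairs. -/

theorem theorem4p2 {k : Type u} [Field k]
    {C : Type u} [AddCommGroup C] [Module k C] [Coalgebra k C]
    {D : Type u} [AddCommGroup D] [Module k D] [Coalgebra k D]
    (L : Bicomod k D C) (X : Bicomod k C D) :
    List.TFAE [
      Nonempty (cotensorRight X ⊣ cotensorRight L),
      Nonempty (cotensorLeft L ⊣ cotensorLeft X),
      ∃ h : L.toRight.Quasifinite, Nonempty (cotensorRight X ≅ coHomRight L h),
      ∃ h : X.toLeft.Quasifinite, Nonempty (cotensorLeft L ≅ coHomLeft X h),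
      ∃ (ψ : Bicomod.regular k C ⟶ X.cotensor L) (ω : L.cotensor X ⟶ Bicomod.regular k D),
        TriangleLeft L X ψ ω ∧ TriangleRight L X ψ ω] ∧
    ((∃ h : L.toRight.Quasifinite, Injective L.toRight ∧ Nonempty (X ≅ Bicomod.coHomRight L h)) →
      Nonempty (cotensorRight X ⊣ cotensorRight L)) ∧
    ((∃ h : X.toLeft.Quasifinite, Injective X.toLeft ∧ Nonempty (L ≅ Bicomod.coHomLeft X h)) →
      Nonempty (cotensorRight X ⊣ cotensorRight L)) ∧
    (X.toRight.Quasifinite → Nonempty (cotensorRight X ⊣ cotensorRight L) →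
      ∃ h : L.toRight.Quasifinite,
        Injective L.toRight ∧ Nonempty (X ≅ Bicomod.coHomRight L h)) ∧
    (L.toLeft.Quasifinite → Nonempty (cotensorRight X ⊣ cotensorRight L) →
      ∃ h : X.toLeft.Quasifinite,
        Injective X.toLeft ∧ Nonempty (L ≅ Bicomod.coHomLeft X h)) := by
  refine ⟨?_, ?_, ?_, ?_, ?_⟩
  · rw [exists_triangles_iff]
    -- Property 5 now reads as the existence of a dual pair, the hub of the cycle. Properties 3 and
    -- 4 pass to 1 and 2 by transporting the co-Hom adjunctions, and come back from 5 by uniqueness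
    -- of left adjoints.
    tfae_have 1 → 5 := fun ⟨adj⟩ => exists_isDualPair_of_adjunctionRight adj
    tfae_have 2 → 5 := fun ⟨adj⟩ => exists_isDualPair_of_adjunctionLeft adj
    tfae_have 3 → 1 := fun ⟨h, ⟨i⟩⟩ => ⟨(coHomRightAdjunction L h).ofNatIsoLeft i.symm⟩
    tfae_have 4 → 2 := fun ⟨h, ⟨i⟩⟩ => ⟨(coHomLeftAdjunction X h).ofNatIsoLeft i.symm⟩
    tfae_have 5 → 3 := fun ⟨_, _, h⟩ => ⟨h.quasifinite_toRight,
      ⟨h.adjunctionRight.leftAdjointUniq (coHomRightAdjunction L h.quasifinite_toRight)⟩⟩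
    tfae_have 5 → 4 := fun ⟨_, _, h⟩ => ⟨h.quasifinite_toLeft,
      ⟨h.adjunctionLeft.leftAdjointUniq (coHomLeftAdjunction X h.quasifinite_toLeft)⟩⟩
    tfae_finish
  · rintro ⟨hL, hinj, ⟨i⟩⟩
    obtain ⟨_, _, h⟩ := exists_isDualPair_of_injective_toRight hL hinj i
    exact ⟨h.adjunctionRight⟩
  · rintro ⟨hX, hinj, ⟨i⟩⟩
    -- A dual pair has no preferred side, so left-hand data also produce the right-hand adjunction.
    obtain ⟨_, _, h⟩ := exists_isDualPair_of_injective_toLeft hX hinj i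
    exact ⟨h.adjunctionRight⟩
  · rintro - ⟨adj⟩
    obtain ⟨_, _, h⟩ := exists_isDualPair_of_adjunctionRight adj
    exact ⟨h.quasifinite_toRight, h.injective_toRight, ⟨h.isoCoHomRight h.quasifinite_toRight⟩⟩
  · rintro - ⟨adj⟩
    obtain ⟨_, _, h⟩ := exists_isDualPair_of_adjunctionRight adj
    exact ⟨h.quasifinite_toLeft, h.injective_toLeft, ⟨h.isoCoHomLeft h.quasifinite_toLeft⟩⟩
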